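/- Let $V$ be a complex vector space of even dimension $n=2m$ with a non-degenerate skew-symmetric form $\omega$, let $0=F_0\subset F_1\subset\dots\subset F_m$ be a complete isotropic flag ($\dim F_i=i$), and let $1\le k$. Let $SG(k,n)$ be the variety of $k$-dimensional isotropic subspaces of $V$. Let $(a;b)$ be a Schubert index for $SG(k,n)$: integers $1\le a_1<\dots<a_s\le m$ and $0\le b_1<\dots<b_{k-s}\le m-1$, $0\le s\le k$, with $a_i\ne b_j+1$ for all $i,j$. The Schubert variety $\Sigma_{a;b}$ is the Zariski closure in $SG(k,n)$ of the locus of $\Lambda$ with $\dim(\Lambda\cap F_{a_i})=i$ for $1\le i\le s$ and $\dim(\Lambda\cap F_{b_j}^\perp)=k-j+1$ for $1\le j\le k-s$. The Schubert cell is the set of $\Lambda\in SG(k,n)$ with $\dim(\Lambda\cap F_i)=\#\{l\mid a_l\le i\}$ and $\dim(\Lambda\cap F_i^\perp)=s+\#\{j\mid b_j\ge i\}$ for all $0\le i\le m$. Put $x_j=\#\{i\mid a_i\le b_j\}$, and $z_\tau=\#\{j\mid b_j<a_\tau\}$ for $1\le\tau\le s$, $z_\tau=k-\tau+1$ for $s<\tau\le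 k$. Let $\Gamma_{a;b}$ be the set of families of isotropic subspaces $\Lambda_\tau$ ($1\le\tau\le k$) and $W^{\tau,j}$ ($1\le\tau\le k$, $1\le j\le z_\tau$) of $V$, with $\dim\Lambda_\tau=\tau$ and $\dim W^{\tau,j}=b_j+\tau-x_j$, such that, with $W^{\tau,0}:=\Lambda_\tau$: $W^{\tau,j}\subset W^{\tau,j+1}$ and $W^{\tau,j}\subset W^{\tau+1,j}$ whenever both sides are defined; $F_{b_j}\subset W^{\tau,j}$ for $1\le j\le z_\tau$; and $W^{\tau,z_\tau}\subset F_{a_\tau}$ if $\tau\le s$, $W^{\tau,z_\tau}\subset F_{b_{k-\tau+1}}^\perp$ if $\tau>s$. Then $\Gamma_{a;b}$ is a closed subvariety of a product of Grassmannians, smooth and irreducible. It is an iterated tower of Grassmannian and symplectic Grassmannian bundles: order the entries row by row ($\tau$ increasing), and within a row with $j$ decreasing from $z_\tau$ to $0$; for each entry $W^{\tau,j}$, of dimension $d$, the map that forgets it, from the image of $\Gamma_{a;b}$ in the product over the entries up to $W^{\tau,j}$ to the image in the product over the preceding entries, is a Zariski locally trivial bundle with fibre $G(1,\dim W^{\tau,j+1}+1-d)$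 if $j<z_\tau$, $G(1,a_\tau+1-d)$ if $j=z_\tau$ and $\tau\le s$, and $SG(1,2(m+1-d))$ if $j=z_\tau$ and $\tau>s$. The forgetful map $\pi$ sending a diagram to $\Lambda_k$ maps $\Gamma_{a;b}$ to $\Sigma_{a;b}$, and $\pi:\Gamma_{a;b}\to\Sigma_{a;b}$ is a resolution of singularities (a proper birational morphism from a smooth irreducible variety). The Schubert cell is open and dense in $\Sigma_{a;b}$, and $\pi$ is an isomorphism over it. -/

import Mathlib

open scoped Topology
open Module

namespace SympSchubert

/-! ### Complex algebraic varieties in the classical sense: spaces with functions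

A classical complex variety is a set of (closed) points, with its Zariski topology and its
sheaf of complex valued regular functions.  The sheaf is recorded through its germs:
`reg x f` says that `f`, which may be arbitrary away from `x`, is regular near `x`.
All spaces used below are built from vector spaces and finitely generated algebras by the
constructions of this section. -/

universe u v w

/-- A set of points, a topology, and the relation "`f` is a regular function near `x`". -/
structure FSpace where
  carrier : Type u
  top : TopologicalSpace carrier
  reg : carrier → (carrier → ℂ) → Prop

namespace FSpace

instance : CoeSort FSpace.{u} (Type u) := ⟨FSpace.carrier⟩

/-- The space whose topology and functions are generated by a subalgebra `A` of the complex valued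
functions on the set `X`: basic open sets are `{p ≠ 0}` with `p ∈ A`, and regular functions are
locally quotients `p / q` with `p, q ∈ A`. -/
def ofAlgebra (X : Type u) (A : Subalgebra ℂ (X → ℂ)) : FSpace.{u} where
  carrier := X
  top := TopologicalSpace.generateFrom {U | ∃ p ∈ A, U = {x | p x ≠ 0}}
  reg x f := ∃ p ∈ A, ∃ q ∈ A, q x ≠ 0 ∧
    ∀ᶠ y in @nhds X (TopologicalSpace.generateFrom {U | ∃ p ∈ A, U = {x | p x ≠ 0}}) x,
      f y = p y / q y

/-- A complex vector space `W` with its polynomial functions (the functions generated by the linear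
forms); for `W` finite dimensional this is affine space. -/
def affine (W : Type u) [AddCommGroup W] [Module ℂ W] : FSpace.{u} :=
  ofAlgebra W (Algebra.adjoin ℂ {f | ∃ φ : W →ₗ[ℂ] ℂ, f = fun w => φ w})

/-- The affine variety of a complex algebra `A` (of interest for `A` finitely generated): its points
are the algebra homomorphisms `A → ℂ`, its functions are generated by the elements of `A`. -/
def spm (A : Type u) [CommRing A] [Algebra ℂ A] : FSpace.{u} :=
  ofAlgebra (A →ₐ[ℂ] ℂ)
    (AlgHom.pi (fun x : A →ₐ[ℂ] ℂ => x)).range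

/-- A subset with the induced topology; a function on it is regular if it locally extends to a
regular function of the ambient space. For a locally closed subset of a variety this is the
reduced induced structure. -/
def restrict (X : FSpace.{u}) (S : Set X) : FSpace.{u} where
  carrier := S
  top := TopologicalSpace.induced Subtype.val X.top
  reg x f := ∃ g : X → ℂ, X.reg x g ∧
    ∀ᶠ y in @nhds S (TopologicalSpace.induced Subtype.val X.top) x, f y = g y

/-- The quotient structure along `π : X → Y`: the quotient topology, and the functions whose
pull-back to `X` is regular. -/
def quotient (X : FSpace.{u}) {Y : Type v} (π : X → Y) : FSpace.{v} where
  carrier := Y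
  top := TopologicalSpace.coinduced π X.top
  reg y f := ∀ x, π x = y → X.reg x (f ∘ π)

/-- `h` is on `U × V` a finite sum of products of regular functions on `U` and on `V`. -/
def IsTensor (X : FSpace.{u}) (Y : FSpace.{v}) (U : Set X) (V : Set Y) (h : X × Y → ℂ) : Prop :=
  ∃ (n : ℕ) (f : Fin n → X → ℂ) (g : Fin n → Y → ℂ),
    (∀ i, ∀ x ∈ U, X.reg x (f i)) ∧ (∀ i, ∀ y ∈ V, Y.reg y (g i)) ∧
    ∀ x ∈ U, ∀ y ∈ V, h (x, y) = ∑ i, f i x * g i y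

/-- The Zariski topology of the product of two varieties. -/
@[reducible] def prodTop (X : FSpace.{u}) (Y : FSpace.{v}) : TopologicalSpace (X × Y) :=
  TopologicalSpace.generateFrom
    {O | ∃ (U : Set X) (V : Set Y) (h : X × Y → ℂ), IsOpen[X.top] U ∧ IsOpen[Y.top] V ∧
      IsTensor X Y U V h ∧ O = {p | p.1 ∈ U ∧ p.2 ∈ V ∧ h p ≠ 0}}

/-- The product of two varieties: regular functions are locally quotients of finite sums of
products of regular functions on the factors. -/
def prod (X : FSpace.{u}) (Y : FSpace.{v}) : FSpace.{max u v} where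
  carrier := X × Y
  top := prodTop X Y
  reg p F := ∃ (U : Set X) (V : Set Y) (h₁ h₂ : X × Y → ℂ),
    IsOpen[X.top] U ∧ IsOpen[Y.top] V ∧ p.1 ∈ U ∧ p.2 ∈ V ∧
    IsTensor X Y U V h₁ ∧ IsTensor X Y U V h₂ ∧ h₂ p ≠ 0 ∧
    ∀ᶠ r in @nhds (X × Y) (prodTop X Y) p, F r = h₁ r / h₂ r

/-- Morphisms: continuous maps pulling back regular functions to regular functions. -/
def IsMorphism {X : FSpace.{u}} {Y : FSpace.{v}} (f : X → Y) : Prop :=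
  Continuous[X.top, Y.top] f ∧
    ∀ (x : X) (g : Y → ℂ), Y.reg (f x) g → X.reg x (g ∘ f)

/-- Isomorphisms: morphisms with an inverse morphism. -/
def IsIsomorphism {X : FSpace.{u}} {Y : FSpace.{v}} (f : X → Y) : Prop :=
  IsMorphism f ∧ ∃ g : Y → X, IsMorphism g ∧ Function.LeftInverse g f ∧ Function.RightInverse g f

/-- `f` restricts to an isomorphism `f⁻¹(U) → U`. -/
def IsIsomorphismOver {X : FSpace.{u}} {Y : FSpace.{v}} (f : X → Y) (U : Set Y) : Prop :=
  IsIsomorphism (X := X.restrict (f ⁻¹' U)) (Y := Y.restrict U) (U.restrictPreimage f)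

/-- `X` is smooth: each point has an open neighbourhood isomorphic to the affine variety of a
smooth complex algebra. -/
def IsSmooth (X : FSpace.{u}) : Prop :=
  ∀ x : X, ∃ U : Set X, IsOpen[X.top] U ∧ x ∈ U ∧
    ∃ (A : Type) (_ : CommRing A) (_ : Algebra ℂ A), Algebra.Smooth ℂ A ∧
      ∃ φ : U → (A →ₐ[ℂ] ℂ), IsIsomorphism (X := X.restrict U) (Y := spm A) φ

/-- `X` is irreducible (in particular non-empty). -/
def IsIrred (X : FSpace.{u}) : Prop := @IrreducibleSpace X X.top

/-- `f` is universally closed: all maps `f × id : X × Z → Y × Z`, with `Z` an affine variety, are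
closed. Closedness is local on the target and every base change of `f` is a closed restriction of
a map `f × id`, so that affine `Z` suffice; for morphisms of quasi-projective varieties this is
properness. -/
def IsProperMap {X : FSpace.{u}} {Y : FSpace.{v}} (f : X → Y) : Prop :=
  IsMorphism f ∧
    ∀ (A : Type) [CommRing A] [Algebra ℂ A] [Algebra.FiniteType ℂ A],
      @IsClosedMap _ _ (X.prod (spm A)).top (Y.prod (spm A)).top
        (Prod.map f (id : spm A → spm A))

/-- `f` is birational: it is an isomorphism over a dense open subset with dense preimage. -/
def IsBirational {X : FSpace.{u}} {Y : FSpace.{v}} (f : X → Y) : Prop :=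
  ∃ U : Set Y, IsOpen[Y.top] U ∧ @Dense Y Y.top U ∧ @Dense X X.top (f ⁻¹' U) ∧
    IsIsomorphismOver f U

/-- A resolution of singularities: a proper birational morphism from a smooth irreducible
variety. -/
def IsResolution {X : FSpace.{u}} {Y : FSpace.{v}} (f : X → Y) : Prop :=
  X.IsSmooth ∧ X.IsIrred ∧ IsMorphism f ∧ IsProperMap f ∧ IsBirational f

/-- `f : X → Y` is a Zariski locally trivial fibre bundle with fibre `G`. -/
def IsFibreBundle {X : FSpace.{u}} {Y : FSpace.{v}} (f : X → Y) (G : FSpace.{w}) : Prop :=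
  IsMorphism f ∧ ∀ y : Y, ∃ U : Set Y, IsOpen[Y.top] U ∧ y ∈ U ∧
    ∃ φ : f ⁻¹' U → U × G,
      IsIsomorphism (X := X.restrict (f ⁻¹' U)) (Y := (Y.restrict U).prod G) φ ∧
      ∀ x, (φ x).1 = U.restrictPreimage f x

end FSpace

open FSpace

/-! ### Grassmannians and symplectic Grassmannians -/

section Grassmannian

/-- The space of tuples, indexed by `ι`, of frames: the entry at `i` consists of `d i` linearly
independent vectors of `V`. -/
def frames (ι : Type v) (d : ι → ℕ) (V : Type u) [AddCommGroup V] [Module ℂ V] :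
    FSpace.{max u v} :=
  (affine (∀ i, Fin (d i) → V)).restrict {w | ∀ i, LinearIndependent ℂ (w i)}

/-- The product over `i : ι` of the Grassmannians `G(d i, V)` of `d i`-dimensional subspaces of
`V`, with the variety structure of the quotient of the space of tuples of frames. -/
def grProd (ι : Type v) (d : ι → ℕ) (V : Type u) [AddCommGroup V] [Module ℂ V] :
    FSpace.{max u v} :=
  (frames ι d V).quotient (Y := {L : ι → Submodule ℂ V // ∀ i, finrank ℂ (L i) = d i})
    (fun w => ⟨fun i => Submodule.span ℂ (Set.range (w.1 i)),
      fun i => by simpa using finrank_span_eq_card (w.2 i)⟩)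

/-- The Grassmannian `G(k, V)`. -/
def gr (k : ℕ) (V : Type u) [AddCommGroup V] [Module ℂ V] : FSpace.{u} :=
  (frames Unit (fun _ => k) V).quotient (Y := {L : Submodule ℂ V // finrank ℂ L = k})
    (fun w => ⟨Submodule.span ℂ (Set.range (w.1 ())),
      by simpa using finrank_span_eq_card (w.2 ())⟩)

variable {V : Type u} [AddCommGroup V] [Module ℂ V]

/-- `W` is isotropic for the bilinear form `ω`. -/
def IsIsotropic (ω : LinearMap.BilinForm ℂ V) (W : Submodule ℂ V) : Prop :=
  ∀ v ∈ W, ∀ w ∈ W, ω v w = 0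

/-- The symplectic Grassmannian `SG(k, V)` of `k`-dimensional isotropic subspaces. -/
def sg (k : ℕ) (ω : LinearMap.BilinForm ℂ V) : FSpace.{u} :=
  (gr k V).restrict {L | IsIsotropic ω L.1}

/-- The standard symplectic form on `ℂ^M ⊕ ℂ^M`. -/
noncomputable def stdSymp (M : ℕ) : LinearMap.BilinForm ℂ (Fin M ⊕ Fin M → ℂ) :=
  Matrix.toBilin' (Matrix.J (Fin M) ℂ)

/-- A complete isotropic flag `F 0 ⊂ F 1 ⊂ ⋯ ⊂ F m` in a symplectic vector space of dimension
`2 * m` (the subspaces `F i` with `i > m` are not used); the other half of the flag consists of the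
orthogonal complements of the `F i`. -/
structure IsotropicFlag (ω : LinearMap.BilinForm ℂ V) (m : ℕ) where
  F : ℕ → Submodule ℂ V
  finrank_eq : ∀ i ≤ m, finrank ℂ (F i) = i
  mono : ∀ i j, i ≤ j → j ≤ m → F i ≤ F j
  isotropic : ∀ i ≤ m, IsIsotropic ω (F i)

end Grassmannian

/-! ### Schubert varieties in `SG(k, 2m)` and isotropic flag diagrams -/

/-- A Schubert index `(a; b)` for `SG(k, 2m)`: sequences `1 ≤ a 1 < ⋯ < a s ≤ m` and
`0 ≤ b 1 < ⋯ < b (k - s) ≤ m - 1` with `a i - b j ≠ 1` (other values of `a`, `b` are not used). -/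
structure SchubertIndex (k m : ℕ) where
  s : ℕ
  s_le : s ≤ k
  a : ℕ → ℕ
  b : ℕ → ℕ
  a_strictMono : StrictMonoOn a (Set.Icc 1 s)
  a_mem : ∀ i ∈ Set.Icc 1 s, 1 ≤ a i ∧ a i ≤ m
  b_strictMono : StrictMonoOn b (Set.Icc 1 (k - s))
  b_lt : ∀ j ∈ Set.Icc 1 (k - s), b j < m
  a_ne : ∀ i ∈ Set.Icc 1 s, ∀ j ∈ Set.Icc 1 (k - s), a i ≠ b j + 1

namespace SchubertIndex

variable {k m : ℕ} (I : SchubertIndex k m)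

/-- `x_j = #{i | a_i ≤ b_j}`. -/
def x (j : ℕ) : ℕ := ((Finset.Icc 1 I.s).filter (fun i => I.a i ≤ I.b j)).card

/-- `z_τ = #{j | b_j < a_τ}` for `τ ≤ s`, and `z_τ = k - τ + 1` for `τ > s`. -/
def z (τ : ℕ) : ℕ :=
  if τ ≤ I.s then ((Finset.Icc 1 (k - I.s)).filter (fun j => I.b j < I.a τ)).card
  else k - τ + 1

/-- The positions of a diagram: `(τ, 0)` is the place of `Λ_τ`, and `(τ, j)` with `1 ≤ j ≤ z_τ` is
the place of `W^{τ,j}`. -/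
def positions : Set (ℕ × ℕ) := {p | 1 ≤ p.1 ∧ p.1 ≤ k ∧ p.2 ≤ I.z p.1}

/-- The dimensions of the entries: `dim Λ_τ = τ` and `dim W^{τ,j} = b_j + τ - x_j`. -/
def dim (p : ℕ × ℕ) : ℕ := if p.2 = 0 then p.1 else I.b p.2 + p.1 - I.x p.2

/-- The positions that precede `p` in the order in which a diagram is built up: row after row, and
within a row from right to left. -/
def before (p : ℕ × ℕ) : Set (ℕ × ℕ) :=
  {q | q ∈ I.positions ∧ (q.1 < p.1 ∨ (q.1 = p.1 ∧ p.2 < q.2))}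

/-- The positions up to and including `p`. -/
def upTo (p : ℕ × ℕ) : Set (ℕ × ℕ) :=
  {q | q ∈ I.positions ∧ (q.1 < p.1 ∨ (q.1 = p.1 ∧ p.2 ≤ q.2))}

theorem before_subset_upTo (p : ℕ × ℕ) : I.before p ⊆ I.upTo p := fun _ hq =>
  ⟨hq.1, hq.2.imp id fun h => ⟨h.1, h.2.le⟩⟩

theorem upTo_subset (p : ℕ × ℕ) : I.upTo p ⊆ I.positions := fun _ hq => hq.1

theorem last_mem (hk : 1 ≤ k) : (k, 0) ∈ I.positions := ⟨hk, le_rfl, Nat.zero_le _⟩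

section Diagrams

variable {V : Type u} [AddCommGroup V] [Module ℂ V] {ω : LinearMap.BilinForm ℂ V}

/-- The locus `Σ°` of isotropic `Λ` with `dim (Λ ∩ F_{a_i}) = i` and
`dim (Λ ∩ F_{b_j}^⊥) = k - j + 1`. -/
def schubertLocus (F : IsotropicFlag ω m) : Set (sg k ω) :=
  {Λ | (∀ i ∈ Set.Icc 1 I.s, finrank ℂ (Λ.1.1 ⊓ F.F (I.a i) : Submodule ℂ V) = i) ∧
    ∀ j ∈ Set.Icc 1 (k - I.s),
      finrank ℂ (Λ.1.1 ⊓ ω.orthogonal (F.F (I.b j)) : Submodule ℂ V) = k - j + 1}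

/-- The Schubert variety: the Zariski closure in `SG(k, V)` of the locus above. -/
def schubertVariety (F : IsotropicFlag ω m) : Set (sg k ω) :=
  @closure (sg k ω) (sg k ω).top (I.schubertLocus F)

/-- The Schubert cell, that is, the set of all isotropic `Λ` in the relative position to the
complete flag `F_0 ⊂ ⋯ ⊂ F_m = F_m^⊥ ⊂ ⋯ ⊂ F_0^⊥ = V` prescribed by the Schubert index. -/
def schubertCell (F : IsotropicFlag ω m) : Set (sg k ω) :=
  {Λ | ∀ i ≤ m,
    finrank ℂ (Λ.1.1 ⊓ F.F i : Submodule ℂ V) =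
      ((Finset.Icc 1 I.s).filter (fun l => I.a l ≤ i)).card ∧
    finrank ℂ (Λ.1.1 ⊓ ω.orthogonal (F.F i) : Submodule ℂ V) =
      I.s + ((Finset.Icc 1 (k - I.s)).filter (fun j => i ≤ I.b j)).card}

variable (V) in
/-- The product of the Grassmannians `G(dim p, V)` over the positions `p` in a set `T`. -/
def ambient (T : Set (ℕ × ℕ)) : FSpace.{u} := grProd T (fun p => I.dim p.1) V

/-- The set `Γ_{a;b}` of isotropic flag diagrams: families of isotropic subspaces `Λ_τ`, `W^{τ,j}`,
increasing along rows and columns, with `F_{b_j} ⊂ W^{τ,j}`, such that the last entry of row `τ`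
is contained in `F_{a_τ}` if `τ ≤ s` and in `F_{b_{k-τ+1}}^⊥` if `τ > s`. -/
def diagrams (F : IsotropicFlag ω m) : Set (I.ambient V I.positions) :=
  {D | (∀ p, IsIsotropic ω (D.1 p)) ∧
    (∀ p q : I.positions, q.1 = (p.1.1, p.1.2 + 1) → D.1 p ≤ D.1 q) ∧
    (∀ p q : I.positions, q.1 = (p.1.1 + 1, p.1.2) → D.1 p ≤ D.1 q) ∧
    (∀ p : I.positions, 1 ≤ p.1.2 → F.F (I.b p.1.2) ≤ D.1 p) ∧
    ∀ p : I.positions, p.1.2 = I.z p.1.1 →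
      D.1 p ≤ if p.1.1 ≤ I.s then F.F (I.a p.1.1)
        else ω.orthogonal (F.F (I.b (k - p.1.1 + 1)))}

/-- Forgetting the entries outside a set `T` of positions. -/
def forget {T T' : Set (ℕ × ℕ)} (h : T ⊆ T') (D : I.ambient V T') : I.ambient V T :=
  ⟨fun p => D.1 ⟨p.1, h p.2⟩, fun p => D.2 ⟨p.1, h p.2⟩⟩

/-- The variety of partial diagrams with positions in `T`: the image of `Γ_{a;b}` under forgetting
all the other entries. -/
def stage (F : IsotropicFlag ω m) {T : Set (ℕ × ℕ)} (h : T ⊆ I.positions) :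
    Set (I.ambient V T) :=
  I.forget h '' I.diagrams F

/-- The variety `Γ_{a;b}`. -/
def Gamma (F : IsotropicFlag ω m) : FSpace.{u} :=
  (I.ambient V I.positions).restrict (I.diagrams F)

/-- The variety of partial diagrams with the positions up to and including `p`. -/
def stageUpTo (F : IsotropicFlag ω m) (p : ℕ × ℕ) : FSpace.{u} :=
  (I.ambient V (I.upTo p)).restrict (I.stage F (I.upTo_subset p))

/-- The variety of partial diagrams with the positions before `p`. -/
def stageBefore (F : IsotropicFlag ω m) (p : ℕ × ℕ) : FSpace.{u} :=
  (I.ambient V (I.before p)).restrict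
    (I.stage F ((I.before_subset_upTo p).trans (I.upTo_subset p)))

/-- The projection forgetting the entry at position `p`, from the partial diagrams up to and
including `p` to the partial diagrams before `p`. -/
def forgetEntry (F : IsotropicFlag ω m) (p : ℕ × ℕ) : I.stageUpTo F p → I.stageBefore F p :=
  fun E => ⟨I.forget (I.before_subset_upTo p) E.1, by
    obtain ⟨_, D, hD, rfl⟩ := E
    exact ⟨D, hD, rfl⟩⟩

/-- The Schubert variety, as a variety. -/
def Sigma (F : IsotropicFlag ω m) : FSpace.{u} := (sg k ω).restrict (I.schubertVariety F)

/-- The forgetful map `Γ_{a;b} → SG(k, V)`, sending a diagram to `Λ_k`. -/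
def lastEntry (hk : 1 ≤ k) (F : IsotropicFlag ω m) (D : I.Gamma F) : sg k ω :=
  ⟨⟨D.1.1 ⟨(k, 0), I.last_mem hk⟩, D.1.2 ⟨(k, 0), I.last_mem hk⟩⟩, D.2.1 _⟩

end Diagrams

end SchubertIndex

end SympSchubert

open SympSchubert SympSchubert.FSpace

open scoped Topology
open Module

namespace SympSchubert

universe u v w w'
namespace FSpace

attribute [local instance] FSpace.top

open Filter

/-- The axioms of a space with functions that are expected of a variety: regularity is a property
of germs, regular germs form a local ring with residue field `ℂ`, and both regularity and
non-vanishing are open conditions. -/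
structure IsLocal (X : FSpace.{u}) : Prop where
  congr : ∀ {x : X} {f g : X → ℂ}, X.reg x f → f =ᶠ[𝓝 x] g → X.reg x g
  const : ∀ (x : X) (c : ℂ), X.reg x (fun _ => c)
  add : ∀ {x : X} {f g : X → ℂ}, X.reg x f → X.reg x g → X.reg x (fun y => f y + g y)
  mul : ∀ {x : X} {f g : X → ℂ}, X.reg x f → X.reg x g → X.reg x (fun y => f y * g y)
  inv : ∀ {x : X} {f : X → ℂ}, X.reg x f → f x ≠ 0 → X.reg x (fun y => (f y)⁻¹)
  ne : ∀ {x : X} {f : X → ℂ}, X.reg x f → f x ≠ 0 → ∀ᶠ y in 𝓝 x, f y ≠ 0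
  near : ∀ {x : X} {f : X → ℂ}, X.reg x f → ∀ᶠ y in 𝓝 x, X.reg y f

namespace IsLocal

variable {X : FSpace.{u}} {x : X}

theorem neg (hX : X.IsLocal) {f : X → ℂ} (hf : X.reg x f) : X.reg x (fun y => -f y) := by
  simpa using hX.mul (hX.const x (-1)) hf

theorem sub (hX : X.IsLocal) {f g : X → ℂ} (hf : X.reg x f) (hg : X.reg x g) : X.reg x (fun y => f y - g y) := by
  simpa [sub_eq_add_neg] using hX.add hf (hX.neg hg)

theorem sum (hX : X.IsLocal) {ι : Type*} (s : Finset ι) {f : ι → X → ℂ} (hf : ∀ i ∈ s, X.reg x (f i)) :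
    X.reg x (fun y => ∑ i ∈ s, f i y) := by
  classical
  induction s using Finset.induction_on with
  | empty => simpa using hX.const x 0
  | insert a s ha ih =>
    simp only [Finset.sum_insert ha]
    exact hX.add (hf a (by simp)) (ih fun i hi => hf i (by simp [hi]))

theorem prod (hX : X.IsLocal) {ι : Type*} (s : Finset ι) {f : ι → X → ℂ} (hf : ∀ i ∈ s, X.reg x (f i)) :
    X.reg x (fun y => ∏ i ∈ s, f i y) := by
  classical
  induction s using Finset.induction_on with
  | empty => simpa using hX.const x 1
  | insert a s ha ih =>
    simp only [Finset.prod_insert ha]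
    exact hX.mul (hf a (by simp)) (ih fun i hi => hf i (by simp [hi]))

theorem det (hX : X.IsLocal) {n : Type*} [Fintype n] [DecidableEq n] {M : X → Matrix n n ℂ}
    (hM : ∀ i j, X.reg x (fun y => M y i j)) : X.reg x (fun y => (M y).det) := by
  simp only [Matrix.det_apply, Units.smul_def, zsmul_eq_mul]
  exact hX.sum _ fun σ _ => hX.mul (hX.const _ _) (hX.prod _ fun i _ => hM _ _)

theorem matrix_inv (hX : X.IsLocal) {n : Type*} [Fintype n] [DecidableEq n] {M : X → Matrix n n ℂ}
    (hM : ∀ i j, X.reg x (fun y => M y i j)) (h0 : (M x).det ≠ 0) (i j : n) :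
    X.reg x (fun y => (M y)⁻¹ i j) := by
  simp only [Matrix.inv_def, Matrix.smul_apply, Ring.inverse_eq_inv', smul_eq_mul]
  refine hX.mul (hX.inv (hX.det hM) h0) ?_
  simp only [Matrix.adjugate_apply]
  refine hX.det fun a b => ?_
  by_cases h : a = j
  · subst h
    simpa using hX.const x ((Pi.single i (1 : ℂ) : n → ℂ) b)
  · simpa [Matrix.updateRow_apply, h] using hM a b

end IsLocal

/-- `f` is a morphism at the point `x`. -/
def MorphAt {X : FSpace.{u}} {Y : FSpace.{v}} (f : X → Y) (x : X) : Prop :=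
  ContinuousAt f x ∧ ∀ g : Y → ℂ, Y.reg (f x) g → X.reg x (g ∘ f)

theorem isMorphism_iff {X : FSpace.{u}} {Y : FSpace.{v}} {f : X → Y} :
    IsMorphism f ↔ ∀ x, MorphAt f x :=
  ⟨fun h x => ⟨h.1.continuousAt, h.2 x⟩,
    fun h => ⟨continuous_iff_continuousAt.2 fun x => (h x).1, fun x => (h x).2⟩⟩

theorem MorphAt.comp {X : FSpace.{u}} {Y : FSpace.{v}} {Z : FSpace.{w}} {g : Y → Z} {f : X → Y}
    {x : X} (hg : MorphAt g (f x)) (hf : MorphAt f x) : MorphAt (X := X) (Y := Z) (g ∘ f) x :=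
  ⟨ContinuousAt.comp hg.1 hf.1, fun h hh => hf.2 _ (hg.2 h hh)⟩

theorem MorphAt.congr {X : FSpace.{u}} {Y : FSpace.{v}} (hX : X.IsLocal) {f g : X → Y} {x : X}
    (hf : MorphAt f x) (h : f =ᶠ[𝓝 x] g) : MorphAt g x := by
  refine ⟨hf.1.congr h, fun k hk => hX.congr (hf.2 k (h.self_of_nhds ▸ hk)) ?_⟩
  filter_upwards [h] with y hy
  simp [hy]

theorem morphAt_id {X : FSpace.{u}} (x : X) : MorphAt (X := X) (Y := X) (fun y => y) x :=
  ⟨continuousAt_id, fun _ h => h⟩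

theorem morphAt_const {X : FSpace.{u}} {Y : FSpace.{v}} (hX : X.IsLocal) (x : X) (y : Y) :
    MorphAt (X := X) (Y := Y) (fun _ => y) x :=
  ⟨continuousAt_const, fun g _ => hX.const x (g y)⟩

/-! ### Spaces generated by an algebra of functions -/

section OfAlgebra

variable {S : Type u} (A : Subalgebra ℂ (S → ℂ))

theorem ofAlgebra_reg_iff {x : ofAlgebra S A} {f : ofAlgebra S A → ℂ} :
    (ofAlgebra S A).reg x f ↔ ∃ p ∈ A, ∃ q ∈ A, q x ≠ 0 ∧
      ∀ᶠ y : ofAlgebra S A in 𝓝 x, f y = p y / q y :=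
  Iff.rfl

theorem ofAlgebra_ne {p : S → ℂ} (hp : p ∈ A) {x : ofAlgebra S A} (hx : p x ≠ 0) :
    ∀ᶠ y : ofAlgebra S A in 𝓝 x, p y ≠ 0 :=
  IsOpen.mem_nhds (TopologicalSpace.isOpen_generateFrom_of_mem ⟨p, hp, rfl⟩) hx

theorem ofAlgebra_reg {p : S → ℂ} (hp : p ∈ A) (x : ofAlgebra S A) : (ofAlgebra S A).reg x p :=
  ⟨p, hp, 1, A.one_mem, one_ne_zero, Eventually.of_forall fun y => by simp⟩

theorem ofAlgebra_isLocal : (ofAlgebra S A).IsLocal where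
  congr := by
    intro x f g hf hfg
    obtain ⟨p, hp, q, hq, hx, h⟩ := (ofAlgebra_reg_iff A).1 hf
    refine ⟨p, hp, q, hq, hx, ?_⟩
    filter_upwards [h, hfg] with y h1 h2
    rw [← h2, h1]
  const x c := ofAlgebra_reg A (A.algebraMap_mem c) x
  add := by
    intro x f g hf hg
    obtain ⟨p, hp, q, hq, hx, h⟩ := (ofAlgebra_reg_iff A).1 hf
    obtain ⟨p', hp', q', hq', hx', h'⟩ := (ofAlgebra_reg_iff A).1 hg
    refine ⟨p * q' + p' * q, add_mem (mul_mem hp hq') (mul_mem hp' hq), q * q', mul_mem hq hq',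
      mul_ne_zero hx hx', ?_⟩
    filter_upwards [h, h', ofAlgebra_ne A hq hx, ofAlgebra_ne A hq' hx'] with y h1 h2 h3 h4
    have h3 : q y ≠ 0 := h3
    have h4 : q' y ≠ 0 := h4
    rw [h1, h2]
    simp only [Pi.add_apply, Pi.mul_apply]
    field_simp
  mul := by
    intro x f g hf hg
    obtain ⟨p, hp, q, hq, hx, h⟩ := (ofAlgebra_reg_iff A).1 hf
    obtain ⟨p', hp', q', hq', hx', h'⟩ := (ofAlgebra_reg_iff A).1 hg
    refine ⟨p * p', mul_mem hp hp', q * q', mul_mem hq hq', mul_ne_zero hx hx', ?_⟩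
    filter_upwards [h, h'] with y h1 h2
    rw [h1, h2]
    simp only [Pi.mul_apply]
    field_simp
  inv := by
    intro x f hg hf
    obtain ⟨p, hp, q, hq, hx, h⟩ := (ofAlgebra_reg_iff A).1 hg
    have h0 := h.self_of_nhds
    refine ⟨q, hq, p, hp, fun h1 => hf (by rw [h0, h1, zero_div]), ?_⟩
    filter_upwards [h] with y h1
    rw [h1, inv_div]
  ne := by
    intro x f hg hf
    obtain ⟨p, hp, q, hq, hx, h⟩ := (ofAlgebra_reg_iff A).1 hg
    have h0 := h.self_of_nhds
    have hp0 : p x ≠ 0 := fun h1 => hf (by rw [h0, h1, zero_div])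
    filter_upwards [h, ofAlgebra_ne A hq hx, ofAlgebra_ne A hp hp0] with y h1 h2 h3
    rw [h1]
    exact div_ne_zero h3 h2
  near := by
    intro x f hf
    obtain ⟨p, hp, q, hq, hx, h⟩ := (ofAlgebra_reg_iff A).1 hf
    filter_upwards [eventually_eventually_nhds.2 h, ofAlgebra_ne A hq hx] with y h1 h2
    exact ⟨p, hp, q, hq, h2, h1⟩

theorem morphAt_ofAlgebra {X : FSpace.{v}} (hX : X.IsLocal) {f : X → ofAlgebra S A} {x : X}
    (hf : ∀ p ∈ A, X.reg x (fun y => p (f y))) : MorphAt f x := by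
  have hc : ContinuousAt f x := by
    refine TopologicalSpace.tendsto_nhds_generateFrom_iff.2 ?_
    rintro _ ⟨p, hp, rfl⟩ hx
    exact hX.ne (hf p hp) hx
  refine ⟨hc, ?_⟩
  rintro g ⟨p, hp, q, hq, hx, h⟩
  refine hX.congr (hX.mul (hf p hp) (hX.inv (hf q hq) hx)) ?_
  filter_upwards [hc.eventually h] with y h1
  simp only [Function.comp]
  rw [h1, div_eq_mul_inv]

end OfAlgebra

theorem affine_isLocal (W : Type u) [AddCommGroup W] [Module ℂ W] : (affine W).IsLocal :=
  ofAlgebra_isLocal _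

theorem affine_reg {W : Type u} [AddCommGroup W] [Module ℂ W] (φ : W →ₗ[ℂ] ℂ) (x : affine W) :
    (affine W).reg x (fun w : W => φ w) :=
  ofAlgebra_reg _ (Algebra.subset_adjoin (Set.mem_ofPred.2 ⟨φ, rfl⟩)) x

theorem morphAt_affine {W : Type u} [AddCommGroup W] [Module ℂ W] {X : FSpace.{v}}
    (hX : X.IsLocal) {f : X → affine W} {x : X}
    (hf : ∀ φ : W →ₗ[ℂ] ℂ, X.reg x (fun y => φ (f y : W))) : MorphAt f x := by
  refine morphAt_ofAlgebra _ hX fun p hp => ?_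
  induction hp using Algebra.adjoin_induction with
  | mem p hp => obtain ⟨φ, rfl⟩ := hp; exact hf φ
  | algebraMap c => exact hX.const x c
  | add p q _ _ h1 h2 => exact hX.add h1 h2
  | mul p q _ _ h1 h2 => exact hX.mul h1 h2

theorem spm_isLocal (A : Type u) [CommRing A] [Algebra ℂ A] : (spm A).IsLocal :=
  ofAlgebra_isLocal _

theorem spm_reg {A : Type u} [CommRing A] [Algebra ℂ A] (a : A) (x : spm A) :
    (spm A).reg x (fun y : A →ₐ[ℂ] ℂ => y a) :=
  ofAlgebra_reg _ (AlgHom.mem_range_self _ a) x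

theorem morphAt_spm {A : Type u} [CommRing A] [Algebra ℂ A] {X : FSpace.{v}}
    (hX : X.IsLocal) {f : X → spm A} {x : X}
    (hf : ∀ a : A, X.reg x (fun y => (show A →ₐ[ℂ] ℂ from f y) a)) : MorphAt f x := by
  refine morphAt_ofAlgebra _ hX ?_
  rintro _ ⟨a, rfl⟩
  exact hf a

/-! ### Subspaces -/

section Restrict

variable {X : FSpace.{u}}

theorem eventually_restrict {S : Set X} {x : X.restrict S} {p : X → Prop}
    (h : ∀ᶠ y in 𝓝 (x.1 : X), p y) : ∀ᶠ y : X.restrict S in 𝓝 x, p y.1 :=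
  (continuous_induced_dom (f := (Subtype.val : S → X)) (t := X.top)).continuousAt.eventually h

theorem restrict_isLocal (hX : X.IsLocal) (S : Set X) : (X.restrict S).IsLocal where
  congr := by
    rintro x f g ⟨f', hf', h⟩ hfg
    refine ⟨f', hf', ?_⟩
    filter_upwards [h, hfg] with y h1 h2
    rw [← h2, h1]
  const x c := ⟨fun _ => c, hX.const _ c, Eventually.of_forall fun _ => rfl⟩
  add := by
    rintro x f g ⟨f', hf', h⟩ ⟨g', hg', h'⟩
    refine ⟨_, hX.add hf' hg', ?_⟩
    filter_upwards [h, h'] with y h1 h2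
    rw [h1, h2]
  mul := by
    rintro x f g ⟨f', hf', h⟩ ⟨g', hg', h'⟩
    refine ⟨_, hX.mul hf' hg', ?_⟩
    filter_upwards [h, h'] with y h1 h2
    rw [h1, h2]
  inv := by
    rintro x f ⟨f', hf', h⟩ h0
    refine ⟨_, hX.inv hf' (h.self_of_nhds ▸ h0), ?_⟩
    filter_upwards [h] with y h1
    rw [h1]
  ne := by
    rintro x f ⟨f', hf', h⟩ h0
    have h1 := eventually_restrict (S := S) (hX.ne hf' (h.self_of_nhds ▸ h0))
    filter_upwards [h, h1] with y h2 h3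
    rwa [h2]
  near := by
    rintro x f ⟨f', hf', h⟩
    filter_upwards [eventually_eventually_nhds.2 h, eventually_restrict (S := S) (hX.near hf')]
      with y h1 h2
    exact ⟨f', h2, h1⟩

theorem morphAt_val {S : Set X} (x : X.restrict S) :
    MorphAt (X := X.restrict S) (Y := X) (fun y => y.1) x :=
  ⟨(continuous_induced_dom (f := (Subtype.val : S → X)) (t := X.top)).continuousAt,
    fun g hg => ⟨g, hg, Eventually.of_forall fun _ => rfl⟩⟩

theorem MorphAt.val {Z : FSpace.{v}} {S : Set X} {f : Z → X.restrict S} {z : Z}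
    (h : MorphAt f z) : MorphAt (X := Z) (Y := X) (fun a => (f a).1) z :=
  (morphAt_val (f z)).comp h

theorem morphAt_restrict {Z : FSpace.{v}} (hZ : Z.IsLocal) {S : Set X} {f : Z → X.restrict S}
    {z : Z} (h : MorphAt (X := Z) (Y := X) (fun y => (f y).1) z) : MorphAt f z := by
  have hc : ContinuousAt f z := by
    have h1 := h.1
    unfold ContinuousAt at h1 ⊢
    rw [show 𝓝 (f z) = comap Subtype.val (𝓝 (f z).1) from nhds_induced _ _]
    exact tendsto_comap_iff.2 h1
  refine ⟨hc, ?_⟩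
  rintro g ⟨g', hg', hh⟩
  refine hZ.congr (h.2 g' hg') ?_
  filter_upwards [hc.eventually hh] with y h1
  simp only [Function.comp]
  rw [h1]

open Classical in
/-- The retraction of a space to a subset with a chosen point. -/
noncomputable def retract (S : Set X) (x : S) (y : X) : X.restrict S :=
  if h : y ∈ S then ⟨y, h⟩ else x

theorem retract_of_mem {S : Set X} (x : S) {y : X} (h : y ∈ S) : retract S x y = ⟨y, h⟩ :=
  dif_pos h

theorem morphAt_retract (hX : X.IsLocal) {S : Set X} (hS : IsOpen S) (x : S) {y : X} (hy : y ∈ S) :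
    MorphAt (retract S x) y := by
  refine morphAt_restrict hX ((morphAt_id y).congr hX ?_)
  filter_upwards [hS.mem_nhds hy] with a ha
  rw [retract_of_mem x ha]

end Restrict

/-! ### Products -/

section Prod

variable {X : FSpace.{u}} {Y : FSpace.{v}}

theorem IsTensor.mono {U U' : Set X} {V V' : Set Y} {h : X × Y → ℂ} (hh : IsTensor X Y U V h)
    (hU : U' ⊆ U) (hV : V' ⊆ V) : IsTensor X Y U' V' h := by
  obtain ⟨n, f, g, hf, hg, e⟩ := hh
  exact ⟨n, f, g, fun i x hx => hf i x (hU hx), fun i x hx => hg i x (hV hx),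
    fun x hx y hy => e x (hU hx) y (hV hy)⟩

theorem IsTensor.add {U : Set X} {V : Set Y} {h k : X × Y → ℂ}
    (hh : IsTensor X Y U V h) (hk : IsTensor X Y U V k) :
    IsTensor X Y U V (fun p => h p + k p) := by
  obtain ⟨n, f, g, hf, hg, e⟩ := hh
  obtain ⟨n', f', g', hf', hg', e'⟩ := hk
  refine ⟨n + n', Fin.append f f', Fin.append g g', fun i => ?_, fun i => ?_, fun x hx y hy => ?_⟩
  · refine Fin.addCases (fun i => ?_) (fun i => ?_) i <;> simp_all
  · refine Fin.addCases (fun i => ?_) (fun i => ?_) i <;> simp_all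
  · rw [Fin.sum_univ_add]
    simp [e x hx y hy, e' x hx y hy]

theorem IsTensor.mul (hX : X.IsLocal) (hY : Y.IsLocal) {U : Set X} {V : Set Y} {h k : X × Y → ℂ}
    (hh : IsTensor X Y U V h) (hk : IsTensor X Y U V k) :
    IsTensor X Y U V (fun p => h p * k p) := by
  obtain ⟨n, f, g, hf, hg, e⟩ := hh
  obtain ⟨n', f', g', hf', hg', e'⟩ := hk
  refine ⟨n * n', fun i x => f (finProdFinEquiv.symm i).1 x * f' (finProdFinEquiv.symm i).2 x,
    fun i x => g (finProdFinEquiv.symm i).1 x * g' (finProdFinEquiv.symm i).2 x,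
    fun i x hx => hX.mul (hf _ _ hx) (hf' _ _ hx), fun i x hx => hY.mul (hg _ _ hx) (hg' _ _ hx),
    fun x hx y hy => ?_⟩
  change h (x, y) * k (x, y) = _
  rw [e x hx y hy, e' x hx y hy, Finset.sum_mul_sum, ← Finset.sum_product',
    ← finProdFinEquiv.sum_comp]
  simp only [Equiv.symm_apply_apply, Finset.univ_product_univ]
  exact Finset.sum_congr rfl fun i _ => by ring

theorem isTensor_fst (hY : Y.IsLocal) {U : Set X} (V : Set Y) {f : X → ℂ}
    (hf : ∀ x ∈ U, X.reg x f) : IsTensor X Y U V (fun p => f p.1) :=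
  ⟨1, fun _ => f, fun _ _ => 1, fun _ => hf, fun _ y _ => hY.const y 1, fun x _ y _ => by simp⟩

theorem isTensor_snd (hX : X.IsLocal) (U : Set X) {V : Set Y} {f : Y → ℂ}
    (hf : ∀ x ∈ V, Y.reg x f) : IsTensor X Y U V (fun p => f p.2) :=
  ⟨1, fun _ _ => 1, fun _ => f, fun _ y _ => hX.const y 1, fun _ => hf, fun x _ y _ => by simp⟩

/-- The basic neighbourhoods in a product. -/
theorem prod_basic_mem_nhds {U : Set X} {V : Set Y} {h : X × Y → ℂ} (hU : IsOpen U)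
    (hV : IsOpen V) (hh : IsTensor X Y U V h) {p : X.prod Y} (h1 : p.1 ∈ U) (h2 : p.2 ∈ V)
    (h3 : h p ≠ 0) : ∀ᶠ q : X.prod Y in 𝓝 p, q.1 ∈ U ∧ q.2 ∈ V ∧ h q ≠ 0 :=
  IsOpen.mem_nhds (TopologicalSpace.isOpen_generateFrom_of_mem ⟨U, V, h, hU, hV, hh, rfl⟩)
    ⟨h1, h2, h3⟩

theorem prod_rect_mem_nhds (hX : X.IsLocal) (hY : Y.IsLocal) {U : Set X} {V : Set Y}
    (hU : IsOpen U) (hV : IsOpen V) {p : X.prod Y} (h1 : p.1 ∈ U) (h2 : p.2 ∈ V) :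
    ∀ᶠ q : X.prod Y in 𝓝 p, q.1 ∈ U ∧ q.2 ∈ V := by
  filter_upwards [prod_basic_mem_nhds hU hV (isTensor_fst hY V fun x _ => hX.const x 1) h1 h2
    one_ne_zero] with q hq using ⟨hq.1, hq.2.1⟩

/-- Sums of products of regular germs are regular. -/
theorem prod_reg_of_isTensor (hX : X.IsLocal) (hY : Y.IsLocal) {U : Set X} {V : Set Y}
    (hU : IsOpen U) (hV : IsOpen V) {h : X × Y → ℂ} (hh : IsTensor X Y U V h) {p : X.prod Y}
    (h1 : p.1 ∈ U) (h2 : p.2 ∈ V) : (X.prod Y).reg p h :=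
  ⟨U, V, h, fun _ => 1, hU, hV, h1, h2, hh, isTensor_fst hY V fun x _ => hX.const x 1,
    one_ne_zero, Eventually.of_forall fun y => by simp⟩

theorem prod_reg_iff {p : X.prod Y} {F : X.prod Y → ℂ} : (X.prod Y).reg p F ↔
    ∃ (U : Set X) (V : Set Y) (h₁ h₂ : X × Y → ℂ), IsOpen U ∧ IsOpen V ∧ p.1 ∈ U ∧ p.2 ∈ V ∧
      IsTensor X Y U V h₁ ∧ IsTensor X Y U V h₂ ∧ h₂ p ≠ 0 ∧
      ∀ᶠ r : X.prod Y in 𝓝 p, F r = h₁ r / h₂ r :=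
  Iff.rfl

theorem prod_isLocal (hX : X.IsLocal) (hY : Y.IsLocal) : (X.prod Y).IsLocal where
  congr := by
    intro p f g hf hfg
    obtain ⟨U, V, h₁, h₂, hU, hV, h1, h2, ht1, ht2, h0, h⟩ := prod_reg_iff.1 hf
    refine ⟨U, V, h₁, h₂, hU, hV, h1, h2, ht1, ht2, h0, ?_⟩
    filter_upwards [h, hfg] with y h1 h2
    rw [← h2, h1]
  const p c := prod_reg_of_isTensor hX hY isOpen_univ isOpen_univ
    (isTensor_fst hY Set.univ (f := fun _ => c) fun x _ => hX.const x c) trivial trivial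
  add := by
    intro p f g hf hg
    obtain ⟨U, V, h₁, h₂, hU, hV, h1, h2, ht1, ht2, h0, h⟩ := prod_reg_iff.1 hf
    obtain ⟨U', V', h₁', h₂', hU', hV', h1', h2', ht1', ht2', h0', h'⟩ :=
      prod_reg_iff.1 hg
    have a1 := ht1.mono (U' := U ∩ U') (V' := V ∩ V') Set.inter_subset_left Set.inter_subset_left
    have a2 := ht2.mono (U' := U ∩ U') (V' := V ∩ V') Set.inter_subset_left Set.inter_subset_left
    have a3 := ht1'.mono (U' := U ∩ U') (V' := V ∩ V') Set.inter_subset_right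
      Set.inter_subset_right
    have a4 := ht2'.mono (U' := U ∩ U') (V' := V ∩ V') Set.inter_subset_right
      Set.inter_subset_right
    refine ⟨U ∩ U', V ∩ V', _, _, hU.inter hU', hV.inter hV', ⟨h1, h1'⟩, ⟨h2, h2'⟩,
      (a1.mul hX hY a4).add (a3.mul hX hY a2), a2.mul hX hY a4, mul_ne_zero h0 h0', ?_⟩
    filter_upwards [h, h', prod_basic_mem_nhds hU hV ht2 h1 h2 h0,
      prod_basic_mem_nhds hU' hV' ht2' h1' h2' h0'] with y e1 e2 e3 e4
    have e3 := e3.2.2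
    have e4 := e4.2.2
    rw [e1, e2]
    field_simp
  mul := by
    intro p f g hf hg
    obtain ⟨U, V, h₁, h₂, hU, hV, h1, h2, ht1, ht2, h0, h⟩ := prod_reg_iff.1 hf
    obtain ⟨U', V', h₁', h₂', hU', hV', h1', h2', ht1', ht2', h0', h'⟩ :=
      prod_reg_iff.1 hg
    have a1 := ht1.mono (U' := U ∩ U') (V' := V ∩ V') Set.inter_subset_left Set.inter_subset_left
    have a2 := ht2.mono (U' := U ∩ U') (V' := V ∩ V') Set.inter_subset_left Set.inter_subset_left
    have a3 := ht1'.mono (U' := U ∩ U') (V' := V ∩ V') Set.inter_subset_right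
      Set.inter_subset_right
    have a4 := ht2'.mono (U' := U ∩ U') (V' := V ∩ V') Set.inter_subset_right
      Set.inter_subset_right
    refine ⟨U ∩ U', V ∩ V', _, _, hU.inter hU', hV.inter hV', ⟨h1, h1'⟩, ⟨h2, h2'⟩,
      a1.mul hX hY a3, a2.mul hX hY a4, mul_ne_zero h0 h0', ?_⟩
    filter_upwards [h, h'] with y e1 e2
    rw [e1, e2, div_mul_div_comm]
  inv := by
    intro p f hg hf
    obtain ⟨U, V, h₁, h₂, hU, hV, h1, h2, ht1, ht2, h0, h⟩ := prod_reg_iff.1 hg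
    refine ⟨U, V, h₂, h₁, hU, hV, h1, h2, ht2, ht1, fun h3 => hf ?_, ?_⟩
    · rw [h.self_of_nhds, h3, zero_div]
    filter_upwards [h] with y h1
    rw [h1, inv_div]
  ne := by
    intro p f hg hf
    obtain ⟨U, V, h₁, h₂, hU, hV, h1, h2, ht1, ht2, h0, h⟩ := prod_reg_iff.1 hg
    have h3 : h₁ p ≠ 0 := fun h3 => hf (by rw [h.self_of_nhds, h3, zero_div])
    filter_upwards [h, prod_basic_mem_nhds hU hV ht2 h1 h2 h0,
      prod_basic_mem_nhds hU hV ht1 h1 h2 h3] with y e1 e2 e3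
    rw [e1]
    exact div_ne_zero e3.2.2 e2.2.2
  near := by
    intro p f hf
    obtain ⟨U, V, h₁, h₂, hU, hV, h1, h2, ht1, ht2, h0, h⟩ := prod_reg_iff.1 hf
    filter_upwards [eventually_eventually_nhds.2 h, prod_basic_mem_nhds hU hV ht2 h1 h2 h0]
      with y e1 e2
    exact ⟨U, V, h₁, h₂, hU, hV, e2.1, e2.2.1, ht1, ht2, e2.2.2, e1⟩

theorem continuousAt_fst (hX : X.IsLocal) (hY : Y.IsLocal) (p : X.prod Y) :
    ContinuousAt (fun q : X.prod Y => q.1) p := by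
  intro N hN
  obtain ⟨U, hUN, hU, hp⟩ := mem_nhds_iff.1 hN
  exact (prod_rect_mem_nhds hX hY hU isOpen_univ hp trivial).mono fun q hq => hUN hq.1

theorem continuousAt_snd (hX : X.IsLocal) (hY : Y.IsLocal) (p : X.prod Y) :
    ContinuousAt (fun q : X.prod Y => q.2) p := by
  intro N hN
  obtain ⟨U, hUN, hU, hp⟩ := mem_nhds_iff.1 hN
  exact (prod_rect_mem_nhds hX hY isOpen_univ hU trivial hp).mono fun q hq => hUN hq.2

theorem morphAt_fst (hX : X.IsLocal) (hY : Y.IsLocal) (p : X.prod Y) :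
    MorphAt (X := X.prod Y) (Y := X) (fun q => q.1) p := by
  refine ⟨continuousAt_fst hX hY p, fun g hg => ?_⟩
  obtain ⟨U, hUN, hU, hp⟩ := mem_nhds_iff.1 (hX.near hg)
  exact prod_reg_of_isTensor hX hY hU isOpen_univ (isTensor_fst hY Set.univ fun x hx => hUN hx)
    hp trivial

theorem morphAt_snd (hX : X.IsLocal) (hY : Y.IsLocal) (p : X.prod Y) :
    MorphAt (X := X.prod Y) (Y := Y) (fun q => q.2) p := by
  refine ⟨continuousAt_snd hX hY p, fun g hg => ?_⟩
  obtain ⟨U, hUN, hU, hp⟩ := mem_nhds_iff.1 (hY.near hg)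
  exact prod_reg_of_isTensor hX hY isOpen_univ hU (isTensor_snd hX Set.univ fun x hx => hUN hx)
    trivial hp

theorem MorphAt.fst (hX : X.IsLocal) (hY : Y.IsLocal) {Z : FSpace.{w}} {f : Z → X.prod Y} {z : Z}
    (h : MorphAt f z) : MorphAt (X := Z) (Y := X) (fun a => (f a).1) z :=
  (morphAt_fst hX hY (f z)).comp h

theorem MorphAt.snd (hX : X.IsLocal) (hY : Y.IsLocal) {Z : FSpace.{w}} {f : Z → X.prod Y} {z : Z}
    (h : MorphAt f z) : MorphAt (X := Z) (Y := Y) (fun a => (f a).2) z :=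
  (morphAt_snd hX hY (f z)).comp h

theorem IsTensor.reg_comp {Z : FSpace.{w}} (hZ : Z.IsLocal) {f : Z → X} {g : Z → Y} {z : Z}
    (hf : MorphAt f z) (hg : MorphAt g z) {U : Set X} {V : Set Y} (hU : IsOpen U) (hV : IsOpen V)
    {h : X × Y → ℂ} (hh : IsTensor X Y U V h) (h1 : f z ∈ U) (h2 : g z ∈ V) :
    Z.reg z (fun a => h (f a, g a)) := by
  obtain ⟨n, F, G, hF, hG, e⟩ := hh
  refine hZ.congr (hZ.sum Finset.univ fun i _ =>
    hZ.mul (hf.2 _ (hF i _ h1)) (hg.2 _ (hG i _ h2))) ?_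
  filter_upwards [hf.1.eventually (hU.mem_nhds h1), hg.1.eventually (hV.mem_nhds h2)] with a h3 h4
  exact (e _ h3 _ h4).symm

theorem morphAt_prodMk {Z : FSpace.{w}} (hZ : Z.IsLocal) {f : Z → X} {g : Z → Y} {z : Z}
    (hf : MorphAt f z) (hg : MorphAt g z) :
    MorphAt (X := Z) (Y := X.prod Y) (fun a => (f a, g a)) z := by
  have hc : ContinuousAt (X := Z) (Y := X.prod Y) (fun a => (f a, g a)) z := by
    refine TopologicalSpace.tendsto_nhds_generateFrom_iff.2 ?_
    rintro _ ⟨U, V, h, hU, hV, hh, rfl⟩ ⟨h1, h2, h3⟩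
    filter_upwards [hf.1.eventually (hU.mem_nhds h1), hg.1.eventually (hV.mem_nhds h2),
      hZ.ne (hh.reg_comp hZ hf hg hU hV h1 h2) h3] with a e1 e2 e3
    exact ⟨e1, e2, e3⟩
  refine ⟨hc, ?_⟩
  rintro F ⟨U, V, h₁, h₂, hU, hV, h1, h2, ht1, ht2, h0, h⟩
  refine hZ.congr (hZ.mul (ht1.reg_comp hZ hf hg hU hV h1 h2)
    (hZ.inv (ht2.reg_comp hZ hf hg hU hV h1 h2) h0)) ?_
  filter_upwards [hc.eventually h] with a ha
  simp only [Function.comp]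
  rw [ha, div_eq_mul_inv]

end Prod

/-! ### Quotients -/

section Quotient

variable {X : FSpace.{u}} {T : Type v} (π : X → T)

/-- Points in the same fibre of `π` are related by an endomorphism over the quotient. -/
def HomogeneousFibres : Prop :=
  ∀ x x' : X, π x = π x' → ∃ φ : X → X, IsMorphism φ ∧ φ x = x' ∧ ∀ y, π (φ y) = π y

theorem morphAt_quotientMk (x : X) : MorphAt (X := X) (Y := X.quotient π) π x :=
  ⟨@Continuous.continuousAt _ _ X.top (X.quotient π).top _ x
    continuous_coinduced_rng, fun _ hg => hg x rfl⟩

theorem HomogeneousFibres.isOpenMap {π : X → T} (h : HomogeneousFibres π) :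
    IsOpenMap (X := X) (Y := X.quotient π) π := by
  intro U hU
  refine isOpen_coinduced.2 (isOpen_iff_mem_nhds.2 ?_)
  rintro x ⟨x', hx', e⟩
  obtain ⟨φ, hφ, rfl, h2⟩ := h x x' e.symm
  filter_upwards [hφ.1.continuousAt.eventually (hU.mem_nhds hx')] with y hy
  exact ⟨φ y, hy, h2 y⟩

theorem eventually_quotient {π : X → T} (h : HomogeneousFibres π) {x : X} {p : T → Prop}
    (hp : ∀ᶠ y in 𝓝 x, p (π y)) : ∀ᶠ t : X.quotient π in @nhds (X.quotient π) (X.quotient π).top (π x), p t := by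
  refine Filter.mem_of_superset
    (h.isOpenMap.image_mem_nhds (X := X) (Y := X.quotient π) hp) ?_
  rintro _ ⟨y, hy, rfl⟩
  exact hy

theorem HomogeneousFibres.reg_comp {π : X → T} (h : HomogeneousFibres π) {f : T → ℂ}
    {x x' : X} (e : π x = π x') (hf : X.reg x' (f ∘ π)) : X.reg x (f ∘ π) := by
  obtain ⟨φ, hφ, rfl, h2⟩ := h x x' e
  have := hφ.2 x _ hf
  rwa [show (f ∘ π) ∘ φ = f ∘ π from funext fun y => by simp [h2]] at this

theorem quotient_isLocal (hX : X.IsLocal) {π : X → T} (h : HomogeneousFibres π)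
    (hs : Function.Surjective π) : (X.quotient π).IsLocal where
  congr := by
    rintro t f g hf hfg x rfl
    exact hX.congr (hf x rfl) ((morphAt_quotientMk π x).1.eventually hfg)
  const t c x _ := hX.const x c
  add hf hg x hx := hX.add (hf x hx) (hg x hx)
  mul hf hg x hx := hX.mul (hf x hx) (hg x hx)
  inv hf h0 x hx := hX.inv (hf x hx) (by subst hx; exact h0)
  ne := by
    intro t f hf h0
    obtain ⟨x, rfl⟩ := hs t
    exact eventually_quotient h (hX.ne (hf x rfl) h0)
  near := by
    intro t f hf
    obtain ⟨x, rfl⟩ := hs t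
    refine eventually_quotient h ?_
    filter_upwards [hX.near (hf x rfl)] with y hy x' hx'
    exact h.reg_comp hx' hy

end Quotient

/-! ### Regular families of vectors and of subspaces -/

section RegVec

variable {X : FSpace.{u}} {V : Type v} [AddCommGroup V] [Module ℂ V]

/-- The vector valued function `w` is regular at `x`. -/
def RegVec (X : FSpace.{u}) (x : X) (w : X → V) : Prop :=
  ∀ φ : V →ₗ[ℂ] ℂ, X.reg x (fun y => φ (w y))

theorem RegVec.const (hX : X.IsLocal) (x : X) (v : V) : RegVec X x (fun _ => v) :=
  fun φ => hX.const x (φ v)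

theorem RegVec.add (hX : X.IsLocal) {x : X} {w w' : X → V} (h : RegVec X x w)
    (h' : RegVec X x w') : RegVec X x (fun y => w y + w' y) :=
  fun φ => by simpa using hX.add (h φ) (h' φ)

theorem RegVec.sub (hX : X.IsLocal) {x : X} {w w' : X → V} (h : RegVec X x w)
    (h' : RegVec X x w') : RegVec X x (fun y => w y - w' y) :=
  fun φ => by simpa using hX.sub (h φ) (h' φ)

theorem RegVec.smul (hX : X.IsLocal) {x : X} {f : X → ℂ} {w : X → V} (hf : X.reg x f)
    (h : RegVec X x w) : RegVec X x (fun y => f y • w y) :=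
  fun φ => by simpa using hX.mul hf (h φ)

theorem RegVec.sum (hX : X.IsLocal) {x : X} {ι : Type*} (s : Finset ι) {w : ι → X → V}
    (h : ∀ i ∈ s, RegVec X x (w i)) : RegVec X x (fun y => ∑ i ∈ s, w i y) :=
  fun φ => by simpa using hX.sum s fun i hi => h i hi φ

theorem RegVec.map {x : X} {V' : Type*} [AddCommGroup V'] [Module ℂ V'] (ℓ : V →ₗ[ℂ] V')
    {w : X → V} (h : RegVec X x w) : RegVec X x (fun y => ℓ (w y)) :=
  fun φ => h (φ ∘ₗ ℓ)

theorem RegVec.comp {Y : FSpace.{w}} {f : Y → X} {y : Y} {w : X → V} (h : RegVec X (f y) w)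
    (hf : MorphAt f y) : RegVec Y y (fun a => w (f a)) :=
  fun φ => hf.2 _ (h φ)

theorem exists_leftInverse_frame {ι : Type*} [Fintype ι] [DecidableEq ι] {w : ι → V}
    (h : LinearIndependent ℂ w) :
    ∃ p : V →ₗ[ℂ] (ι → ℂ), ∀ i, p (w i) = Pi.single i 1 := by
  obtain ⟨p, hp⟩ := LinearMap.exists_leftInverse_of_injective (Fintype.linearCombination ℂ w)
    (LinearMap.ker_eq_bot.2 (linearIndependent_iff_injective_fintypeLinearCombination.1 h))
  refine ⟨p, fun i => ?_⟩
  have := LinearMap.congr_fun hp (Pi.single i 1)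
  simpa using this

theorem linearIndependent_of_det_ne_zero {ι : Type*} [Fintype ι] [DecidableEq ι] {w : ι → V}
    (p : V →ₗ[ℂ] (ι → ℂ)) (h : (Matrix.of fun i => p (w i)).det ≠ 0) :
    LinearIndependent ℂ w :=
  LinearIndependent.of_comp p (Matrix.linearIndependent_rows_of_det_ne_zero h)

theorem RegVec.eventually_linearIndependent (hX : X.IsLocal) {x : X} {ι : Type*} [Finite ι]
    {w : X → ι → V} (hw : ∀ i, RegVec X x (fun y => w y i)) (h : LinearIndependent ℂ (w x)) :
    ∀ᶠ y in 𝓝 x, LinearIndependent ℂ (w y) := by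
  classical
  have := Fintype.ofFinite ι
  obtain ⟨p, hp⟩ := exists_leftInverse_frame h
  have h1 : X.reg x (fun y => (Matrix.of fun i => p (w y i)).det) :=
    hX.det fun i j => hw i (LinearMap.proj j ∘ₗ p)
  have h2 : (Matrix.of fun i => p (w x i)) = 1 := by
    ext i j
    simp [hp, Matrix.one_apply, Pi.single_apply, eq_comm]
  filter_upwards [hX.ne h1 (by simp [h2])] with y hy
  exact linearIndependent_of_det_ne_zero p hy

/-- A family of `d`-dimensional subspaces which near `x` is spanned by a regular frame. -/
def RegSub (X : FSpace.{u}) (d : ℕ) (L : X → Submodule ℂ V) (x : X) : Prop :=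
  ∃ w : X → Fin d → V, (∀ i, RegVec X x (fun y => w y i)) ∧
    ∀ᶠ y in 𝓝 x, LinearIndependent ℂ (w y) ∧ Submodule.span ℂ (Set.range (w y)) = L y

variable {d e r : ℕ} {x : X} {L M : X → Submodule ℂ V}

theorem RegSub.comp {Y : FSpace.{w}} {f : Y → X} {y : Y} (h : RegSub X d L (f y))
    (hf : MorphAt f y) : RegSub Y d (fun a => L (f a)) y := by
  obtain ⟨w, hw, h1⟩ := h
  exact ⟨fun a => w (f a), fun i => (hw i).comp hf, hf.1.eventually h1⟩

theorem RegSub.congr (h : RegSub X d L x) (h' : ∀ᶠ y in 𝓝 x, L y = M y) : RegSub X d M x := by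
  obtain ⟨w, hw, h1⟩ := h
  refine ⟨w, hw, ?_⟩
  filter_upwards [h1, h'] with y h2 h3
  rwa [← h3]

theorem RegSub.finrank_eq (h : RegSub X d L x) : finrank ℂ (L x) = d := by
  obtain ⟨w, -, h1⟩ := h
  obtain ⟨h2, h3⟩ := h1.self_of_nhds
  rw [← h3, finrank_span_eq_card h2, Fintype.card_fin]

theorem exists_frame [FiniteDimensional ℂ V] {N : Submodule ℂ V} (h : finrank ℂ N = r) :
    ∃ w : Fin r → V, LinearIndependent ℂ w ∧ Submodule.span ℂ (Set.range w) = N := by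
  have b := finBasisOfFinrankEq ℂ N h
  refine ⟨fun i => (b i : V), b.linearIndependent.map' N.subtype (Submodule.ker_subtype N), ?_⟩
  rw [Set.range_comp' (Subtype.val) b]
  have := congrArg (Submodule.map N.subtype) b.span_eq
  rw [Submodule.map_span, Submodule.map_subtype_top] at this
  exact this

theorem RegSub.const [FiniteDimensional ℂ V] (hX : X.IsLocal) (x : X) {N : Submodule ℂ V}
    (h : finrank ℂ N = d) : RegSub X d (fun _ => N) x := by
  obtain ⟨w, hw⟩ := exists_frame h
  exact ⟨fun _ => w, fun i => RegVec.const hX x _, Eventually.of_forall fun y => hw⟩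

theorem RegSub.map (hX : X.IsLocal) {V' : Type*} [AddCommGroup V'] [Module ℂ V']
    (ℓ : V →ₗ[ℂ] V') (h : RegSub X d L x) (h0 : Disjoint (L x) (LinearMap.ker ℓ)) :
    RegSub X d (fun y => (L y).map ℓ) x := by
  obtain ⟨w, hw, h1⟩ := h
  refine ⟨fun y i => ℓ (w y i), fun i => (hw i).map ℓ, ?_⟩
  obtain ⟨h2, h3⟩ := h1.self_of_nhds
  have h4 : LinearIndependent ℂ (fun i => ℓ (w x i)) := h2.map (by rwa [h3])
  filter_upwards [h1, RegVec.eventually_linearIndependent hX (fun i => (hw i).map ℓ) h4]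
    with y h5 h6
  refine ⟨h6, ?_⟩
  rw [← h5.2, Submodule.map_span, Set.range_comp' ℓ]

theorem exists_fin_linearIndependent {ι : Type*} [Finite ι] (u : ι → V)
    (h : finrank ℂ (Submodule.span ℂ (Set.range u)) = r) :
    ∃ a : Fin r → ι, LinearIndependent ℂ (u ∘ a) := by
  obtain ⟨κ, a, ha, h1, h2⟩ := exists_linearIndependent' ℂ u
  have := Finite.of_injective a ha
  have := Fintype.ofFinite κ
  have h3 : Fintype.card κ = r := by rw [← h, ← h1, finrank_span_eq_card h2]
  exact ⟨a ∘ (Fintype.equivFinOfCardEq h3).symm,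
    h2.comp _ (Fintype.equivFinOfCardEq h3).symm.injective⟩

theorem RegSub.span (hX : X.IsLocal) {ι : Type*} [Finite ι] {u : X → ι → V}
    (hu : ∀ i, RegVec X x (fun y => u y i))
    (h : ∀ᶠ y in 𝓝 x, finrank ℂ (Submodule.span ℂ (Set.range (u y))) = r) :
    RegSub X r (fun y => Submodule.span ℂ (Set.range (u y))) x := by
  obtain ⟨a, ha⟩ := exists_fin_linearIndependent (u x) h.self_of_nhds
  refine ⟨fun y i => u y (a i), fun i => hu _, ?_⟩
  filter_upwards [h, RegVec.eventually_linearIndependent hX (fun i => hu (a i)) ha] with y h1 h2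
  refine ⟨h2, ?_⟩
  have : FiniteDimensional ℂ (Submodule.span ℂ (Set.range (u y))) :=
    FiniteDimensional.span_of_finite ℂ (Set.finite_range _)
  refine Submodule.eq_of_le_of_finrank_eq (Submodule.span_mono (Set.range_comp_subset_range a _)) ?_
  rw [finrank_span_eq_card h2, Fintype.card_fin, h1]

theorem RegVec.eventually_le_finrank (hX : X.IsLocal) {ι : Type*} [Finite ι] {u : X → ι → V}
    (hu : ∀ i, RegVec X x (fun y => u y i)) :
    ∀ᶠ y in 𝓝 x, finrank ℂ (Submodule.span ℂ (Set.range (u x))) ≤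
      finrank ℂ (Submodule.span ℂ (Set.range (u y))) := by
  obtain ⟨a, ha⟩ := exists_fin_linearIndependent (u x) rfl
  filter_upwards [RegVec.eventually_linearIndependent hX (fun i => hu (a i)) ha] with y h2
  have : FiniteDimensional ℂ (Submodule.span ℂ (Set.range (u y))) :=
    FiniteDimensional.span_of_finite ℂ (Set.finite_range _)
  have h3 := Submodule.finrank_mono (Submodule.span_mono (R := ℂ)
    (Set.range_comp_subset_range a (u y)))
  change finrank ℂ (Submodule.span ℂ (Set.range (fun i => u y (a i)))) ≤ _ at h3
  rwa [finrank_span_eq_card h2, Fintype.card_fin] at h3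

/-- Generators of the sum of two families. -/
theorem RegSub.exists_sup (hL : RegSub X d L x) (hM : RegSub X e M x) :
    ∃ u : X → Fin d ⊕ Fin e → V, (∀ i, RegVec X x (fun y => u y i)) ∧
      ∀ᶠ y in 𝓝 x, Submodule.span ℂ (Set.range (u y)) = L y ⊔ M y := by
  obtain ⟨w, hw, h1⟩ := hL
  obtain ⟨w', hw', h1'⟩ := hM
  refine ⟨fun y => Sum.elim (w y) (w' y), ?_, ?_⟩
  · rintro (i | i)
    · exact hw i
    · exact hw' i
  · filter_upwards [h1, h1'] with y h2 h3
    rw [Set.Sum.elim_range, Submodule.span_union, h2.2, h3.2]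

theorem RegSub.sup (hX : X.IsLocal) (hL : RegSub X d L x) (hM : RegSub X e M x)
    (h : ∀ᶠ y in 𝓝 x, finrank ℂ (L y ⊔ M y : Submodule ℂ V) = r) :
    RegSub X r (fun y => L y ⊔ M y) x := by
  obtain ⟨u, hu, h1⟩ := hL.exists_sup hM
  refine (RegSub.span hX hu ?_).congr h1
  filter_upwards [h, h1] with y h2 h3
  rw [h3, h2]

theorem RegSub.eventually_le_finrank_sup (hX : X.IsLocal) (hL : RegSub X d L x)
    (hM : RegSub X e M x) : ∀ᶠ y in 𝓝 x, finrank ℂ (L x ⊔ M x : Submodule ℂ V) ≤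
      finrank ℂ (L y ⊔ M y : Submodule ℂ V) := by
  obtain ⟨u, hu, h1⟩ := hL.exists_sup hM
  filter_upwards [h1, RegVec.eventually_le_finrank hX hu] with y h2 h3
  rwa [h1.self_of_nhds, h2] at h3

theorem RegSub.eventually_finrank_eq (h : RegSub X d L x) : ∀ᶠ y in 𝓝 x, finrank ℂ (L y) = d := by
  obtain ⟨w, hw, h1⟩ := h
  filter_upwards [h1] with y h2
  rw [← h2.2, finrank_span_eq_card h2.1, Fintype.card_fin]

theorem RegSub.eventually_not_le [FiniteDimensional ℂ V] (hX : X.IsLocal) (hL : RegSub X d L x)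
    (hM : RegSub X e M x) (h : ¬ L x ≤ M x) : ∀ᶠ y in 𝓝 x, ¬ L y ≤ M y := by
  filter_upwards [hL.eventually_le_finrank_sup hX hM, hM.eventually_finrank_eq] with y h1 h2 h3
  rw [sup_eq_right.2 h3, h2] at h1
  have h4 : M x < L x ⊔ M x := lt_of_le_of_ne le_sup_right fun h5 => h (h5 ▸ le_sup_left)
  have := Submodule.finrank_lt_finrank_of_lt h4
  rw [hM.finrank_eq] at this
  omega

/-- Semicontinuity of the dimension of intersections. -/
theorem RegSub.eventually_finrank_inf_le [FiniteDimensional ℂ V] (hX : X.IsLocal)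
    (hL : RegSub X d L x) (hM : RegSub X e M x) : ∀ᶠ y in 𝓝 x,
      finrank ℂ (L y ⊓ M y : Submodule ℂ V) ≤ finrank ℂ (L x ⊓ M x : Submodule ℂ V) := by
  filter_upwards [hL.eventually_le_finrank_sup hX hM, hM.eventually_finrank_eq,
    hL.eventually_finrank_eq] with y h1 h2 h3
  have h4 := Submodule.finrank_sup_add_finrank_inf_eq (L x) (M x)
  have h5 := Submodule.finrank_sup_add_finrank_inf_eq (L y) (M y)
  rw [hL.finrank_eq, hM.finrank_eq] at h4
  omega

theorem RegSub.eventually_disjoint [FiniteDimensional ℂ V] (hX : X.IsLocal)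
    (hL : RegSub X d L x) (hM : RegSub X e M x) (h : L x ⊓ M x = ⊥) :
    ∀ᶠ y in 𝓝 x, L y ⊓ M y = ⊥ := by
  filter_upwards [hL.eventually_finrank_inf_le hX hM] with y h1
  rw [h, finrank_bot] at h1
  exact Submodule.finrank_eq_zero.1 (by omega)

theorem RegVec.bilin [FiniteDimensional ℂ V] (hX : X.IsLocal) (ω : LinearMap.BilinForm ℂ V)
    {w w' : X → V} (h : RegVec X x w) (h' : RegVec X x w') :
    X.reg x (fun y => ω (w y) (w' y)) := by
  have b := Module.finBasis ℂ V
  have e : ∀ y, ω (w y) (w' y) = ∑ i, b.coord i (w y) * ω (b i) (w' y) := by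
    intro y
    conv_lhs => rw [← b.sum_repr (w y)]
    simp only [map_sum, LinearMap.sum_apply, map_smul, LinearMap.smul_apply, smul_eq_mul,
      Basis.coord_apply]
  simp only [e]
  exact hX.sum _ fun i _ => hX.mul (h _) (h' _)

theorem isIsotropic_span {ω : LinearMap.BilinForm ℂ V} {ι : Type*} {w : ι → V}
    (h : ∀ i j, ω (w i) (w j) = 0) : IsIsotropic ω (Submodule.span ℂ (Set.range w)) := by
  intro a ha b hb
  induction ha using Submodule.span_induction with
  | mem a ha =>
    obtain ⟨i, rfl⟩ := ha
    induction hb using Submodule.span_induction with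
    | mem b hb =>
      obtain ⟨j, rfl⟩ := hb
      exact h i j
    | zero => simp
    | add b c _ _ hb hc => simp [hb, hc]
    | smul t b _ hb => simp [hb]
  | zero => simp
  | add b c _ _ hb hc => simp [hb, hc]
  | smul t b _ hb => simp [hb]

theorem RegSub.eventually_not_isotropic [FiniteDimensional ℂ V] (hX : X.IsLocal)
    (ω : LinearMap.BilinForm ℂ V) (hL : RegSub X d L x) (h : ¬ IsIsotropic ω (L x)) :
    ∀ᶠ y in 𝓝 x, ¬ IsIsotropic ω (L y) := by
  obtain ⟨w, hw, h1⟩ := hL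
  have h2 : ∃ i j, ω (w x i) (w x j) ≠ 0 := by
    by_contra! h2
    apply h
    rw [← h1.self_of_nhds.2]
    exact isIsotropic_span h2
  obtain ⟨i, j, h2⟩ := h2
  filter_upwards [hX.ne ((hw i).bilin hX ω (hw j)) h2, h1] with y h3 h4 h5
  exact h3 (h5 _ (h4.2 ▸ Submodule.subset_span ⟨i, rfl⟩) _
    (h4.2 ▸ Submodule.subset_span ⟨j, rfl⟩))

theorem orthogonal_sup (ω : LinearMap.BilinForm ℂ V) (N N' : Submodule ℂ V) :
    ω.orthogonal (N ⊔ N') = ω.orthogonal N ⊓ ω.orthogonal N' := by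
  refine le_antisymm (le_inf (LinearMap.BilinForm.orthogonal_le le_sup_left)
    (LinearMap.BilinForm.orthogonal_le le_sup_right)) ?_
  rintro v ⟨h1, h2⟩ n hn
  obtain ⟨a, ha, b, hb, rfl⟩ := Submodule.mem_sup.1 hn
  change ω (a + b) v = 0
  have e1 : ω a v = 0 := h1 a ha
  have e2 : ω b v = 0 := h2 b hb
  simp [e1, e2]

section Orthogonal

variable [FiniteDimensional ℂ V] {ω : LinearMap.BilinForm ℂ V}

theorem RegSub.orthogonal (hX : X.IsLocal) (hω : ω.Nondegenerate) (hL : RegSub X d L x) :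
    RegSub X (finrank ℂ V - d) (fun y => ω.orthogonal (L y)) x := by
  have hdim := hL.eventually_finrank_eq
  obtain ⟨w, hw, h1⟩ := hL
  obtain ⟨p, hp⟩ := exists_leftInverse_frame h1.self_of_nhds.1
  let v : Fin d → V := fun j => (LinearMap.BilinForm.toDual ω.flip hω.flip).symm
    (LinearMap.proj j ∘ₗ p)
  have hv : ∀ a j, ω a (v j) = p a j := by
    intro a j
    have := LinearMap.BilinForm.toDual_def hω.flip (m := v j) (n := a)
    rw [LinearEquiv.apply_symm_apply] at this
    simpa using this.symm
  let G : X → Matrix (Fin d) (Fin d) ℂ := fun y => Matrix.of fun l j => ω (w y l) (v j)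
  have hG : ∀ i j, X.reg x (fun y => G y i j) := fun i j =>
    (hw i).bilin hX ω (RegVec.const hX x (v j))
  have hGx : G x = 1 := by
    ext i j
    simp [G, hv, hp, Matrix.one_apply, Pi.single_apply, eq_comm]
  have hr : finrank ℂ (ω.orthogonal (L x)) = finrank ℂ V - d := by
    rw [LinearMap.BilinForm.finrank_orthogonal hω, hdim.self_of_nhds]
  have b := finBasisOfFinrankEq ℂ _ hr
  let c : X → Fin (finrank ℂ V - d) → Fin d → ℂ := fun y i =>
    (G y)⁻¹.mulVec fun l => ω (w y l) (b i : V)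
  let u : X → Fin (finrank ℂ V - d) → V := fun y i => (b i : V) - ∑ j, c y i j • v j
  have hu : ∀ i, RegVec X x (fun y => u y i) := by
    intro i
    refine (RegVec.const hX x _).sub hX (RegVec.sum hX _ fun j _ =>
      RegVec.smul hX ?_ (RegVec.const hX x _))
    simp only [c, Matrix.mulVec, dotProduct]
    exact hX.sum _ fun l _ => hX.mul (hX.matrix_inv hG (by simp [hGx]) j l)
      ((hw l).bilin hX ω (RegVec.const hX x _))
  have hux : u x = fun i => (b i : V) := by
    funext i
    have : c x i = 0 := by
      have h0 : (fun l => ω (w x l) (b i : V)) = 0 := by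
        funext l
        exact (b i).2 _ (h1.self_of_nhds.2 ▸ Submodule.subset_span ⟨l, rfl⟩)
      simp only [c, h0, Matrix.mulVec_zero]
    simp [u, this]
  have hli : LinearIndependent ℂ (u x) := by
    rw [hux]
    exact b.linearIndependent.map' (Submodule.subtype _) (Submodule.ker_subtype _)
  refine ⟨u, hu, ?_⟩
  filter_upwards [h1, hdim, RegVec.eventually_linearIndependent hX hu hli,
    hX.ne (hX.det hG) (by simp [hGx])] with y h2 h3 h4 h5
  refine ⟨h4, Submodule.eq_of_le_of_finrank_eq ?_ ?_⟩
  · rw [Submodule.span_le]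
    rintro _ ⟨i, rfl⟩ n hn
    rw [← h2.2] at hn
    have key : ∀ l, ω (w y l) (u y i) = 0 := by
      intro l
      have h6 : (G y).mulVec (c y i) l = ω (w y l) (b i : V) := by
        simp only [c, Matrix.mulVec_mulVec]
        rw [Matrix.mul_nonsing_inv _ (isUnit_iff_ne_zero.2 h5), Matrix.one_mulVec]
      simp only [u, map_sub, map_sum, map_smul, smul_eq_mul]
      rw [← h6]
      simp only [Matrix.mulVec, dotProduct, G, Matrix.of_apply]
      rw [sub_eq_zero]
      exact Finset.sum_congr rfl fun j _ => mul_comm _ _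
    change ω n (u y i) = 0
    induction hn using Submodule.span_induction with
    | mem a ha =>
      obtain ⟨l, rfl⟩ := ha
      exact key l
    | zero => simp
    | add b c _ _ hb hc => simp [hb, hc]
    | smul t b _ hb => simp [hb]
  · rw [finrank_span_eq_card h4, Fintype.card_fin, LinearMap.BilinForm.finrank_orthogonal hω, h3]

theorem inf_eq_orthogonal_sup (hω : ω.Nondegenerate) (hω' : ω.IsRefl) (N N' : Submodule ℂ V) :
    N ⊓ N' = ω.orthogonal (ω.orthogonal N ⊔ ω.orthogonal N') := by
  rw [orthogonal_sup, LinearMap.BilinForm.orthogonal_orthogonal hω hω',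
    LinearMap.BilinForm.orthogonal_orthogonal hω hω']

theorem RegSub.inf (hX : X.IsLocal) (hω : ω.Nondegenerate) (hω' : ω.IsRefl)
    (hL : RegSub X d L x) (hM : RegSub X e M x)
    (h : ∀ᶠ y in 𝓝 x, finrank ℂ (L y ⊓ M y : Submodule ℂ V) = r) :
    RegSub X r (fun y => L y ⊓ M y) x := by
  have h0 := h.self_of_nhds
  have hr : r ≤ finrank ℂ V := h0 ▸ Submodule.finrank_le _
  have h1 := ((hL.orthogonal hX hω).sup hX (hM.orthogonal hX hω) (r := finrank ℂ V - r)
    (by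
      filter_upwards [h] with y h2
      have h3 := LinearMap.BilinForm.finrank_orthogonal hω
        (ω.orthogonal (L y) ⊔ ω.orthogonal (M y))
      rw [← inf_eq_orthogonal_sup hω hω', h2] at h3
      have := Submodule.finrank_le (ω.orthogonal (L y) ⊔ ω.orthogonal (M y))
      omega)).orthogonal hX hω
  rw [Nat.sub_sub_self hr] at h1
  exact h1.congr (Eventually.of_forall fun y => (inf_eq_orthogonal_sup hω hω' _ _).symm)

end Orthogonal

end RegVec

/-! ### Grassmannians -/

section Frames

variable {V : Type u} [AddCommGroup V] [Module ℂ V]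

/-- Linear combinations of the vectors of a frame with the coefficients in the rows of a matrix. -/
def changeFrame {d : ℕ} (g : Matrix (Fin d) (Fin d) ℂ) (y : Fin d → V) : Fin d → V :=
  fun a => ∑ c, g a c • y c

theorem changeFrame_mul {d : ℕ} (g g' : Matrix (Fin d) (Fin d) ℂ) (y : Fin d → V) :
    changeFrame g (changeFrame g' y) = changeFrame (g * g') y := by
  funext a
  simp only [changeFrame, Finset.smul_sum, smul_smul, Matrix.mul_apply, Finset.sum_smul]
  exact Finset.sum_comm

theorem changeFrame_one {d : ℕ} (y : Fin d → V) : changeFrame 1 y = y := by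
  funext a
  simp [changeFrame, Matrix.one_apply]

theorem span_changeFrame_le {d : ℕ} (g : Matrix (Fin d) (Fin d) ℂ) (y : Fin d → V) :
    Submodule.span ℂ (Set.range (changeFrame g y)) ≤ Submodule.span ℂ (Set.range y) := by
  rw [Submodule.span_le]
  rintro _ ⟨a, rfl⟩
  exact Submodule.sum_mem _ fun c _ => Submodule.smul_mem _ _ (Submodule.subset_span ⟨c, rfl⟩)

theorem span_changeFrame {d : ℕ} {g g' : Matrix (Fin d) (Fin d) ℂ} (h : g' * g = 1)
    (y : Fin d → V) :
    Submodule.span ℂ (Set.range (changeFrame g y)) = Submodule.span ℂ (Set.range y) := by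
  refine le_antisymm (span_changeFrame_le g y) ?_
  conv_lhs => rw [← changeFrame_one y, ← h, ← changeFrame_mul]
  exact span_changeFrame_le _ _

theorem linearIndependent_changeFrame {d : ℕ} {g g' : Matrix (Fin d) (Fin d) ℂ} (h : g' * g = 1)
    {y : Fin d → V} (hy : LinearIndependent ℂ y) : LinearIndependent ℂ (changeFrame g y) := by
  rw [linearIndependent_iff_card_eq_finrank_span, Set.finrank, span_changeFrame h,
    finrank_span_eq_card hy]

theorem exists_changeFrame {d : ℕ} {y y' : Fin d → V} (hy : LinearIndependent ℂ y)
    (h : Submodule.span ℂ (Set.range y) = Submodule.span ℂ (Set.range y')) :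
    ∃ g g' : Matrix (Fin d) (Fin d) ℂ, g' * g = 1 ∧ changeFrame g y = y' := by
  have h1 : ∀ a, ∃ c : Fin d → ℂ, ∑ i, c i • y i = y' a := fun a =>
    Submodule.mem_span_range_iff_exists_fun ℂ |>.1 (h ▸ Submodule.subset_span ⟨a, rfl⟩)
  have h2 : ∀ a, ∃ c : Fin d → ℂ, ∑ i, c i • y' i = y a := fun a =>
    Submodule.mem_span_range_iff_exists_fun ℂ |>.1 (h ▸ Submodule.subset_span ⟨a, rfl⟩)
  choose g hg using h1
  choose g' hg' using h2
  have e1 : changeFrame (Matrix.of g) y = y' := funext hg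
  have e2 : changeFrame (Matrix.of g') y' = y := funext hg'
  refine ⟨Matrix.of g, Matrix.of g', ?_, e1⟩
  have e3 : changeFrame (Matrix.of g' * Matrix.of g) y = changeFrame 1 y := by
    rw [← changeFrame_mul, e1, e2, changeFrame_one]
  ext a c
  have e4 := congrFun e3 a
  simp only [changeFrame] at e4
  exact congrFun (hy.fintypeLinearCombination_injective
    (by simpa [Fintype.linearCombination_apply] using e4)) c

variable {ι : Type v} {d : ι → ℕ}

theorem frames_isLocal : (frames ι d V).IsLocal :=
  restrict_isLocal (affine_isLocal _) _

theorem regVec_frames (x : frames ι d V) (i : ι) (a : Fin (d i)) :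
    RegVec (frames ι d V) x (fun w => w.1 i a) := fun φ =>
  (morphAt_val (X := affine (∀ i, Fin (d i) → V)) x).2 _
    (affine_reg (φ ∘ₗ LinearMap.proj (φ := fun _ : Fin (d i) => V) a ∘ₗ
      LinearMap.proj (φ := fun i => Fin (d i) → V) i) _)

theorem morphAt_frames [Finite ι] {Z : FSpace.{w}} (hZ : Z.IsLocal) {f : Z → frames ι d V} {z : Z}
    (h : ∀ i a, RegVec Z z (fun y => (f y).1 i a)) : MorphAt f z := by
  classical
  have := Fintype.ofFinite ι
  refine morphAt_restrict hZ (morphAt_affine hZ fun φ => ?_)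
  have e : ∀ w : ∀ i, Fin (d i) → V, φ w = ∑ i, ∑ a,
      (φ ∘ₗ LinearMap.single ℂ _ i ∘ₗ LinearMap.single ℂ _ a) (w i a) := by
    intro w
    conv_lhs => rw [← Finset.univ_sum_single w]
    rw [map_sum]
    refine Finset.sum_congr rfl fun i _ => ?_
    conv_lhs => rw [← Finset.univ_sum_single (w i)]
    have := map_sum (φ ∘ₗ LinearMap.single ℂ (fun i => Fin (d i) → V) i)
      (fun a => Pi.single a (w i a)) Finset.univ
    exact this
  exact hZ.congr (hZ.sum _ fun i _ => hZ.sum _ fun a _ => h i a _)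
    (Eventually.of_forall fun y => (e (f y).1).symm)

variable {T : Type w} {q : frames ι d V → T}

/-- `q` parametrizes the tuples of subspaces spanned by frames. -/
def IsSpanMap (q : frames ι d V → T) : Prop :=
  Function.Surjective q ∧ ∀ w w' : frames ι d V, q w = q w' ↔
    ∀ i, Submodule.span ℂ (Set.range (w.1 i)) = Submodule.span ℂ (Set.range (w'.1 i))

theorem IsSpanMap.homogeneousFibres [Finite ι] (hq : IsSpanMap q) : HomogeneousFibres q := by
  intro x x' h
  have h1 := (hq.2 x x').1 h
  choose g g' hg h2 using fun i => exists_changeFrame (x.2 i) (h1 i)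
  refine ⟨fun y => ⟨fun i => changeFrame (g i) (y.1 i),
    fun i => linearIndependent_changeFrame (hg i) (y.2 i)⟩, ?_, ?_, ?_⟩
  · refine isMorphism_iff.2 fun y => morphAt_frames frames_isLocal fun i a => ?_
    simp only [changeFrame]
    exact RegVec.sum frames_isLocal _ fun c _ =>
      RegVec.smul frames_isLocal (frames_isLocal.const _ _) (regVec_frames y i c)
  · exact Subtype.ext (funext h2)
  · exact fun y => (hq.2 _ _).2 fun i => span_changeFrame (hg i) _

theorem IsSpanMap.isLocal [Finite ι] (hq : IsSpanMap q) : ((frames ι d V).quotient q).IsLocal :=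
  quotient_isLocal frames_isLocal hq.homogeneousFibres hq.1

/-- The frame of a subspace `N` on which the coordinate functions `p` form a coordinate system. -/
noncomputable def normalFrame {r : ℕ} (p : V →ₗ[ℂ] (Fin r → ℂ)) (N : Submodule ℂ V) (a : Fin r) :
    V :=
  open Classical in if h : ∃ v ∈ N, p v = Pi.single a 1 then h.choose else 0

theorem normalFrame_eq {r : ℕ} (p : V →ₗ[ℂ] (Fin r → ℂ)) {w : Fin r → V}
    (h : (Matrix.of fun i => p (w i)).det ≠ 0) :
    normalFrame p (Submodule.span ℂ (Set.range w)) =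
      changeFrame (Matrix.of fun i => p (w i))⁻¹ w := by
  funext a
  set P : Matrix (Fin r) (Fin r) ℂ := Matrix.of fun i => p (w i) with hP
  have hu : IsUnit P.det := isUnit_iff_ne_zero.2 h
  have hp : ∀ c : Fin r → ℂ, p (∑ i, c i • w i) = Matrix.vecMul c P := by
    intro c
    ext j
    simp [Matrix.vecMul, dotProduct, hP]
  have hex : ∃ v ∈ Submodule.span ℂ (Set.range w), p v = Pi.single a 1 := by
    refine ⟨changeFrame P⁻¹ w a, span_changeFrame_le _ _ (Submodule.subset_span ⟨a, rfl⟩), ?_⟩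
    rw [changeFrame, hp]
    have : (P⁻¹ a) = Matrix.vecMul (Pi.single a 1) P⁻¹ := by simp [Matrix.row]
    rw [this, Matrix.vecMul_vecMul, Matrix.nonsing_inv_mul _ hu, Matrix.vecMul_one]
  rw [normalFrame, dif_pos hex]
  obtain ⟨h1, h2⟩ := hex.choose_spec
  obtain ⟨c, hc⟩ := (Submodule.mem_span_range_iff_exists_fun ℂ).1 h1
  rw [← hc, hp] at h2
  rw [← hc, changeFrame]
  have : c = P⁻¹ a := by
    have h3 := congrArg (fun t => Matrix.vecMul t P⁻¹) h2
    simp only [Matrix.vecMul_vecMul, Matrix.mul_nonsing_inv _ hu, Matrix.vecMul_one] at h3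
    rw [h3]
    simp [Matrix.row]
  rw [this]

/-- The tautological families on a product of Grassmannians. -/
theorem IsSpanMap.regSub [Finite ι] (hq : IsSpanMap q) (i : ι) {K : T → Submodule ℂ V}
    (hK : ∀ w, K (q w) = Submodule.span ℂ (Set.range (w.1 i))) (t : T) :
    RegSub ((frames ι d V).quotient q) (d i) K t := by
  obtain ⟨w₀, rfl⟩ := hq.1 t
  obtain ⟨p, hp⟩ := exists_leftInverse_frame (w₀.2 i)
  have hreg : ∀ w : frames ι d V, ∀ a b, (frames ι d V).reg w
      (fun y => (Matrix.of fun c => p (y.1 i c)) a b) := fun w a b =>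
    regVec_frames w i a (LinearMap.proj b ∘ₗ p)
  have hdet : ∀ w : frames ι d V, q w = q w₀ → (Matrix.of fun c => p (w.1 i c)).det ≠ 0 := by
    intro w hw
    obtain ⟨g, g', hg, h1⟩ := exists_changeFrame (w.2 i) (((hq.2 _ _).1 hw) i)
    intro h0
    have h2 : g * (Matrix.of fun c => p (w.1 i c)) = 1 := by
      ext a b
      have := congrFun (hp a) b
      rw [← congrFun h1 a, changeFrame] at this
      simp only [map_sum, map_smul, Finset.sum_apply, Pi.smul_apply, smul_eq_mul] at this
      rw [Matrix.mul_apply, Matrix.one_apply]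
      simpa [Pi.single_apply, eq_comm] using this
    have h3 := congrArg Matrix.det h2
    rw [Matrix.det_mul, h0] at h3
    simp at h3
  refine ⟨fun s => normalFrame p (K s), fun a φ => ?_, ?_⟩
  · intro w hw
    refine frames_isLocal.congr (f := fun y =>
      ∑ c, (Matrix.of fun c => p (y.1 i c))⁻¹ a c * φ (y.1 i c)) ?_ ?_
    · exact frames_isLocal.sum _ fun c _ => frames_isLocal.mul
        (frames_isLocal.matrix_inv (hreg w) (hdet w hw) a c) (regVec_frames w i c φ)
    · filter_upwards [frames_isLocal.ne (frames_isLocal.det (hreg w)) (hdet w hw)] with y hy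
      simp only [Function.comp]
      rw [hK, normalFrame_eq p hy, changeFrame]
      simp
  · refine eventually_quotient hq.homogeneousFibres ?_
    filter_upwards [frames_isLocal.ne (frames_isLocal.det (hreg w₀)) (hdet w₀ rfl)] with y hy
    have hinv : (Matrix.of fun c => p (y.1 i c)) * (Matrix.of fun c => p (y.1 i c))⁻¹ = 1 :=
      Matrix.mul_nonsing_inv _ (isUnit_iff_ne_zero.2 hy)
    rw [hK, normalFrame_eq p hy]
    exact ⟨linearIndependent_changeFrame hinv (y.2 i), span_changeFrame hinv _⟩

open Classical in
theorem morphAt_of_frames [Finite ι] {Z : FSpace.{w'}} (hZ : Z.IsLocal)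
    {f : Z → (frames ι d V).quotient q} {z : Z} (w : Z → ∀ i, Fin (d i) → V)
    (hw : ∀ i a, RegVec Z z (fun y => w y i a))
    (hf : ∀ᶠ y in 𝓝 z, ∃ h : ∀ i, LinearIndependent ℂ (w y i), q ⟨w y, h⟩ = f y) :
    MorphAt f z := by
  obtain ⟨h0, hz⟩ := hf.self_of_nhds
  let g : Z → frames ι d V := fun y =>
    if h : ∀ i, LinearIndependent ℂ (w y i) then ⟨w y, h⟩ else ⟨w z, h0⟩
  have hgy : ∀ y (h : ∀ i, LinearIndependent ℂ (w y i)), g y = ⟨w y, h⟩ := fun y h => dif_pos h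
  have hg : MorphAt g z := by
    refine morphAt_frames hZ fun i a φ => hZ.congr (hw i a φ) ?_
    filter_upwards [hf] with y hy
    obtain ⟨h, -⟩ := hy
    rw [hgy y h]
  refine ((morphAt_quotientMk q (g z)).comp hg).congr hZ ?_
  filter_upwards [hf] with y hy
  obtain ⟨h, h1⟩ := hy
  change q (g y) = f y
  rw [hgy y h, h1]

end Frames

section Grassmannian

variable {V : Type u} [AddCommGroup V] [Module ℂ V]

theorem morphAt_gr {k : ℕ} {Z : FSpace.{w}} (hZ : Z.IsLocal) {f : Z → gr k V} {z : Z}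
    (h : RegSub Z k (fun y => (f y).1) z) : MorphAt f z := by
  obtain ⟨w, hw, h1⟩ := h
  refine morphAt_of_frames (ι := Unit) hZ (fun y _ => w y) (fun _ a => hw a) ?_
  filter_upwards [h1] with y hy
  exact ⟨fun _ => hy.1, Subtype.ext hy.2⟩

theorem morphAt_grProd {ι : Type v} [Finite ι] {d : ι → ℕ} {Z : FSpace.{w}} (hZ : Z.IsLocal) {f : Z → grProd ι d V} {z : Z}
    (h : ∀ i, RegSub Z (d i) (fun y => (f y).1 i) z) : MorphAt f z := by
  choose w hw h1 using h
  refine morphAt_of_frames hZ (fun y i => w i y) (fun i a => hw i a) ?_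
  filter_upwards [eventually_all.2 h1] with y hy
  exact ⟨fun i => (hy i).1, Subtype.ext (funext fun i => (hy i).2)⟩

variable [FiniteDimensional ℂ V]

theorem isSpanMap_gr (k : ℕ) : IsSpanMap (d := fun _ : Unit => k) (V := V)
    (T := {L : Submodule ℂ V // finrank ℂ L = k})
    (fun w => ⟨Submodule.span ℂ (Set.range (w.1 ())),
      by simpa using finrank_span_eq_card (w.2 ())⟩) := by
  refine ⟨fun L => ?_, fun w w' => ?_⟩
  · obtain ⟨w, hw, h⟩ := exists_frame L.2
    exact ⟨⟨fun _ => w, fun _ => hw⟩, Subtype.ext h⟩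
  · rw [Subtype.ext_iff]
    exact ⟨fun h _ => h, fun h => h ()⟩

theorem gr_isLocal (k : ℕ) : (gr k V).IsLocal :=
  (isSpanMap_gr k).isLocal

theorem regSub_gr {k : ℕ} (L : gr k V) : RegSub (gr k V) k (fun N => N.1) L :=
  (isSpanMap_gr k).regSub () (fun _ => rfl) L

variable {ι : Type v} {d : ι → ℕ}

theorem isSpanMap_grProd : IsSpanMap (ι := ι) (d := d) (V := V)
    (T := {L : ι → Submodule ℂ V // ∀ i, finrank ℂ (L i) = d i})
    (fun w => ⟨fun i => Submodule.span ℂ (Set.range (w.1 i)),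
      fun i => by simpa using finrank_span_eq_card (w.2 i)⟩) := by
  refine ⟨fun L => ?_, fun w w' => ?_⟩
  · choose w hw h using fun i => exists_frame (L.2 i)
    exact ⟨⟨w, hw⟩, Subtype.ext (funext h)⟩
  · rw [Subtype.ext_iff]
    exact ⟨fun h i => congrFun h i, fun h => funext h⟩

variable [Finite ι]

theorem grProd_isLocal : (grProd ι d V).IsLocal :=
  isSpanMap_grProd.isLocal

theorem regSub_grProd (L : grProd ι d V) (i : ι) :
    RegSub (grProd ι d V) (d i) (fun N => N.1 i) L :=
  isSpanMap_grProd.regSub i (fun _ => rfl) L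

end Grassmannian

/-! ### Bundles of lines between two families of subspaces -/

section LinearAlgebra

variable {V : Type u} [AddCommGroup V] [Module ℂ V]
  {K : Type v} [AddCommGroup K] [Module ℂ K] {A B M C : Submodule ℂ V} {ℓ : V →ₗ[ℂ] K}

theorem finrank_map_of_disjoint_ker {ℓ : V →ₗ[ℂ] K} {N : Submodule ℂ V}
    (h : N ⊓ LinearMap.ker ℓ = ⊥) : finrank ℂ (N.map ℓ) = finrank ℂ N := by
  rw [← LinearMap.range_domRestrict]
  refine LinearMap.finrank_range_of_inj (LinearMap.ker_eq_bot.1 ?_)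
  rw [Submodule.eq_bot_iff]
  intro x hx
  have : (x : V) ∈ N ⊓ LinearMap.ker ℓ := ⟨x.2, hx⟩
  rw [h] at this
  exact Subtype.ext (by simpa using this)

theorem slice_inf_ker (hM : M ⊓ LinearMap.ker ℓ ≤ C) (hB : B ⊓ C = ⊥) :
    (M ⊓ B) ⊓ LinearMap.ker ℓ = ⊥ := by
  rw [eq_bot_iff, ← hB]
  exact le_inf (inf_le_left.trans inf_le_right) (le_trans (inf_le_inf_right _ inf_le_left) hM)

theorem comap_eq_ker_sup_map {s : K →ₗ[ℂ] V} (hs : ∀ x, ℓ (s x) = x) (t : Submodule ℂ K) :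
    t.comap ℓ = LinearMap.ker ℓ ⊔ t.map s := by
  refine le_antisymm (fun v hv => ?_) (sup_le (fun v hv => ?_) ?_)
  · refine Submodule.mem_sup.2 ⟨v - s (ℓ v), ?_, s (ℓ v), ⟨_, hv, rfl⟩, by simp⟩
    simp [hs]
  · simp [LinearMap.mem_ker.1 hv]
  · rw [Submodule.map_le_iff_le_comap]
    intro x hx
    simpa [hs] using hx

variable [FiniteDimensional ℂ V]

/-- Linear data that coordinatizes the lines in `B₀ / A₀` and in all nearby quotients. -/
theorem exists_slice [FiniteDimensional ℂ K] {A₀ B₀ : Submodule ℂ V} (h : A₀ ≤ B₀)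
    (hd : finrank ℂ B₀ = finrank ℂ K + finrank ℂ A₀) :
    ∃ (M C : Submodule ℂ V) (ℓ : V →ₗ[ℂ] K), Function.Surjective ℓ ∧ M ⊓ LinearMap.ker ℓ ≤ C ∧
      A₀ ⊓ M = ⊥ ∧ B₀ ⊓ C = ⊥ ∧ finrank ℂ M + finrank ℂ A₀ = finrank ℂ V := by
  obtain ⟨C, hC⟩ := Submodule.exists_isCompl B₀
  obtain ⟨N, hN⟩ := Submodule.exists_isCompl (A₀ ⊔ C)
  have hAC : A₀ ⊓ C = ⊥ := le_bot_iff.1 (le_trans (inf_le_inf_right _ h) hC.inf_eq_bot.le)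
  have d1 := Submodule.finrank_add_eq_of_isCompl hC
  have d2 := Submodule.finrank_add_eq_of_isCompl hN
  have d3 := Submodule.finrank_sup_add_finrank_inf_eq A₀ C
  rw [hAC, finrank_bot] at d3
  have d4 : finrank ℂ N = finrank ℂ K := by omega
  let e := LinearEquiv.ofFinrankEq N K d4
  have hNC : N ⊓ C = ⊥ :=
    le_bot_iff.1 (le_trans (inf_le_inf_left _ le_sup_right) (inf_comm (A₀ ⊔ C) N ▸ hN.inf_eq_bot.le))
  have d5 := Submodule.finrank_sup_add_finrank_inf_eq N C
  rw [hNC, finrank_bot] at d5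
  let ℓ : V →ₗ[ℂ] K := e.toLinearMap ∘ₗ Submodule.projectionOnto N (A₀ ⊔ C) hN.symm
  have hker : LinearMap.ker ℓ = A₀ ⊔ C := by
    simp [ℓ]
  have hM : (N ⊔ C) ⊓ LinearMap.ker ℓ ≤ C := by
    rw [hker, sup_comm N C, sup_inf_assoc_of_le N (le_sup_right : C ≤ A₀ ⊔ C), inf_comm,
      hN.inf_eq_bot, sup_bot_eq]
  refine ⟨N ⊔ C, C, ℓ, ?_, hM, ?_, hC.inf_eq_bot, by omega⟩
  · exact e.surjective.comp (LinearMap.range_eq_top.1 (Submodule.range_projectionOnto _))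
  · rw [eq_bot_iff, ← hAC]
    refine le_inf inf_le_left (le_trans (le_inf inf_le_right ?_) hM)
    rw [hker]
    exact inf_le_left.trans le_sup_left

theorem finrank_slice (hAB : A ≤ B) (hd : finrank ℂ B = finrank ℂ K + finrank ℂ A)
    (hA : A ⊓ M = ⊥) (hdM : finrank ℂ M + finrank ℂ A = finrank ℂ V) :
    finrank ℂ (M ⊓ B : Submodule ℂ V) = finrank ℂ K := by
  have h1 := Submodule.finrank_sup_add_finrank_inf_eq M B
  have h2 := Submodule.finrank_le (M ⊔ B)
  have h3 := Submodule.finrank_sup_add_finrank_inf_eq (M ⊓ B) A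
  have h4 : (M ⊓ B) ⊓ A = ⊥ := by
    rw [eq_bot_iff, ← hA]
    exact le_inf inf_le_right (inf_le_left.trans inf_le_left)
  have h5 := Submodule.finrank_mono (sup_le inf_le_right hAB : (M ⊓ B) ⊔ A ≤ B)
  rw [h4, finrank_bot] at h3
  omega

theorem finrank_slice_of_mem {W : Submodule ℂ V} (hAW : A ≤ W)
    (hW : finrank ℂ W = finrank ℂ A + 1) (hA : A ⊓ M = ⊥)
    (hdM : finrank ℂ M + finrank ℂ A = finrank ℂ V) : finrank ℂ (W ⊓ M : Submodule ℂ V) = 1 := by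
  have h1 := Submodule.finrank_sup_add_finrank_inf_eq W M
  have h2 := Submodule.finrank_le (W ⊔ M)
  have h3 := Submodule.finrank_sup_add_finrank_inf_eq (W ⊓ M) A
  have h4 : (W ⊓ M) ⊓ A = ⊥ := by
    rw [eq_bot_iff, ← hA]
    exact le_inf inf_le_right (inf_le_left.trans inf_le_right)
  have h5 := Submodule.finrank_mono (sup_le inf_le_left hAW : (W ⊓ M) ⊔ A ≤ W)
  rw [h4, finrank_bot] at h3
  omega

theorem finrank_map_slice_of_mem {W : Submodule ℂ V} (hAW : A ≤ W) (hWB : W ≤ B)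
    (hW : finrank ℂ W = finrank ℂ A + 1) (hA : A ⊓ M = ⊥)
    (hdM : finrank ℂ M + finrank ℂ A = finrank ℂ V)
    (hM : M ⊓ LinearMap.ker ℓ ≤ C) (hB : B ⊓ C = ⊥) :
    finrank ℂ ((W ⊓ M).map ℓ) = 1 := by
  rw [finrank_map_of_disjoint_ker, finrank_slice_of_mem hAW hW hA hdM]
  rw [eq_bot_iff, ← slice_inf_ker hM hB]
  exact inf_le_inf_right _ (le_inf inf_le_right (inf_le_left.trans hWB))

variable [FiniteDimensional ℂ K]

theorem map_slice_inf_comap (hAB : A ≤ B) (hd : finrank ℂ B = finrank ℂ K + finrank ℂ A)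
    (hA : A ⊓ M = ⊥) (hdM : finrank ℂ M + finrank ℂ A = finrank ℂ V)
    (hM : M ⊓ LinearMap.ker ℓ ≤ C) (hB : B ⊓ C = ⊥) (t : Submodule ℂ K) :
    ((M ⊓ B) ⊓ t.comap ℓ).map ℓ = t := by
  have h1 : (M ⊓ B).map ℓ = ⊤ := Submodule.eq_top_of_finrank_eq
    ((finrank_map_of_disjoint_ker (slice_inf_ker hM hB)).trans (finrank_slice hAB hd hA hdM))
  refine le_antisymm (Submodule.map_le_iff_le_comap.2 inf_le_right) fun x hx => ?_
  obtain ⟨v, hv, rfl⟩ : x ∈ (M ⊓ B).map ℓ := h1 ▸ Submodule.mem_top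
  exact ⟨v, ⟨hv, hx⟩, rfl⟩

theorem finrank_slice_inf_comap (hAB : A ≤ B) (hd : finrank ℂ B = finrank ℂ K + finrank ℂ A)
    (hA : A ⊓ M = ⊥) (hdM : finrank ℂ M + finrank ℂ A = finrank ℂ V)
    (hM : M ⊓ LinearMap.ker ℓ ≤ C) (hB : B ⊓ C = ⊥) (t : Submodule ℂ K) :
    finrank ℂ ((M ⊓ B) ⊓ t.comap ℓ : Submodule ℂ V) = finrank ℂ t := by
  have h := slice_inf_ker hM hB
  conv_rhs => rw [← map_slice_inf_comap hAB hd hA hdM hM hB t]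
  refine (finrank_map_of_disjoint_ker ?_).symm
  rw [eq_bot_iff, ← h]
  exact inf_le_inf_right _ inf_le_left

theorem finrank_sup_slice (hAB : A ≤ B) (hd : finrank ℂ B = finrank ℂ K + finrank ℂ A)
    (hA : A ⊓ M = ⊥) (hdM : finrank ℂ M + finrank ℂ A = finrank ℂ V)
    (hM : M ⊓ LinearMap.ker ℓ ≤ C) (hB : B ⊓ C = ⊥) {t : Submodule ℂ K} (ht : finrank ℂ t = 1) :
    finrank ℂ (A ⊔ ((M ⊓ B) ⊓ t.comap ℓ) : Submodule ℂ V) = finrank ℂ A + 1 := by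
  have h1 := finrank_slice_inf_comap hAB hd hA hdM hM hB t
  have h3 := Submodule.finrank_sup_add_finrank_inf_eq A ((M ⊓ B) ⊓ t.comap ℓ)
  have h4 : A ⊓ ((M ⊓ B) ⊓ t.comap ℓ) = ⊥ := by
    rw [eq_bot_iff, ← hA]
    exact inf_le_inf_left _ (inf_le_left.trans inf_le_left)
  rw [h4, finrank_bot] at h3
  omega

theorem sup_slice_map {W : Submodule ℂ V} (hAB : A ≤ B)
    (hd : finrank ℂ B = finrank ℂ K + finrank ℂ A) (hAW : A ≤ W) (hWB : W ≤ B)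
    (hW : finrank ℂ W = finrank ℂ A + 1) (hA : A ⊓ M = ⊥)
    (hdM : finrank ℂ M + finrank ℂ A = finrank ℂ V)
    (hM : M ⊓ LinearMap.ker ℓ ≤ C) (hB : B ⊓ C = ⊥) :
    A ⊔ ((M ⊓ B) ⊓ ((W ⊓ M).map ℓ).comap ℓ) = W := by
  have h1 := finrank_map_slice_of_mem hAW hWB hW hA hdM hM hB
  have h2 := finrank_slice_inf_comap hAB hd hA hdM hM hB ((W ⊓ M).map ℓ)
  have h3 : W ⊓ M = (M ⊓ B) ⊓ ((W ⊓ M).map ℓ).comap ℓ := by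
    refine Submodule.eq_of_le_of_finrank_eq (le_inf (le_inf inf_le_right (inf_le_left.trans hWB))
      (Submodule.le_comap_map _ _)) ?_
    rw [h2, h1, finrank_slice_of_mem hAW hW hA hdM]
  refine Submodule.eq_of_le_of_finrank_eq (sup_le hAW (h3 ▸ inf_le_left)) ?_
  rw [finrank_sup_slice hAB hd hA hdM hM hB h1, hW]

theorem map_sup_slice (hAB : A ≤ B) (hd : finrank ℂ B = finrank ℂ K + finrank ℂ A)
    (hA : A ⊓ M = ⊥) (hdM : finrank ℂ M + finrank ℂ A = finrank ℂ V)
    (hM : M ⊓ LinearMap.ker ℓ ≤ C) (hB : B ⊓ C = ⊥) {t : Submodule ℂ K} (ht : finrank ℂ t = 1) :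
    ((A ⊔ ((M ⊓ B) ⊓ t.comap ℓ)) ⊓ M).map ℓ = t := by
  have h1 := map_slice_inf_comap hAB hd hA hdM hM hB t
  have h2 := finrank_sup_slice hAB hd hA hdM hM hB ht
  refine (Submodule.eq_of_le_of_finrank_eq ?_ ?_).symm
  · conv_lhs => rw [← h1]
    exact Submodule.map_mono (le_inf le_sup_right (inf_le_left.trans inf_le_left))
  · rw [ht, finrank_map_slice_of_mem le_sup_left
      (sup_le hAB (inf_le_left.trans inf_le_right)) h2 hA hdM hM hB]

end LinearAlgebra

/-- The space of subspaces of dimension `a + 1` between a family `A` of subspaces of dimension `a`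
and a family `B` is a bundle of projective spaces. -/
theorem isFibreBundle_of_lines {V : Type w} [AddCommGroup V] [Module ℂ V] [FiniteDimensional ℂ V]
    {ω : LinearMap.BilinForm ℂ V} (hω : ω.Nondegenerate) (hω' : ω.IsRefl)
    {K : Type w'} [AddCommGroup K] [Module ℂ K] [FiniteDimensional ℂ K]
    {X : FSpace.{u}} {Y : FSpace.{v}} (hX : X.IsLocal) (hY : Y.IsLocal) {f : X → Y}
    (hf : IsMorphism f) {a : ℕ} {A B : Y → Submodule ℂ V} {W : X → Submodule ℂ V}
    (hA : ∀ y, RegSub Y a A y) (hB : ∀ y, RegSub Y (finrank ℂ K + a) B y) (hAB : ∀ y, A y ≤ B y)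
    (hW : ∀ x, RegSub X (a + 1) W x) (hAW : ∀ x, A (f x) ≤ W x) (hWB : ∀ x, W x ≤ B (f x))
    (lift : ∀ y (N : Submodule ℂ V), A y ≤ N → N ≤ B y → finrank ℂ N = a + 1 →
      ∃ x, f x = y ∧ W x = N)
    (uniq : ∀ x x', f x = f x' → W x = W x' → x = x')
    (morph : ∀ (Z : FSpace.{max v w'}), Z.IsLocal → ∀ (h : Z → X) (z : Z),
      MorphAt (X := Z) (Y := Y) (f ∘ h) z → RegSub Z (a + 1) (fun y => W (h y)) z → MorphAt h z) :
    IsFibreBundle f (gr 1 K) := by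
  refine ⟨hf, fun y₀ => ?_⟩
  have dA : ∀ y, finrank ℂ (A y) = a := fun y => (hA y).finrank_eq
  have dW : ∀ x, finrank ℂ (W x) = a + 1 := fun x => (hW x).finrank_eq
  have dB : ∀ y, finrank ℂ (B y) = finrank ℂ K + finrank ℂ (A y) := fun y => by
    rw [dA, (hB y).finrank_eq]
  obtain ⟨M, C, ℓ, hℓ, hM, hA0, hB0, hdM⟩ := exists_slice (hAB y₀) (dB y₀)
  obtain ⟨s, hs⟩ := LinearMap.exists_rightInverse_of_surjective ℓ (LinearMap.range_eq_top.2 hℓ)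
  have hs : ∀ x, ℓ (s x) = x := fun x => LinearMap.congr_fun hs x
  have hdM : ∀ y, finrank ℂ M + finrank ℂ (A y) = finrank ℂ V := fun y => by
    rw [dA, ← hdM, dA]
  let U : Set Y := {y | A y ⊓ M = ⊥ ∧ B y ⊓ C = ⊥}
  have hU : IsOpen U := by
    refine isOpen_iff_mem_nhds.2 fun y hy => ?_
    filter_upwards [(hA y).eventually_disjoint hY (RegSub.const hY y (N := M) rfl) hy.1,
      (hB y).eventually_disjoint hY (RegSub.const hY y (N := C) rfl) hy.2] with z h1 h2
    exact ⟨h1, h2⟩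
  let XU := X.restrict (f ⁻¹' U)
  let YU := Y.restrict U
  have hXU : XU.IsLocal := restrict_isLocal hX _
  have hYU : YU.IsLocal := restrict_isLocal hY _
  have hG : (gr 1 K).IsLocal := gr_isLocal 1
  have hP : (YU.prod (gr 1 K)).IsLocal := prod_isLocal hYU hG
  have dφ : ∀ x : f ⁻¹' U, finrank ℂ ((W x.1 ⊓ M).map ℓ) = 1 := fun x =>
    finrank_map_slice_of_mem (hAW x.1) (hWB x.1) (by rw [dW, dA]) x.2.1 (hdM _) hM x.2.2
  let φ : f ⁻¹' U → U × gr 1 K := fun x => (⟨f x.1, x.2⟩, ⟨(W x.1 ⊓ M).map ℓ, dφ x⟩)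
  let N : U × gr 1 K → Submodule ℂ V := fun p => A p.1.1 ⊔ ((M ⊓ B p.1.1) ⊓ p.2.1.comap ℓ)
  have dN : ∀ p, finrank ℂ (N p) = a + 1 := fun p => by
    rw [finrank_sup_slice (hAB _) (dB _) p.1.2.1 (hdM _) hM p.1.2.2 p.2.2, dA]
  choose ψ hψ hψ' using fun p : U × gr 1 K => lift p.1.1 (N p) le_sup_left
    (sup_le (hAB _) (inf_le_left.trans inf_le_right)) (dN p)
  let Ψ : U × gr 1 K → f ⁻¹' U := fun p => ⟨ψ p, by
    change f (ψ p) ∈ U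
    rw [hψ]
    exact p.1.2⟩
  refine ⟨U, hU, ⟨hA0, hB0⟩, φ, ⟨?_, Ψ, ?_, ?_, ?_⟩, fun x => rfl⟩
  · refine isMorphism_iff.2 fun x => ?_
    refine morphAt_prodMk (X := YU) (Y := gr 1 K) hXU ?_ ?_
    · refine morphAt_restrict hXU ?_
      exact ((isMorphism_iff.1 hf) x.1).comp (morphAt_val (S := f ⁻¹' U) x)
    · refine morphAt_gr hXU ?_
      have h1 : RegSub XU (a + 1) (fun x => W x.1) x :=
        (hW x.1).comp (morphAt_val (S := f ⁻¹' U) x)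
      have h2 : RegSub XU 1 (fun x => W x.1 ⊓ M) x :=
        h1.inf hXU hω hω' (RegSub.const hXU x (N := M) rfl) (Eventually.of_forall fun x =>
          finrank_slice_of_mem (hAW x.1) (by rw [dW, dA]) x.2.1 (hdM _))
      refine h2.map hXU ℓ (disjoint_iff.2 ?_)
      rw [eq_bot_iff, ← slice_inf_ker hM x.2.2]
      exact inf_le_inf_right _ (le_inf inf_le_right (inf_le_left.trans (hWB x.1)))
  · refine isMorphism_iff.2 fun p => ?_
    refine morphAt_restrict hP (morph _ hP _ p ?_ ?_)
    · refine MorphAt.congr hP (f := fun q : YU.prod (gr 1 K) => q.1.1) ?_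
        (Eventually.of_forall fun q => (hψ q).symm)
      exact (morphAt_val (S := U) p.1).comp (morphAt_fst hYU hG p)
    · refine RegSub.congr (L := fun q : YU.prod (gr 1 K) => N q) ?_
        (Eventually.of_forall fun q => (hψ' q).symm)
      have hb : MorphAt (X := YU.prod (gr 1 K)) (Y := Y) (fun q => q.1.1) p :=
        (morphAt_val (S := U) p.1).comp (morphAt_fst hYU hG p)
      have h1 : RegSub (YU.prod (gr 1 K)) a (fun q => A q.1.1) p := RegSub.comp (X := Y) (L := A) (f := fun q : YU.prod (gr 1 K) => q.1.1) (hA _) hb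
      have h2 : RegSub (YU.prod (gr 1 K)) (finrank ℂ K + a) (fun q => B q.1.1) p :=
        RegSub.comp (X := Y) (L := B) (f := fun q : YU.prod (gr 1 K) => q.1.1) (hB _) hb
      have h3 : RegSub (YU.prod (gr 1 K)) 1 (fun q => q.2.1) p :=
        (regSub_gr p.2).comp (morphAt_snd hYU hG p)
      have hsinj : LinearMap.ker s = ⊥ :=
        LinearMap.ker_eq_bot.2 (Function.LeftInverse.injective (g := ℓ) hs)
      have h4 := h3.map hP s (by rw [hsinj]; exact disjoint_bot_right)
      have h5 : RegSub (YU.prod (gr 1 K)) (finrank ℂ (LinearMap.ker ℓ) + 1)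
          (fun q => q.2.1.comap ℓ) p := by
        refine ((RegSub.const hP p (N := LinearMap.ker ℓ) rfl).sup hP h4 ?_).congr
          (Eventually.of_forall fun q => (comap_eq_ker_sup_map hs _).symm)
        refine Eventually.of_forall fun q => ?_
        have e1 := Submodule.finrank_sup_add_finrank_inf_eq (LinearMap.ker ℓ) (q.2.1.map s)
        have e2 : LinearMap.ker ℓ ⊓ q.2.1.map s = ⊥ := by
          rw [eq_bot_iff]
          rintro _ ⟨hv, x, hx, rfl⟩
          have : x = 0 := by rw [← hs x]; exact hv
          simp [this]
        have e3 : finrank ℂ (q.2.1.map s) = 1 := by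
          rw [finrank_map_of_disjoint_ker (by rw [hsinj, inf_bot_eq])]
          exact q.2.2
        rw [e2, e3, finrank_bot] at e1
        omega
      have h6 : RegSub (YU.prod (gr 1 K)) (finrank ℂ K) (fun q => M ⊓ B q.1.1) p :=
        (RegSub.const hP p (N := M) rfl).inf hP hω hω' h2 (Eventually.of_forall fun q =>
          finrank_slice (hAB _) (dB _) q.1.2.1 (hdM _))
      have h7 : RegSub (YU.prod (gr 1 K)) 1 (fun q => (M ⊓ B q.1.1) ⊓ q.2.1.comap ℓ) p :=
        h6.inf hP hω hω' h5 (Eventually.of_forall fun q =>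
          (finrank_slice_inf_comap (hAB _) (dB _) q.1.2.1 (hdM _) hM q.1.2.2 _).trans q.2.2)
      exact h1.sup hP h7 (Eventually.of_forall dN)
  · intro x
    refine Subtype.ext (uniq _ _ (hψ _) ?_)
    rw [hψ']
    exact sup_slice_map (hAB _) (dB _) (hAW x.1) (hWB x.1) (by rw [dW, dA]) x.2.1 (hdM _) hM x.2.2
  · intro p
    refine Prod.ext (Subtype.ext (hψ p)) (Subtype.ext ?_)
    change (W (ψ p) ⊓ M).map ℓ = p.2.1
    rw [show W (ψ p) = N p from hψ' p]
    exact map_sup_slice (hAB _) (dB _) p.1.2.1 (hdM _) hM p.1.2.2 p.2.2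

/-! ### Local isomorphisms -/

section LocIso

variable {X : FSpace.{u}} {Y : FSpace.{v}} {Z : FSpace.{w}}

/-- `c` and `s` restrict to inverse isomorphisms between the open sets `U` and `O`. -/
structure LocIso (c : X → Y) (s : Y → X) (U : Set X) (O : Set Y) : Prop where
  isOpen_source : IsOpen U
  isOpen_target : IsOpen O
  mapsTo : ∀ x ∈ U, c x ∈ O
  mapsTo' : ∀ y ∈ O, s y ∈ U
  left_inv : ∀ x ∈ U, s (c x) = x
  right_inv : ∀ y ∈ O, c (s y) = y
  morphAt : ∀ x ∈ U, MorphAt c x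
  morphAt' : ∀ y ∈ O, MorphAt s y

theorem eventually_of_restrict (hX : X.IsLocal) {S : Set X} (hS : IsOpen S) {x : X.restrict S}
    {p : X → Prop} (h : ∀ᶠ y : X.restrict S in 𝓝 x, p y.1) : ∀ᶠ y in 𝓝 x.1, p y := by
  have h1 := (morphAt_retract hX hS x x.2).1
  have h2 : ∀ᶠ y in 𝓝 x.1, p (retract S x y).1 := by
    refine h1.eventually (p := fun z : X.restrict S => p z.1) ?_
    rwa [retract_of_mem x x.2]
  filter_upwards [h2, hS.mem_nhds x.2] with y h3 h4
  rwa [retract_of_mem x h4] at h3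

theorem LocIso.comp {c : X → Y} {s : Y → X} {U : Set X} {O : Set Y} (h : LocIso c s U O)
    {c' : Y → Z} {s' : Z → Y} {U' : Set Y} {O' : Set Z} (h' : LocIso c' s' U' O') :
    LocIso (X := X) (Y := Z) (c' ∘ c) (s ∘ s') (U ∩ c ⁻¹' U') (O' ∩ s' ⁻¹' O) where
  isOpen_source := isOpen_iff_mem_nhds.2 fun x hx => by
    filter_upwards [h.isOpen_source.mem_nhds hx.1,
      (h.morphAt x hx.1).1.eventually (h'.isOpen_source.mem_nhds hx.2)] with y h1 h2 using ⟨h1, h2⟩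
  isOpen_target := isOpen_iff_mem_nhds.2 fun x hx => by
    filter_upwards [h'.isOpen_target.mem_nhds hx.1,
      (h'.morphAt' x hx.1).1.eventually (h.isOpen_target.mem_nhds hx.2)] with y h1 h2 using ⟨h1, h2⟩
  mapsTo x hx := ⟨h'.mapsTo _ hx.2, by
    change s' (c' (c x)) ∈ O
    rw [h'.left_inv _ hx.2]
    exact h.mapsTo _ hx.1⟩
  mapsTo' y hy := ⟨h.mapsTo' _ hy.2, by
    change c (s (s' y)) ∈ U'
    rw [h.right_inv _ hy.2]
    exact h'.mapsTo' _ hy.1⟩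
  left_inv x hx := by
    simp only [Function.comp]
    rw [h'.left_inv _ hx.2, h.left_inv _ hx.1]
  right_inv y hy := by
    simp only [Function.comp]
    rw [h.right_inv _ hy.2, h'.right_inv _ hy.1]
  morphAt x hx := (h'.morphAt _ hx.2).comp (h.morphAt x hx.1)
  morphAt' y hy := (h.morphAt' _ hy.2).comp (h'.morphAt' y hy.1)

theorem LocIso.prod (hX : X.IsLocal) (hY : Y.IsLocal) {X' : FSpace.{w}} {Y' : FSpace.{w'}}
    (hX' : X'.IsLocal) (hY' : Y'.IsLocal)
    {c : X → Y} {s : Y → X} {U : Set X} {O : Set Y} (h : LocIso c s U O)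
    {c' : X' → Y'} {s' : Y' → X'} {U' : Set X'} {O' : Set Y'} (h' : LocIso c' s' U' O') :
    LocIso (X := X.prod X') (Y := Y.prod Y') (fun p => (c p.1, c' p.2)) (fun p => (s p.1, s' p.2))
      {p | p.1 ∈ U ∧ p.2 ∈ U'} {p | p.1 ∈ O ∧ p.2 ∈ O'} where
  isOpen_source := isOpen_iff_mem_nhds.2 fun _ hx =>
    prod_rect_mem_nhds hX hX' h.isOpen_source h'.isOpen_source hx.1 hx.2
  isOpen_target := isOpen_iff_mem_nhds.2 fun _ hx =>
    prod_rect_mem_nhds hY hY' h.isOpen_target h'.isOpen_target hx.1 hx.2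
  mapsTo _ hx := ⟨h.mapsTo _ hx.1, h'.mapsTo _ hx.2⟩
  mapsTo' _ hx := ⟨h.mapsTo' _ hx.1, h'.mapsTo' _ hx.2⟩
  left_inv _ hx := Prod.ext (h.left_inv _ hx.1) (h'.left_inv _ hx.2)
  right_inv _ hx := Prod.ext (h.right_inv _ hx.1) (h'.right_inv _ hx.2)
  morphAt x hx := morphAt_prodMk (prod_isLocal hX hX')
    ((h.morphAt _ hx.1).comp (morphAt_fst hX hX' x))
    ((h'.morphAt _ hx.2).comp (morphAt_snd hX hX' x))
  morphAt' x hx := morphAt_prodMk (prod_isLocal hY hY')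
    ((h.morphAt' _ hx.1).comp (morphAt_fst hY hY' x))
    ((h'.morphAt' _ hx.2).comp (morphAt_snd hY hY' x))

theorem LocIso.isIsomorphism (hY : Y.IsLocal) {c : X → Y} {s : Y → X} {U : Set X}
    (h : LocIso c s U Set.univ) : IsIsomorphism (X := X.restrict U) (Y := Y) (fun x => c x.1) := by
  refine ⟨isMorphism_iff.2 fun x => (h.morphAt _ x.2).comp (morphAt_val x),
    fun y => ⟨s y, h.mapsTo' _ trivial⟩, isMorphism_iff.2 fun y => morphAt_restrict hY
      (h.morphAt' y trivial), fun x => Subtype.ext (h.left_inv _ x.2),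
    fun y => h.right_inv _ trivial⟩

/-- A fibre bundle has local trivializations. -/
theorem IsFibreBundle.exists_locIso {f : X → Y} {G : FSpace.{w}} (hX : X.IsLocal) (hY : Y.IsLocal)
    (hG : G.IsLocal) (h : IsFibreBundle f G) [Nonempty G] (y : Y) :
    ∃ (U : Set Y) (c : X → Y.prod G) (s : Y.prod G → X), IsOpen U ∧ y ∈ U ∧
      LocIso (X := X) (Y := Y.prod G) c s (f ⁻¹' U) {p | p.1 ∈ U} ∧
      ∀ x, f x ∈ U → (c x).1 = f x := by
  obtain ⟨hf, h⟩ := h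
  obtain ⟨U, hU, hy, φ, ⟨hφ, ψ, hψ, h1, h2⟩, h3⟩ := h y
  obtain ⟨g₀⟩ := ‹Nonempty G›
  have hfU : IsOpen (f ⁻¹' U) := hU.preimage hf.1
  have hP := prod_isLocal hY hG
  have hOU : ∀ p : Y.prod G, p.1 ∈ U → ∀ᶠ q : Y.prod G in 𝓝 p, q.1 ∈ U := fun p hp =>
    (prod_rect_mem_nhds hY hG hU isOpen_univ hp trivial).mono fun q hq => hq.1
  let x₀ : f ⁻¹' U := ψ (⟨y, hy⟩, g₀)
  let c : X → Y.prod G := fun x => ((φ (retract _ x₀ x)).1.1, (φ (retract _ x₀ x)).2)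
  let s : Y.prod G → X := fun p => (ψ (retract U ⟨y, hy⟩ p.1, p.2)).1
  have hc : ∀ x (hx : f x ∈ U), c x = ((φ ⟨x, hx⟩).1.1, (φ ⟨x, hx⟩).2) := fun x hx => by
    simp only [c]
    rw [retract_of_mem x₀ (show x ∈ f ⁻¹' U from hx)]
  have hs : ∀ p : Y.prod G, ∀ hp : p.1 ∈ U, s p = (ψ (⟨p.1, hp⟩, p.2)).1 := fun p hp => by
    simp only [s]
    rw [retract_of_mem (⟨y, hy⟩ : U) hp]
  have hc1 : ∀ x, f x ∈ U → (c x).1 = f x := fun x hx => by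
    rw [hc x hx, h3]
    rfl
  have hcs : ∀ p : Y.prod G, p.1 ∈ U → c (s p) = p := fun p hp => by
    have e : f (s p) ∈ U := by
      rw [hs p hp]
      exact (ψ (⟨p.1, hp⟩, p.2)).2
    rw [hc _ e]
    have e2 : (⟨s p, e⟩ : f ⁻¹' U) = ψ (⟨p.1, hp⟩, p.2) := Subtype.ext (hs p hp)
    rw [e2]
    exact congrArg (fun q : U × G => ((q.1.1, q.2) : Y × G)) (h2 (⟨p.1, hp⟩, p.2))
  refine ⟨U, c, s, hU, hy, ⟨hfU, isOpen_iff_mem_nhds.2 hOU, ?_, ?_, ?_, hcs, ?_, ?_⟩, hc1⟩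
  · intro x hx
    change (c x).1 ∈ U
    rwa [hc1 x hx]
  · intro p hp
    change f (s p) ∈ U
    rw [hs p hp]
    exact (ψ (⟨p.1, hp⟩, p.2)).2
  · intro x hx
    have e1 : (c x).1 ∈ U := by rwa [hc1 x hx]
    rw [hs _ e1]
    have e2 : ((⟨(c x).1, e1⟩, (c x).2) : U × G) = φ ⟨x, hx⟩ := by
      refine Prod.ext (Subtype.ext ?_) ?_
      · change (c x).1 = _
        rw [hc x hx]
      · change (c x).2 = _
        rw [hc x hx]
    exact congrArg Subtype.val ((congrArg ψ e2).trans (h1 ⟨x, hx⟩))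
  · intro x hx
    have m1 : MorphAt (X := X) (Y := (Y.restrict U).prod G) (fun x => φ (retract _ x₀ x)) x :=
      MorphAt.comp (Y := X.restrict (f ⁻¹' U)) (isMorphism_iff.1 hφ _) (morphAt_retract hX hfU x₀ hx)
    exact morphAt_prodMk hX (m1.fst (restrict_isLocal hY U) hG).val
      (m1.snd (restrict_isLocal hY U) hG)
  · intro p hp
    have m1 : MorphAt (X := Y.prod G) (Y := (Y.restrict U).prod G)
        (fun q => (retract U ⟨y, hy⟩ q.1, q.2)) p :=
      morphAt_prodMk hP (MorphAt.comp (morphAt_retract hY hU ⟨y, hy⟩ hp) (morphAt_fst hY hG p))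
        (morphAt_snd hY hG p)
    exact (morphAt_val _).comp (MorphAt.comp (Y := (Y.restrict U).prod G)
      (Z := X.restrict (f ⁻¹' U)) (isMorphism_iff.1 hψ _) m1)

/-- The fibre of a bundle may be replaced by an isomorphic one. -/
theorem IsFibreBundle.congr_fibre {f : X → Y} {G : FSpace.{w}} {G' : FSpace.{w'}} (hX : X.IsLocal)
    (hY : Y.IsLocal) (hG : G.IsLocal) (hG' : G'.IsLocal) (h : IsFibreBundle f G) {e : G → G'}
    (he : IsIsomorphism e) : IsFibreBundle f G' := by
  refine ⟨h.1, fun y => ?_⟩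
  obtain ⟨U, hU, hy, φ, ⟨hφ, ψ, hψ, h1, h2⟩, h3⟩ := h.2 y
  obtain ⟨he, e', he', h4, h5⟩ := he
  have hYU := restrict_isLocal hY U
  have hXU := restrict_isLocal hX (f ⁻¹' U)
  refine ⟨U, hU, hy, fun x => ((φ x).1, e (φ x).2), ⟨isMorphism_iff.2 fun x => ?_,
    fun p => ψ (p.1, e' p.2), isMorphism_iff.2 fun p => ?_, fun x => ?_, fun p => ?_⟩, h3⟩
  · have m := isMorphism_iff.1 hφ x
    exact morphAt_prodMk hXU ((morphAt_fst hYU hG _).comp m)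
      ((isMorphism_iff.1 he _).comp ((morphAt_snd hYU hG _).comp m))
  · refine MorphAt.comp (Y := (Y.restrict U).prod G) (isMorphism_iff.1 hψ _) ?_
    exact morphAt_prodMk (prod_isLocal hYU hG') (morphAt_fst hYU hG' p)
      ((isMorphism_iff.1 he' _).comp (morphAt_snd hYU hG' p))
  · change ψ ((φ x).1, e' (e (φ x).2)) = x
    rw [h4]
    exact h1 x
  · change ((φ (ψ (p.1, e' p.2))).1, e (φ (ψ (p.1, e' p.2))).2) = p
    exact Prod.ext (congrArg (fun q : U × G => q.1) (h2 (p.1, e' p.2)))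
      ((congrArg (fun q : U × G => e q.2) (h2 (p.1, e' p.2))).trans (h5 p.2))

end LocIso

/-! ### Properties that pass to the total space of a bundle -/

/-- `X` is locally isomorphic to open subsets of affine spaces. -/
def LocAffine (X : FSpace.{u}) : Prop :=
  ∀ x : X, ∃ (W : Type) (_ : AddCommGroup W) (_ : Module ℂ W) (_ : FiniteDimensional ℂ W)
    (c : X → affine W) (s : affine W → X) (U : Set X) (O : Set (affine W)), x ∈ U ∧ LocIso c s U O

/-- The projections `T × X → T` are closed. -/
def UnivClosed (X : FSpace.{u}) : Prop :=
  ∀ T : FSpace.{w}, T.IsLocal → ∀ C : Set (T.prod X), IsClosed[(T.prod X).top] C →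
    IsClosed {t : T | ∃ x : X, ((t, x) : T × X) ∈ C}

theorem locIso_affine_prod (W W' : Type) [AddCommGroup W] [Module ℂ W] [AddCommGroup W']
    [Module ℂ W'] : LocIso (X := (affine W).prod (affine W')) (Y := affine (W × W'))
      (fun p => p) (fun p => p) Set.univ Set.univ where
  isOpen_source := isOpen_univ
  isOpen_target := isOpen_univ
  mapsTo _ _ := trivial
  mapsTo' _ _ := trivial
  left_inv _ _ := rfl
  right_inv _ _ := rfl
  morphAt p _ := by
    have h1 := affine_isLocal W
    have h2 := affine_isLocal W'
    have h3 := prod_isLocal h1 h2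
    refine morphAt_affine (W := W × W') h3 fun φ => h3.congr (h3.add
      ((morphAt_fst h1 h2 p).2 _ (affine_reg (φ ∘ₗ LinearMap.inl ℂ W W') _))
      ((morphAt_snd h1 h2 p).2 _ (affine_reg (φ ∘ₗ LinearMap.inr ℂ W W') _)))
      (Eventually.of_forall fun q => ?_)
    exact (map_add φ _ _).symm.trans (congrArg φ (Prod.ext (add_zero _) (zero_add _)))
  morphAt' p _ := by
    have h3 := affine_isLocal (W × W')
    exact morphAt_prodMk h3
      (morphAt_affine h3 fun φ => affine_reg (φ ∘ₗ LinearMap.fst ℂ W W') _)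
      (morphAt_affine h3 fun φ => affine_reg (φ ∘ₗ LinearMap.snd ℂ W W') _)

theorem IsFibreBundle.locAffine {X : FSpace.{u}} {Y : FSpace.{v}} {G : FSpace.{w}} {f : X → Y}
    (h : IsFibreBundle f G) (hX : X.IsLocal) (hY : Y.IsLocal) (hG : G.IsLocal)
    (hY' : LocAffine Y) (hG' : LocAffine G) [Nonempty G] : LocAffine X := by
  intro x
  obtain ⟨U, c, s, hU, hy, hcs, h1⟩ := h.exists_locIso hX hY hG (f x)
  obtain ⟨W, _, _, _, c₁, s₁, U₁, O₁, hx₁, h₁⟩ := hY' (c x).1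
  obtain ⟨W', _, _, _, c₂, s₂, U₂, O₂, hx₂, h₂⟩ := hG' (c x).2
  refine ⟨W × W', inferInstance, inferInstance, inferInstance, _, _, _, _, ?_,
    (hcs.comp (h₁.prod hY (affine_isLocal W) hG (affine_isLocal W') h₂)).comp
      (locIso_affine_prod W W')⟩
  exact ⟨⟨hy, hx₁, hx₂⟩, trivial⟩

theorem IsFibreBundle.isIrred {X : FSpace.{u}} {Y : FSpace.{v}} {G : FSpace.{w}} {f : X → Y}
    (h : IsFibreBundle f G) (hX : X.IsLocal) (hY : Y.IsLocal) (hG : G.IsLocal)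
    (hY' : Y.IsIrred) (hG' : G.IsIrred) : X.IsIrred := by
  have : IrreducibleSpace Y := hY'
  have : IrreducibleSpace G := hG'
  have slice : ∀ (U : Set Y) (c : X → Y.prod G) (s : Y.prod G → X),
      LocIso (X := X) (Y := Y.prod G) c s (f ⁻¹' U) {p | p.1 ∈ U} → ∀ y ∈ U, ∀ g : G,
      ContinuousAt (fun g => s (y, g)) g ∧ ContinuousAt (fun y => s (y, g)) y := by
    intro U c s hcs y hy g
    have m := hcs.morphAt' (y, g) hy
    exact ⟨(MorphAt.comp (Y := Y.prod G) (f := fun g : G => ((y, g) : Y × G)) m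
      (morphAt_prodMk hG (morphAt_const hG g y) (morphAt_id g))).1,
      (MorphAt.comp (Y := Y.prod G) (f := fun y : Y => ((y, g) : Y × G)) m
      (morphAt_prodMk hY (morphAt_id y) (morphAt_const hY y g))).1⟩
  have hopen : ∀ U₁ : Set X, IsOpen U₁ → ∀ x ∈ U₁, ∀ᶠ y in 𝓝 (f x), ∃ x' ∈ U₁, f x' = y := by
    intro U₁ hU₁ x hx
    obtain ⟨U, c, s, hU, hy, hcs, h1⟩ := h.exists_locIso hX hY hG (f x)
    have e : s (f x, (c x).2) = x := by
      rw [← h1 x hy]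
      exact hcs.left_inv x hy
    have m := (slice U c s hcs (f x) hy (c x).2).2.eventually (hU₁.mem_nhds (Set.mem_of_eq_of_mem e hx))
    filter_upwards [m, hU.mem_nhds hy] with y h2 h3
    refine ⟨_, h2, ?_⟩
    have h4 := hcs.right_inv (y, (c x).2) h3
    have h5 := hcs.mapsTo' (y, (c x).2) h3
    rw [← h1 _ h5, h4]
  have hne : Nonempty X := by
    obtain ⟨y⟩ : Nonempty Y := inferInstance
    obtain ⟨U, c, s, -⟩ := h.exists_locIso hX hY hG y
    obtain ⟨g⟩ : Nonempty G := inferInstance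
    exact ⟨s (y, g)⟩
  refine @IrreducibleSpace.mk X X.top ⟨?_⟩ hne
  rintro U₁ U₂ hU₁ hU₂ ⟨x₁, -, hx₁⟩ ⟨x₂, -, hx₂⟩
  obtain ⟨V₁, hV₁, hV₁o, hy₁⟩ := mem_nhds_iff.1 (hopen U₁ hU₁ x₁ hx₁)
  obtain ⟨V₂, hV₂, hV₂o, hy₂⟩ := mem_nhds_iff.1 (hopen U₂ hU₂ x₂ hx₂)
  obtain ⟨y, h1, h2⟩ := nonempty_preirreducible_inter hV₁o hV₂o ⟨_, hy₁⟩ ⟨_, hy₂⟩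
  obtain ⟨z₁, hz₁, e₁⟩ := hV₁ h1
  obtain ⟨z₂, hz₂, e₂⟩ := hV₂ h2
  obtain ⟨U, c, s, hU, hy, hcs, h3⟩ := h.exists_locIso hX hY hG y
  have key : ∀ V : Set X, IsOpen V → IsOpen {g : G | s (y, g) ∈ V} := fun V hV =>
    isOpen_iff_mem_nhds.2 fun g hg =>
      (slice U c s hcs y hy g).1.eventually (hV.mem_nhds hg)
  have e : ∀ z, f z = y → s (y, (c z).2) = z := by
    rintro z rfl
    rw [← h3 z hy]
    exact hcs.left_inv z hy
  obtain ⟨g, h4, h5⟩ := nonempty_preirreducible_inter (key U₁ hU₁) (key U₂ hU₂)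
    ⟨(c z₁).2, Set.mem_ofPred.2 (Set.mem_of_eq_of_mem (e z₁ e₁) hz₁)⟩
    ⟨(c z₂).2, Set.mem_ofPred.2 (Set.mem_of_eq_of_mem (e z₂ e₂) hz₂)⟩
  exact ⟨s (y, g), trivial, h4, h5⟩

theorem IsFibreBundle.univClosed {X Y : FSpace.{u}} {G : FSpace.{w}} {f : X → Y}
    (h : IsFibreBundle f G) (hX : X.IsLocal) (hY : Y.IsLocal) (hG : G.IsLocal)
    (hY' : UnivClosed.{u, u} Y) (hG' : UnivClosed.{w, u} G) [Nonempty G] :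
    UnivClosed.{u, u} X := by
  intro T hT C hC
  have hTX := prod_isLocal hT hX
  have hTY := prod_isLocal hT hY
  have key : IsClosed[(T.prod Y).top] {p : T.prod Y | ∃ x, f x = p.2 ∧ ((p.1, x) : T × X) ∈ C} := by
    refine ⟨isOpen_iff_mem_nhds.2 fun p hp => ?_⟩
    obtain ⟨U, c, s, hU, hy, hcs, h1⟩ := h.exists_locIso hX hY hG p.2
    have hS : IsOpen {q : T.prod Y | q.2 ∈ U} := isOpen_iff_mem_nhds.2 fun q hq =>
      (prod_rect_mem_nhds hT hY isOpen_univ hU trivial hq).mono fun r hr => hr.2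
    let R := (T.prod Y).restrict {q | q.2 ∈ U}
    have hR : R.IsLocal := restrict_isLocal hTY _
    let j : R.prod G → T.prod X := fun q => (q.1.1.1, s (q.1.1.2, q.2))
    have hj : ∀ q, MorphAt j q := by
      intro q
      have m1 := (morphAt_fst hR hG q).val
      have m3 := morphAt_prodMk (prod_isLocal hR hG) (m1.snd hT hY) (morphAt_snd hR hG q)
      exact morphAt_prodMk (prod_isLocal hR hG) (m1.fst hT hY)
        (MorphAt.comp (Y := Y.prod G) (hcs.morphAt' (q.1.1.2, q.2) q.1.2) m3)
    have hjc : IsClosed[(R.prod G).top] (j ⁻¹' C) := hC.preimage (isMorphism_iff.2 hj).1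
    have hcl := hG' R hR _ hjc
    let p' : R := ⟨p, hy⟩
    have hp' : p' ∈ {t : R | ∃ x : G, ((t, x) : R × G) ∈ j ⁻¹' C}ᶜ := by
      rintro ⟨g, hg⟩
      refine hp ⟨s (p.2, g), ?_, hg⟩
      have h4 := hcs.right_inv (p.2, g) hy
      rw [← h1 _ (hcs.mapsTo' (p.2, g) hy), h4]
    have hev : ∀ᶠ q in 𝓝 p, q ∈ {q : T.prod Y | q.2 ∈ U} →
        ∀ g : G, ((q.1, s (q.2, g)) : T × X) ∉ C := by
      refine eventually_of_restrict (x := p') hTY hS ?_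
      filter_upwards [hcl.isOpen_compl.mem_nhds hp'] with q hq _ g hg
      exact hq ⟨g, hg⟩
    filter_upwards [hev, hS.mem_nhds hy] with q h2 h3
    rintro ⟨x, hx, hxC⟩
    refine h2 h3 (c x).2 ?_
    have h4 : f x ∈ U := hx ▸ h3
    have : s (q.2, (c x).2) = x := by
      rw [← hx, ← h1 x h4]
      exact hcs.left_inv x h4
    rwa [this]
  convert hY' T hT _ key using 1
  ext t
  exact ⟨fun ⟨x, hx⟩ => ⟨f x, x, rfl, hx⟩, fun ⟨_, x, _, hx⟩ => ⟨x, hx⟩⟩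

/-! ### Elimination theory -/

theorem ofAlgebra_exists_basic {S : Type u} (A : Subalgebra ℂ (S → ℂ)) {x : ofAlgebra S A}
    {O : Set (ofAlgebra S A)} (h : O ∈ 𝓝 x) :
    ∃ p ∈ A, p x ≠ 0 ∧ ∀ y : S, p y ≠ 0 → (show ofAlgebra S A from y) ∈ O := by
  obtain ⟨O', hO', ho, hx⟩ := mem_nhds_iff.1 h
  have key : ∀ O' : Set S, TopologicalSpace.GenerateOpen {U | ∃ p ∈ A, U = {x | p x ≠ 0}} O' →
      ∀ x : S, x ∈ O' → ∃ p ∈ A, p x ≠ 0 ∧ ∀ y : S, p y ≠ 0 → y ∈ O' := by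
    intro O' ho
    induction ho with
    | basic U hU =>
      obtain ⟨p, hp, rfl⟩ := hU
      exact fun x hx => ⟨p, hp, hx, fun y hy => hy⟩
    | univ => exact fun x _ => ⟨1, A.one_mem, one_ne_zero, fun _ _ => trivial⟩
    | inter U V _ _ hU hV =>
      rintro x ⟨h1, h2⟩
      obtain ⟨p, hp, hpx, hp'⟩ := hU x h1
      obtain ⟨q, hq, hqx, hq'⟩ := hV x h2
      exact ⟨p * q, mul_mem hp hq, mul_ne_zero hpx hqx, fun y hy =>
        ⟨hp' y (left_ne_zero_of_mul hy), hq' y (right_ne_zero_of_mul hy)⟩⟩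
    | sUnion 𝒰 _ ih =>
      rintro x ⟨U, hU, hx⟩
      obtain ⟨p, hp, hpx, hp'⟩ := ih U hU x hx
      exact ⟨p, hp, hpx, fun y hy => ⟨U, hU, hp' y hy⟩⟩
  obtain ⟨p, hp, hpx, hp'⟩ := key O' ho x hx
  exact ⟨p, hp, hpx, fun y hy => hO' (hp' y hy)⟩

theorem exists_eval_eq {W : Type u} [AddCommGroup W] [Module ℂ W] {n : ℕ}
    (b : Basis (Fin n) ℂ W) {p : W → ℂ}
    (hp : p ∈ Algebra.adjoin ℂ {f | ∃ φ : W →ₗ[ℂ] ℂ, f = fun w => φ w}) :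
    ∃ P : MvPolynomial (Fin n) ℂ, ∀ w, p w = MvPolynomial.eval (b.repr w) P := by
  induction hp using Algebra.adjoin_induction with
  | mem p hp =>
    obtain ⟨φ, rfl⟩ := hp
    refine ⟨∑ i, MvPolynomial.C (φ (b i)) * MvPolynomial.X i, fun w => ?_⟩
    conv_lhs => rw [← b.sum_repr w]
    simp [mul_comm, -Basis.sum_repr]
  | algebraMap c => exact ⟨MvPolynomial.C c, fun w => by simp⟩
  | add p q _ _ h1 h2 =>
    obtain ⟨P, hP⟩ := h1
    obtain ⟨Q, hQ⟩ := h2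
    exact ⟨P + Q, fun w => by simp [hP, hQ]⟩
  | mul p q _ _ h1 h2 =>
    obtain ⟨P, hP⟩ := h1
    obtain ⟨Q, hQ⟩ := h2
    exact ⟨P * Q, fun w => by simp [hP, hQ]⟩

theorem ofAlgebra_common_denominator {S : Type u} (A : Subalgebra ℂ (S → ℂ)) {x : ofAlgebra S A}
    {ι : Type v} [Fintype ι] {g : ι → ofAlgebra S A → ℂ} (hg : ∀ i, (ofAlgebra S A).reg x (g i)) :
    ∃ q ∈ A, q x ≠ 0 ∧ ∃ p : ι → S → ℂ, (∀ i, p i ∈ A) ∧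
      ∀ᶠ y : ofAlgebra S A in 𝓝 x, ∀ i, g i y * q y = p i y := by
  classical
  choose p hp q hq hx h using fun i => (ofAlgebra_reg_iff A).1 (hg i)
  have aux : ∀ (i : ι) (y : S) (γ : ℂ), γ = p i y / q i y → q i y ≠ 0 →
      γ * (∏ i, q i) y = (p i * ∏ j ∈ Finset.univ.erase i, q j) y := by
    intro i y γ h1 h3
    rw [h1, ← Finset.mul_prod_erase _ _ (Finset.mem_univ i)]
    simp only [Pi.mul_apply]
    field_simp
  refine ⟨∏ i, q i, prod_mem fun i _ => hq i, ?_,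
    fun i => p i * ∏ j ∈ Finset.univ.erase i, q j,
    fun i => mul_mem (hp i) (prod_mem fun j _ => hq j), ?_⟩
  · refine (Finset.prod_apply (show S from x) Finset.univ q).trans_ne ?_
    exact Finset.prod_ne_zero_iff.2 fun i _ => hx i
  · filter_upwards [eventually_all.2 h, eventually_all.2 fun i => ofAlgebra_ne A (hq i) (hx i)]
      with y h1 h2 i
    exact aux i y _ (h1 i) (h2 i)

theorem prod_exists_basic {X : FSpace.{u}} {Y : FSpace.{v}} (hX : X.IsLocal) (hY : Y.IsLocal)
    {p : X.prod Y} {O : Set (X.prod Y)} (h : O ∈ 𝓝 p) :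
    ∃ (U : Set X) (V : Set Y) (h : X × Y → ℂ), IsOpen U ∧ IsOpen V ∧ IsTensor X Y U V h ∧
      p.1 ∈ U ∧ p.2 ∈ V ∧ h p ≠ 0 ∧ ∀ x ∈ U, ∀ y ∈ V, h (x, y) ≠ 0 → ((x, y) : X × Y) ∈ O := by
  obtain ⟨O', hO', ho, hx⟩ := mem_nhds_iff.1 h
  have key : ∀ O' : Set (X × Y), TopologicalSpace.GenerateOpen
      {O | ∃ (U : Set X) (V : Set Y) (h : X × Y → ℂ), IsOpen[X.top] U ∧ IsOpen[Y.top] V ∧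
      IsTensor X Y U V h ∧ O = {p | p.1 ∈ U ∧ p.2 ∈ V ∧ h p ≠ 0}} O' →
      ∀ p ∈ O', ∃ (U : Set X) (V : Set Y) (h : X × Y → ℂ), IsOpen U ∧ IsOpen V ∧
        IsTensor X Y U V h ∧ p.1 ∈ U ∧ p.2 ∈ V ∧ h p ≠ 0 ∧
        ∀ x ∈ U, ∀ y ∈ V, h (x, y) ≠ 0 → (x, y) ∈ O' := by
    intro O' ho
    induction ho with
    | basic O hO =>
      obtain ⟨U, V, h, hU, hV, hh, rfl⟩ := hO
      exact fun p hp => ⟨U, V, h, hU, hV, hh, hp.1, hp.2.1, hp.2.2,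
        fun x hx y hy hxy => ⟨hx, hy, hxy⟩⟩
    | univ => exact fun p _ => ⟨Set.univ, Set.univ, fun _ => 1, isOpen_univ, isOpen_univ,
        isTensor_fst hY _ (f := fun _ => 1) fun x _ => hX.const x 1, trivial, trivial, one_ne_zero,
        fun _ _ _ _ _ => trivial⟩
    | inter O₁ O₂ _ _ h1 h2 =>
      rintro p ⟨hp1, hp2⟩
      obtain ⟨U, V, h, hU, hV, hh, a1, a2, a3, a4⟩ := h1 p hp1
      obtain ⟨U', V', h', hU', hV', hh', b1, b2, b3, b4⟩ := h2 p hp2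
      exact ⟨U ∩ U', V ∩ V', _, hU.inter hU', hV.inter hV',
        (hh.mono Set.inter_subset_left Set.inter_subset_left).mul hX hY
          (hh'.mono Set.inter_subset_right Set.inter_subset_right), ⟨a1, b1⟩, ⟨a2, b2⟩,
        mul_ne_zero a3 b3, fun x hx y hy hxy =>
          ⟨a4 x hx.1 y hy.1 (left_ne_zero_of_mul hxy), b4 x hx.2 y hy.2 (right_ne_zero_of_mul hxy)⟩⟩
    | sUnion 𝒰 _ ih =>
      rintro x ⟨U, hU, hx⟩
      obtain ⟨U', V, h, a1, a2, a3, a4, a5, a6, a7⟩ := ih U hU x hx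
      exact ⟨U', V, h, a1, a2, a3, a4, a5, a6, fun x hx y hy hxy => ⟨U, hU, a7 x hx y hy hxy⟩⟩
  obtain ⟨U, V, h, a1, a2, a3, a4, a5, a6, a7⟩ := key O' ho p hx
  exact ⟨U, V, h, a1, a2, a3, a4, a5, a6, fun x hx y hy hxy => hO' (a7 x hx y hy hxy)⟩

/-- The homogeneous components of a polynomial vanish on the cones on which it vanishes. -/
theorem eval_homogeneousComponent_eq_zero {n : ℕ} {f : MvPolynomial (Fin n) ℂ} {a : Fin n → ℂ}
    (h : ∀ c : ℂ, c ≠ 0 → MvPolynomial.eval (c • a) f = 0) (D : ℕ) :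
    MvPolynomial.eval a (MvPolynomial.homogeneousComponent D f) = 0 := by
  have hs : ∀ (d : ℕ) (c : ℂ), MvPolynomial.eval (c • a) (MvPolynomial.homogeneousComponent d f) =
      MvPolynomial.eval a (MvPolynomial.homogeneousComponent d f) * c ^ d := by
    intro d c
    rw [MvPolynomial.eval_eq', MvPolynomial.eval_eq', Finset.sum_mul]
    refine Finset.sum_congr rfl fun m hm => ?_
    have hd : ∑ i, m i = d := by
      have := MvPolynomial.homogeneousComponent_isHomogeneous d f (MvPolynomial.mem_support_iff.1 hm)
      rw [← this, Finsupp.weight_apply, Finsupp.sum_fintype] <;> simp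
    simp only [Pi.smul_apply, smul_eq_mul, mul_pow]
    rw [Finset.prod_mul_distrib, Finset.prod_pow_eq_pow_sum, hd]
    ring
  let q : Polynomial ℂ := ∑ d ∈ Finset.range (f.totalDegree + 1), Polynomial.C
    (MvPolynomial.eval a (MvPolynomial.homogeneousComponent d f)) * Polynomial.X ^ d
  have hq : ∀ c : ℂ, c ≠ 0 → q.eval c = 0 := by
    intro c hc
    rw [← h c hc]
    conv_rhs => rw [← MvPolynomial.sum_homogeneousComponent f]
    simp only [q, Polynomial.eval_finsetSum, Polynomial.eval_mul, Polynomial.eval_C,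
      Polynomial.eval_pow, Polynomial.eval_X, map_sum, hs]
  have hq0 : q = 0 := by
    refine Polynomial.eq_zero_of_infinite_isRoot q (Set.Infinite.mono (s := {0}ᶜ) ?_ ?_)
    · exact fun c hc => hq c hc
    · exact (Set.finite_singleton _).infinite_compl
  by_cases hD : D < f.totalDegree + 1
  · have := congrArg (fun p => Polynomial.coeff p D) hq0
    simpa [q, Polynomial.finsetSum_coeff, Polynomial.coeff_C_mul, Polynomial.coeff_X_pow, hD]
      using this
  · rw [MvPolynomial.homogeneousComponent_eq_zero _ _ (by omega), map_zero]

section Elimination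

variable {T : FSpace.{u}} {n : ℕ}

/-- The ideal of the specializations at `t` of the polynomials with coefficients regular at `t` that
vanish on a set of pairs. -/
def specialIdeal (hT : T.IsLocal) (D : T → Set (Fin n → ℂ)) (t : T) :
    Ideal (MvPolynomial (Fin n) ℂ) where
  carrier := {f | ∃ F : T → MvPolynomial (Fin n) ℂ, F t = f ∧
    (∀ m, T.reg t (fun s => (F s).coeff m)) ∧
    ∀ᶠ s in 𝓝 t, ∀ a ∈ D s, MvPolynomial.eval a (F s) = 0}
  zero_mem' := ⟨fun _ => 0, rfl, fun m => by simpa using hT.const t 0,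
    Eventually.of_forall fun s a _ => by simp⟩
  add_mem' := by
    rintro _ _ ⟨F, rfl, h1, h2⟩ ⟨G, rfl, h3, h4⟩
    refine ⟨fun s => F s + G s, rfl, fun m => ?_, ?_⟩
    · simpa using hT.add (h1 m) (h3 m)
    · filter_upwards [h2, h4] with s h5 h6 a ha
      rw [map_add, h5 a ha, h6 a ha, add_zero]
  smul_mem' := by
    rintro g _ ⟨F, rfl, h1, h2⟩
    refine ⟨fun s => g * F s, rfl, fun m => ?_, ?_⟩
    · simp only [MvPolynomial.coeff_mul]
      exact hT.sum _ fun i _ => hT.mul (hT.const _ _) (h1 _)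
    · filter_upwards [h2] with s h5 a ha
      rw [map_mul, h5 a ha, mul_zero]

/-- If a cone has no non-zero point over `t`, then this also holds near `t`. -/
theorem eventually_eq_empty_of_zeroLocus (hT : T.IsLocal) {D : T → Set (Fin n → ℂ)} {t : T}
    (hcone : ∀ s, ∀ a ∈ D s, ∀ c : ℂ, c ≠ 0 → c • a ∈ D s) (h0 : ∀ s, ∀ a ∈ D s, a ≠ 0)
    (h : MvPolynomial.zeroLocus ℂ (specialIdeal hT D t) ⊆ {0}) : ∀ᶠ s in 𝓝 t, D s = ∅ := by
  classical
  have hrad : ∀ i, MvPolynomial.X i ∈ (specialIdeal hT D t).radical := by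
    intro i
    rw [← MvPolynomial.vanishingIdeal_zeroLocus_eq_radical (K := ℂ),
      MvPolynomial.mem_vanishingIdeal_iff]
    intro x hx
    rw [Set.mem_singleton_iff.1 (h hx)]
    simp
  choose r hr using hrad
  let R := ∑ i, r i
  have hR : ∀ i, MvPolynomial.X i ^ R ∈ specialIdeal hT D t := fun i =>
    Ideal.pow_mem_of_pow_mem _ (hr i)
      (Finset.single_le_sum (f := r) (fun _ _ => Nat.zero_le _) (Finset.mem_univ i))
  let N := n * R + 1
  let S := Finset.finsuppAntidiag (Finset.univ : Finset (Fin n)) N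
  have hS : ∀ m ∈ S, MvPolynomial.monomial m (1 : ℂ) ∈ specialIdeal hT D t := by
    intro m hm
    have h1 : ∑ i, m i = N := (Finset.mem_finsuppAntidiag.1 hm).1
    have h2 : ∃ i, R ≤ m i := by
      by_contra! h2
      have := Finset.sum_le_sum fun i (_ : i ∈ Finset.univ) => (h2 i).le
      simp only [h1, Finset.sum_const, Finset.card_univ, Fintype.card_fin, smul_eq_mul, N] at this
      omega
    obtain ⟨i, hi⟩ := h2
    have h3 : MvPolynomial.monomial m (1 : ℂ) =
        MvPolynomial.monomial (m - Finsupp.single i R) 1 * MvPolynomial.X i ^ R := by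
      rw [MvPolynomial.X_pow_eq_monomial, MvPolynomial.monomial_mul, mul_one,
        tsub_add_cancel_of_le (Finsupp.single_le_iff.2 hi)]
    rw [h3]
    exact Ideal.mul_mem_left _ _ (hR i)
  choose F hF1 hF2 hF3 using fun m : S => hS m.1 m.2
  let M : T → Matrix S S ℂ := fun s => Matrix.of fun m m' => (F m s).coeff m'.1
  have hM : M t = 1 := by
    ext m m'
    simp only [M, Matrix.of_apply, hF1, MvPolynomial.coeff_monomial, Matrix.one_apply,
      Subtype.ext_iff]
  have hdet := hT.ne (hT.det (M := M) fun m m' => hF2 m m'.1) (by simp [hM])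
  filter_upwards [hdet, eventually_all.2 hF3] with s hs1 hs2
  rw [Set.eq_empty_iff_forall_notMem]
  intro a ha
  have hmul : (M s).mulVec (fun m' : S => ∏ i, a i ^ m'.1 i) = 0 := by
    funext m
    have h1 := eval_homogeneousComponent_eq_zero (f := F m s) (a := a)
      (fun c hc => hs2 m _ (hcone s a ha c hc)) N
    rw [MvPolynomial.eval_eq'] at h1
    simp only [Matrix.mulVec, dotProduct, M, Matrix.of_apply, Pi.zero_apply]
    rw [← h1, Finset.sum_coe_sort S (fun m' => (F m s).coeff m' * ∏ i, a i ^ m' i)]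
    have hmem : ∀ m' : Fin n →₀ ℕ, m' ∈ S ↔ m'.degree = N := by
      intro m'
      rw [Finset.mem_finsuppAntidiag, Finsupp.degree_eq_sum]
      simp
    symm
    refine Finset.sum_subset_zero_on_sdiff (fun m' hm' => ?_) (fun m' hm' => ?_) (fun m' hm' => ?_)
    · rw [hmem]
      by_contra hne
      exact MvPolynomial.mem_support_iff.1 hm' (by
        rw [MvPolynomial.coeff_homogeneousComponent, if_neg hne])
    · have h2 := (Finset.mem_sdiff.1 hm')
      have h3 := MvPolynomial.notMem_support_iff.1 h2.2
      rw [MvPolynomial.coeff_homogeneousComponent, if_pos ((hmem m').1 h2.1)] at h3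
      rw [h3, zero_mul]
    · have h4 : m'.degree = N := by
        by_contra hne
        exact MvPolynomial.mem_support_iff.1 hm' (by
          rw [MvPolynomial.coeff_homogeneousComponent, if_neg hne])
      rw [MvPolynomial.coeff_homogeneousComponent, if_pos h4]
  have hvec : (fun m' : S => ∏ i, a i ^ m'.1 i) = 0 := by
    have := congrArg (M s)⁻¹.mulVec hmul
    rwa [Matrix.mulVec_mulVec, Matrix.nonsing_inv_mul _ (isUnit_iff_ne_zero.2 hs1),
      Matrix.one_mulVec, Matrix.mulVec_zero] at this
  refine h0 s a ha (funext fun i => ?_)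
  have hmem : Finsupp.single i N ∈ S := by
    rw [Finset.mem_finsuppAntidiag]
    refine ⟨?_, Finset.subset_univ _⟩
    simp [Finsupp.single_apply]
  have h5 := congrFun hvec ⟨_, hmem⟩
  simp only [Pi.zero_apply, Finsupp.single_apply, pow_ite, pow_zero] at h5
  rw [Finset.prod_ite_eq] at h5
  simpa [N] using h5

end Elimination

/-! ### Projective spaces -/

section Line

variable {K : Type w} [AddCommGroup K] [Module ℂ K]

open Classical in
/-- The line spanned by `v`; a default value is used for `v = 0`. -/
noncomputable def line (L₀ : gr 1 K) (v : K) : gr 1 K :=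
  if h : v = 0 then L₀ else ⟨Submodule.span ℂ {v}, finrank_span_singleton h⟩

theorem line_val (L₀ : gr 1 K) {v : K} (h : v ≠ 0) : (line L₀ v).1 = Submodule.span ℂ {v} := by
  exact congrArg Subtype.val (dif_neg h)

theorem line_eq (L₀ : gr 1 K) {v : K} (h : v ≠ 0) {L : gr 1 K} (hv : v ∈ L.1) :
    line L₀ v = L := by
  refine Subtype.ext ?_
  rw [line_val L₀ h]
  have h2 : finrank ℂ L.1 = 1 := L.2
  have : FiniteDimensional ℂ L.1 := Module.finite_of_finrank_eq_succ h2
  refine Submodule.eq_of_le_of_finrank_eq ((Submodule.span_singleton_le_iff_mem v L.1).2 hv) ?_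
  rw [finrank_span_singleton h, h2]

theorem exists_ne_zero_mem (L : gr 1 K) : ∃ v ∈ L.1, v ≠ 0 := by
  have h : finrank ℂ L.1 = 1 := L.2
  have : Nontrivial L.1 := Module.nontrivial_of_finrank_pos (R := ℂ) (by omega)
  obtain ⟨v, hv⟩ := exists_ne (0 : L.1)
  exact ⟨v.1, v.2, fun h => hv (Subtype.ext h)⟩

theorem RegVec.morphAt_line [FiniteDimensional ℂ K] {Z : FSpace.{u}} (hZ : Z.IsLocal) (L₀ : gr 1 K) {g : Z → K} {z : Z}
    (hg : RegVec Z z g) (h : g z ≠ 0) : MorphAt (fun y => line L₀ (g y)) z := by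
  refine morphAt_gr hZ ⟨fun y _ => g y, fun _ => hg, ?_⟩
  have h1 : LinearIndependent ℂ (fun _ : Fin 1 => g z) := LinearIndependent.of_subsingleton 0 h
  filter_upwards [RegVec.eventually_linearIndependent hZ (w := fun y _ => g y)
    (fun _ : Fin 1 => hg) h1] with y hy
  refine ⟨hy, ?_⟩
  rw [line_val L₀ (hy.ne_zero 0), Set.range_const]

theorem reg_coeff_C {T : FSpace.{u}} (hT : T.IsLocal) {t : T} {f : T → ℂ} (hf : T.reg t f) {n : ℕ}
    (m : Fin n →₀ ℕ) : T.reg t (fun s => MvPolynomial.coeff m (MvPolynomial.C (f s))) := by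
  classical
  simp only [MvPolynomial.coeff_C]
  split_ifs
  · exact hf
  · exact hT.const t 0

theorem gr_one_univClosed (K : Type w) [AddCommGroup K] [Module ℂ K] [FiniteDimensional ℂ K] :
    UnivClosed.{w, u} (gr 1 K) := by
  intro T hT C hC
  refine ⟨isOpen_iff_mem_nhds.2 fun t ht => ?_⟩
  let n := finrank ℂ K
  let b : Basis (Fin n) ℂ K := finBasis ℂ K
  let v : (Fin n → ℂ) → K := b.equivFun.symm
  have hv0 : ∀ a, a ≠ 0 → v a ≠ 0 := fun a ha h =>
    ha (b.equivFun.symm.map_eq_zero_iff.1 h)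
  have hrepr : ∀ a, (b.repr (v a) : Fin n → ℂ) = a := fun a => by
    have := b.equivFun.apply_symm_apply a
    rwa [Basis.equivFun_apply] at this
  let D : T → Set (Fin n → ℂ) := fun s =>
    {a | a ≠ 0 ∧ ∃ L : gr 1 K, v a ∈ L.1 ∧ ((s, L) : T × gr 1 K) ∈ C}
  have hD : ∀ᶠ s in 𝓝 t, D s = ∅ := by
    refine eventually_eq_empty_of_zeroLocus hT ?_ (fun s a ha => ha.1) ?_
    · rintro s a ⟨h1, L, h2, h3⟩ c hc
      refine ⟨smul_ne_zero hc h1, L, ?_, h3⟩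
      simp only [v, map_smul]
      exact L.1.smul_mem c h2
    · intro a ha
      by_contra ha0
      have hva := hv0 a ha0
      let L₀ : gr 1 K := ⟨Submodule.span ℂ {v a}, finrank_span_singleton hva⟩
      have hA := affine_isLocal K
      have hP := prod_isLocal hT hA
      let p₀ : T.prod (affine K) := (t, v a)
      let φ : T.prod (affine K) → T.prod (gr 1 K) := fun p => (p.1, line L₀ p.2)
      have hφ : MorphAt φ p₀ := by
        refine morphAt_prodMk hP (morphAt_fst hT hA p₀) ?_
        refine RegVec.morphAt_line hP L₀ (g := fun p : T.prod (affine K) => (show K from p.2)) ?_ hva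
        exact fun ψ => (morphAt_snd hT hA p₀).2 _ (affine_reg ψ _)
      have hO : ∀ᶠ p in 𝓝 p₀, φ p ∉ C := by
        refine hφ.1.eventually (hC.isOpen_compl.mem_nhds ?_)
        exact fun h => ht ⟨_, h⟩
      obtain ⟨U, V, h, hU, hV, ⟨N, f, g, hf, hg, hfg⟩, htU, haV, hh, hUV⟩ :=
        prod_exists_basic hT hA hO
      obtain ⟨q, hq, hq0, p, hp, hpq⟩ := ofAlgebra_common_denominator _
        (fun i => hg i (show affine K from v a) haV)
      obtain ⟨r, hr, hr0, hr1⟩ := ofAlgebra_exists_basic _ (inter_mem hpq (hV.mem_nhds haV))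
      choose P hP' using fun i => exists_eval_eq b (hp i)
      obtain ⟨R, hR⟩ := exists_eval_eq b hr
      let F : T → MvPolynomial (Fin n) ℂ := fun s => R * ∑ i, MvPolynomial.C (f i s) * P i
      have hF : ∀ s ∈ U, ∀ a', MvPolynomial.eval a' (F s) = r (v a') * (h (s, v a') * q (v a')) := by
        intro s hs a'
        simp only [F, map_mul, map_sum, MvPolynomial.eval_C]
        have e1 := hR (v a')
        rw [hrepr] at e1
        rw [← e1]
        by_cases h0 : r (v a') = 0
        · rw [h0, zero_mul, zero_mul]
        have h1 := hr1 (v a') h0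
        congr 1
        rw [hfg s hs _ h1.2, Finset.sum_mul]
        refine Finset.sum_congr rfl fun i _ => ?_
        have e2 := hP' i (v a')
        rw [hrepr] at e2
        rw [← e2, mul_assoc]
        congr 1
        exact (h1.1 i).symm
      have hmem : F t ∈ specialIdeal hT D t := by
        refine ⟨F, rfl, fun m => ?_, ?_⟩
        · simp only [F, MvPolynomial.coeff_mul, MvPolynomial.coeff_sum]
          exact hT.sum _ fun i _ => hT.mul (hT.const _ _) (hT.sum _ fun j _ =>
            hT.sum _ fun k _ => hT.mul (reg_coeff_C hT (hf j t htU) _) (hT.const _ _))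
        · filter_upwards [hU.mem_nhds htU] with s hs a' ha'
          rw [hF s hs]
          by_cases h0 : r (v a') = 0
          · rw [h0, zero_mul]
          by_cases h1 : h (s, v a') = 0
          · rw [h1, zero_mul, mul_zero]
          exfalso
          have h2 := hUV s hs (v a') (hr1 (v a') h0).2 h1
          obtain ⟨h3, L, h4, h5⟩ := ha'
          refine h2 ?_
          have h6 : line L₀ (v a') = L := line_eq L₀ (hv0 _ h3) h4
          exact Set.mem_of_eq_of_mem (congrArg (fun L => ((s, L) : T × gr 1 K)) h6) h5
      have h1 := ha (F t) hmem
      have h2 : MvPolynomial.eval a (F t) = 0 := h1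
      rw [hF t htU] at h2
      exact mul_ne_zero hr0 (mul_ne_zero hh hq0) h2
  filter_upwards [hD] with s hs
  rintro ⟨L, hL⟩
  obtain ⟨w, hw, hw0⟩ := exists_ne_zero_mem L
  have : b.equivFun w ∈ D s := by
    refine ⟨by simpa using hw0, L, ?_, hL⟩
    simpa [v] using hw
  rw [hs] at this
  exact this

end Line

/-! ### Smoothness -/

section Smooth

variable {W : Type u} [AddCommGroup W] [Module ℂ W] {n : ℕ} (b : Basis (Fin n) ℂ W)

theorem affine_reg_eval (P : MvPolynomial (Fin n) ℂ) (x : affine W) :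
    (affine W).reg x (fun w => MvPolynomial.eval (b.repr (show W from w)) P) := by
  have hA := affine_isLocal W
  induction P using MvPolynomial.induction_on with
  | C c => simpa using hA.const x c
  | add P Q hP hQ => simpa using hA.add hP hQ
  | mul_X P i hP =>
    simp only [map_mul, MvPolynomial.eval_X]
    exact hA.mul hP (affine_reg (b.coord i) x)

variable (P : MvPolynomial (Fin n) ℂ)

/-- Evaluation at a point of the basic open set `P ≠ 0`. -/
noncomputable def awayEval {a : Fin n → ℂ} (h : MvPolynomial.eval a P ≠ 0) :
    Localization.Away P →ₐ[ℂ] ℂ :=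
  IsLocalization.liftAlgHom (M := Submonoid.powers P) (f := MvPolynomial.aeval a) (by
    rintro ⟨_, k, rfl⟩
    simpa using IsUnit.pow k (isUnit_iff_ne_zero.2 h))

theorem awayEval_algebraMap {a : Fin n → ℂ} (h : MvPolynomial.eval a P ≠ 0)
    (Q : MvPolynomial (Fin n) ℂ) :
    awayEval P h (algebraMap _ _ Q) = MvPolynomial.eval a Q := by
  rw [awayEval, IsLocalization.liftAlgHom_apply, IsLocalization.lift_eq]
  simp

theorem algHom_algebraMap (ψ : Localization.Away P →ₐ[ℂ] ℂ) (Q : MvPolynomial (Fin n) ℂ) :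
    ψ (algebraMap _ _ Q) =
      MvPolynomial.eval (fun i => ψ (algebraMap (MvPolynomial (Fin n) ℂ) _ (MvPolynomial.X i))) Q := by
  induction Q using MvPolynomial.induction_on with
  | C c =>
    rw [MvPolynomial.eval_C]
    exact ψ.commutes c
  | add P Q hP hQ => simp [hP, hQ]
  | mul_X P i hP => simp [hP]

open Classical in
theorem exists_locIso_spm {p : W → ℂ} (hp : ∀ w, p w = MvPolynomial.eval (b.repr w) P)
    (w₀ : W) (hw₀ : p w₀ ≠ 0) : ∃ (c : affine W → spm (Localization.Away P))
      (s : spm (Localization.Away P) → affine W), LocIso c s {w | p w ≠ 0} Set.univ := by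
  have hA := affine_isLocal W
  have hS := spm_isLocal (Localization.Away P)
  let c : W → (Localization.Away P →ₐ[ℂ] ℂ) := fun w =>
    if h : MvPolynomial.eval (b.repr w) P ≠ 0 then awayEval P h
    else awayEval P (hp w₀ ▸ hw₀)
  have hc : ∀ w (h : MvPolynomial.eval (b.repr w) P ≠ 0), c w = awayEval P h := fun w h => dif_pos h
  let s : (Localization.Away P →ₐ[ℂ] ℂ) → W := fun ψ =>
    b.equivFun.symm fun i => ψ (algebraMap (MvPolynomial (Fin n) ℂ) _ (MvPolynomial.X i))
  have hs : ∀ ψ, (b.repr (s ψ) : Fin n → ℂ) = fun i => ψ (algebraMap (MvPolynomial (Fin n) ℂ) _ (MvPolynomial.X i)) := by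
    intro ψ
    have := b.equivFun.apply_symm_apply fun i => ψ (algebraMap (MvPolynomial (Fin n) ℂ) _ (MvPolynomial.X i))
    rwa [Basis.equivFun_apply] at this
  have hsP : ∀ ψ, MvPolynomial.eval (b.repr (s ψ)) P ≠ 0 := by
    intro ψ
    rw [hs, ← algHom_algebraMap]
    exact ((IsLocalization.Away.algebraMap_isUnit P).map ψ).ne_zero
  have hpo : ∀ x : affine W, p x ≠ 0 → ∀ᶠ y : affine W in 𝓝 x, p y ≠ 0 := fun x hx =>
    hA.ne (hA.congr (affine_reg_eval b P x) (Eventually.of_forall fun y => (hp y).symm)) hx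
  refine ⟨c, s, isOpen_iff_mem_nhds.2 hpo, isOpen_univ, fun _ _ => trivial, fun ψ _ => ?_,
    fun w hw => ?_, fun ψ _ => ?_, fun w hw => ?_, fun ψ _ => ?_⟩
  · change p (s ψ) ≠ 0
    rw [hp]
    exact hsP ψ
  · have hw' : p w ≠ 0 := hw
    have h := hp w ▸ hw'
    change s (c w) = w
    rw [hc w h]
    refine b.equivFun.injective ?_
    rw [Basis.equivFun_apply, hs]
    funext i
    rw [awayEval_algebraMap, MvPolynomial.eval_X]
    rfl
  · change c (s ψ) = ψ
    rw [hc _ (hsP ψ)]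
    refine IsLocalization.algHom_ext (Submonoid.powers P) ?_
    refine MvPolynomial.algHom_ext fun i => ?_
    refine (awayEval_algebraMap P (hsP ψ) _).trans ?_
    rw [MvPolynomial.eval_X]
    exact congrFun (hs ψ) i
  · have hw' : p w ≠ 0 := hw
    have hPw : MvPolynomial.eval (b.repr (show W from w)) P ≠ 0 := hp w ▸ hw'
    refine morphAt_spm hA fun a => ?_
    obtain ⟨k, Q, hQ⟩ := IsLocalization.Away.surj P a
    refine hA.congr (hA.mul (affine_reg_eval b Q w) (hA.inv (affine_reg_eval b (P ^ k) w) ?_)) ?_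
    · rw [map_pow]
      exact pow_ne_zero _ hPw
    · filter_upwards [hpo w hw'] with y hy
      have h := hp y ▸ hy
      change _ = c y a
      rw [hc y h, ← div_eq_mul_inv, div_eq_iff (by rw [map_pow]; exact pow_ne_zero _ h),
        ← awayEval_algebraMap P h Q, ← awayEval_algebraMap P h (P ^ k), ← map_mul, map_pow, hQ]
  · refine morphAt_affine hS fun φ => ?_
    have h1 := hS.sum (x := ψ) Finset.univ (f := fun i ψ => φ (b i) *
      (show Localization.Away P →ₐ[ℂ] ℂ from ψ)
        (algebraMap (MvPolynomial (Fin n) ℂ) _ (MvPolynomial.X i)))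
      fun i _ => hS.mul (hS.const _ _) (spm_reg _ _)
    refine hS.congr h1 (Eventually.of_forall fun ψ' => ?_)
    simp [s, mul_comm, Basis.equivFun_symm_apply]

theorem algebra_smooth_away : Algebra.Smooth ℂ (Localization.Away P) := by
  have h1 : Algebra.Smooth (MvPolynomial (Fin n) ℂ) (Localization.Away P) :=
    Algebra.Smooth.of_isLocalization_Away P
  have h2 : Algebra.Smooth ℂ (MvPolynomial (Fin n) ℂ) := {}
  exact Algebra.Smooth.comp ℂ (MvPolynomial (Fin n) ℂ) (Localization.Away P)

theorem LocAffine.isSmooth {X : FSpace.{u}} (hX : LocAffine X) : X.IsSmooth := by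
  intro x
  obtain ⟨W, _, _, _, c, s, U, O, hx, h⟩ := hX x
  obtain ⟨p, hp, hp0, hpO⟩ := ofAlgebra_exists_basic _ (h.isOpen_target.mem_nhds (h.mapsTo x hx))
  let b : Basis (Fin (finrank ℂ W)) ℂ W := finBasis ℂ W
  obtain ⟨P, hP⟩ := exists_eval_eq b hp
  obtain ⟨c', s', h'⟩ := exists_locIso_spm b P hP (c x) hp0
  have h2 := h.comp h'
  have h3 : Set.univ ∩ s' ⁻¹' O = Set.univ := by
    rw [Set.univ_inter, Set.eq_univ_iff_forall]
    exact fun ψ => hpO _ (h'.mapsTo' ψ trivial)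
  rw [h3] at h2
  exact ⟨_, h2.isOpen_source, ⟨hx, hp0⟩, Localization.Away P, inferInstance, inferInstance,
    algebra_smooth_away P, _, h2.isIsomorphism (spm_isLocal _)⟩

end Smooth

/-! ### Irreducibility -/

theorem affine_isIrred (W : Type u) [AddCommGroup W] [Module ℂ W] [FiniteDimensional ℂ W] :
    (affine W).IsIrred := by
  refine @IrreducibleSpace.mk (affine W) (affine W).top ⟨?_⟩ ⟨(0 : W)⟩
  rintro U₁ U₂ h1 h2 ⟨x₁, -, hx₁⟩ ⟨x₂, -, hx₂⟩
  obtain ⟨p, hp, hp0, hpU⟩ := ofAlgebra_exists_basic _ (h1.mem_nhds hx₁)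
  obtain ⟨q, hq, hq0, hqU⟩ := ofAlgebra_exists_basic _ (h2.mem_nhds hx₂)
  let b : Basis (Fin (finrank ℂ W)) ℂ W := finBasis ℂ W
  obtain ⟨P, hP⟩ := exists_eval_eq b hp
  obtain ⟨Q, hQ⟩ := exists_eval_eq b hq
  have hPQ : P * Q ≠ 0 := by
    refine mul_ne_zero ?_ ?_
    · rintro rfl
      exact hp0 (by simpa using hP x₁)
    · rintro rfl
      exact hq0 (by simpa using hQ x₂)
  obtain ⟨a, ha⟩ : ∃ a, MvPolynomial.eval a (P * Q) ≠ 0 := by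
    by_contra! h
    exact hPQ (MvPolynomial.funext fun a => by simpa using h a)
  have hrepr : (b.repr (b.equivFun.symm a) : Fin _ → ℂ) = a := by
    have := b.equivFun.apply_symm_apply a
    rwa [Basis.equivFun_apply] at this
  rw [map_mul] at ha
  refine ⟨b.equivFun.symm a, trivial, hpU _ ?_, hqU _ ?_⟩
  · rw [hP, hrepr]
    exact left_ne_zero_of_mul ha
  · rw [hQ, hrepr]
    exact right_ne_zero_of_mul ha

/-- A space in which two points can be joined by an affine line is irreducible. -/
theorem isIrred_of_paths {X : FSpace.{u}} [hne : Nonempty X]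
    (h : ∀ x y : X, ∃ γ : affine ℂ → X, IsMorphism γ ∧ x ∈ Set.range γ ∧ y ∈ Set.range γ) :
    X.IsIrred := by
  refine @IrreducibleSpace.mk X X.top ⟨?_⟩ hne
  rintro U₁ U₂ h1 h2 ⟨x₁, -, hx₁⟩ ⟨x₂, -, hx₂⟩
  obtain ⟨γ, hγ, ⟨t₁, rfl⟩, ⟨t₂, rfl⟩⟩ := h x₁ x₂
  have : IrreducibleSpace (affine ℂ) := affine_isIrred ℂ
  obtain ⟨t, h3, h4⟩ := nonempty_preirreducible_inter (h1.preimage hγ.1) (h2.preimage hγ.1)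
    ⟨t₁, hx₁⟩ ⟨t₂, hx₂⟩
  exact ⟨γ t, trivial, h3, h4⟩

section Line

variable (K : Type w) [AddCommGroup K] [Module ℂ K] [FiniteDimensional ℂ K]

theorem gr_one_nonempty (K : Type w) [AddCommGroup K] [Module ℂ K] (h : 0 < finrank ℂ K) : Nonempty (gr 1 K) := by
  have : Nontrivial K := Module.nontrivial_of_finrank_pos h
  obtain ⟨v, hv⟩ := exists_ne (0 : K)
  exact ⟨⟨Submodule.span ℂ {v}, finrank_span_singleton hv⟩⟩

theorem gr_one_isIrred (h : 0 < finrank ℂ K) : (gr 1 K).IsIrred := by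
  have := gr_one_nonempty K h
  refine isIrred_of_paths fun L₁ L₂ => ?_
  obtain ⟨v₁, hv₁, h₁⟩ := exists_ne_zero_mem L₁
  obtain ⟨v₂, hv₂, h₂⟩ := exists_ne_zero_mem L₂
  have hA := affine_isLocal ℂ
  by_cases hL : v₂ ∈ L₁.1
  · have e : L₁ = L₂ := (line_eq L₁ h₂ hL).symm.trans (line_eq L₁ h₂ hv₂)
    exact ⟨fun _ => L₁, isMorphism_iff.2 fun t => morphAt_const hA t L₁, ⟨(0 : ℂ), rfl⟩, (0 : ℂ), e⟩
  have h0 : ∀ t : ℂ, v₁ + t • (v₂ - v₁) ≠ 0 := by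
    intro t ht
    by_cases h3 : t = 0
    · rw [h3, zero_smul, add_zero] at ht
      exact h₁ ht
    · refine hL ?_
      have : v₂ = (1 - t⁻¹) • v₁ := by
        have h4 : t • v₂ = (t - 1) • v₁ := by
          linear_combination (norm := module) ht
        rw [← inv_smul_smul₀ h3 v₂, h4, smul_smul]
        congr 1
        field_simp
      rw [this]
      exact L₁.1.smul_mem _ hv₁
  refine ⟨fun t : ℂ => line L₁ (v₁ + t • (v₂ - v₁)), isMorphism_iff.2 fun t => ?_, ⟨(0 : ℂ), ?_⟩,
    (1 : ℂ), ?_⟩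
  · refine RegVec.morphAt_line hA L₁ (g := fun t : ℂ => v₁ + t • (v₂ - v₁)) ?_ (h0 t)
    exact RegVec.add hA (RegVec.const hA _ _)
      (RegVec.smul hA (affine_reg (LinearMap.id : ℂ →ₗ[ℂ] ℂ) t) (RegVec.const hA _ _))
  · refine line_eq L₁ (h0 0) ?_
    simpa using hv₁
  · refine line_eq L₁ (h0 1) ?_
    simpa using hv₂

theorem gr_one_locAffine (K : Type) [AddCommGroup K] [Module ℂ K] [FiniteDimensional ℂ K] :
    LocAffine (gr 1 K) := by
  intro L₀
  obtain ⟨u, hu, hu0⟩ := exists_ne_zero_mem L₀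
  obtain ⟨p', hp'⟩ : ∃ p : K →ₗ[ℂ] ℂ, p u ≠ 0 := by
    by_contra! h
    exact hu0 ((Module.forall_dual_apply_eq_zero_iff ℂ u).1 h)
  let p : K →ₗ[ℂ] ℂ := (p' u)⁻¹ • p'
  have hpu : p u = 1 := by simp [p, hp']
  have hG := gr_isLocal (V := K) 1
  have hA := affine_isLocal (LinearMap.ker p)
  let ρ : K →ₗ[ℂ] LinearMap.ker p := LinearMap.codRestrict _
    (LinearMap.id - p.smulRight u) (fun w => by simp [hpu])
  have hρ : ∀ w, (ρ w : K) = w - p w • u := fun w => rfl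
  choose f hf hf0 using exists_ne_zero_mem (K := K)
  let c : gr 1 K → affine (LinearMap.ker p) := fun N => ρ ((p (f N))⁻¹ • f N)
  let s : affine (LinearMap.ker p) → gr 1 K := fun w => line L₀ (u + (show LinearMap.ker p from w).1)
  have hs0 : ∀ w : LinearMap.ker p, p (u + w.1) = 1 := fun w => by simp [hpu]
  have hs1 : ∀ w : LinearMap.ker p, u + w.1 ≠ 0 := fun w h => by
    have := hs0 w
    rw [h, map_zero] at this
    exact zero_ne_one this
  have hc : ∀ (N : gr 1 K), ∀ v ∈ N.1, p v ≠ 0 → p (f N) ≠ 0 ∧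
      (p (f N))⁻¹ • f N = (p v)⁻¹ • v := by
    intro N v hv hpv
    have h1 : f N ∈ Submodule.span ℂ {v} := by
      rw [← line_val L₀ (v := v) (by rintro rfl; simp at hpv),
        line_eq L₀ (by rintro rfl; simp at hpv) hv]
      exact hf N
    obtain ⟨t, ht⟩ := Submodule.mem_span_singleton.1 h1
    have ht0 : t ≠ 0 := by
      rintro rfl
      exact hf0 N (by simpa using ht.symm)
    rw [← ht, map_smul, smul_eq_mul]
    refine ⟨mul_ne_zero ht0 hpv, ?_⟩
    rw [smul_smul]
    congr 1
    field_simp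
  have key : ∀ N : gr 1 K, p (f N) ≠ 0 → ∃ g : gr 1 K → K, RegVec (gr 1 K) N g ∧
      ∀ᶠ N' in 𝓝 N, g N' ∈ N'.1 ∧ p (g N') ≠ 0 := by
    intro N hN
    obtain ⟨g, hg, hg'⟩ := regSub_gr N
    refine ⟨fun N' => g N' 0, hg 0, ?_⟩
    have h1 : ∀ᶠ N' in 𝓝 N, g N' 0 ∈ N'.1 := hg'.mono fun N' h =>
      h.2.le (Submodule.subset_span ⟨0, rfl⟩)
    have h2 : p (g N 0) ≠ 0 := by
      have h3 := hg'.self_of_nhds.2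
      have h4 := h3.ge (hf N)
      rw [Set.range_unique, Submodule.mem_span_singleton] at h4
      obtain ⟨t, ht⟩ := h4
      intro h5
      refine hN ?_
      rw [← ht, map_smul]
      exact (congrArg (t • ·) h5).trans (smul_zero t)
    filter_upwards [h1, hG.ne (hg 0 p) h2] with N' h3 h4 using ⟨h3, h4⟩
  refine ⟨LinearMap.ker p, inferInstance, inferInstance, inferInstance, c, s, {N | p (f N) ≠ 0},
    Set.univ, ?_, ?_, isOpen_univ, fun _ _ => trivial, fun w _ => ?_, fun N hN => ?_, fun w _ => ?_,
    fun N hN => ?_, fun w _ => ?_⟩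
  · exact (hc L₀ u hu (by rw [hpu]; exact one_ne_zero)).1
  · refine isOpen_iff_mem_nhds.2 fun N hN => ?_
    obtain ⟨g, -, hg⟩ := key N hN
    filter_upwards [hg] with N' h using (hc N' _ h.1 h.2).1
  · have hm : u + (show LinearMap.ker p from w).1 ∈ (s w).1 := by
      simp only [s]
      rw [line_val L₀ (hs1 w)]
      exact Submodule.mem_span_singleton_self _
    exact (hc (s w) _ hm (by rw [hs0]; exact one_ne_zero)).1
  · have hN' : p (f N) ≠ 0 := hN
    refine line_eq L₀ (hs1 _) ?_
    have : u + (show LinearMap.ker p from c N).1 = (p (f N))⁻¹ • f N := by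
      refine (congrArg (u + ·) (hρ _)).trans ?_
      simp [hN']
    rw [this]
    exact N.1.smul_mem _ (hf N)
  · have hm : u + (show LinearMap.ker p from w).1 ∈ (s w).1 := by
      simp only [s]
      rw [line_val L₀ (hs1 w)]
      exact Submodule.mem_span_singleton_self _
    have h1 := (hc (s w) _ hm (by rw [hs0]; exact one_ne_zero)).2
    refine Subtype.ext ?_
    refine (hρ _).trans ?_
    rw [h1, hs0]
    rw [inv_one, one_smul, hs0, one_smul, add_sub_cancel_left]
  · obtain ⟨g, hg, hg'⟩ := key N hN
    refine morphAt_affine hG fun φ => ?_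
    have h1 := hG.mul (hG.inv (hg p) hg'.self_of_nhds.2) (hg (φ ∘ₗ ρ))
    refine hG.congr h1 ?_
    filter_upwards [hg'] with N' h
    simp only [c]
    rw [(hc N' _ h.1 h.2).2, map_smul, map_smul]
    rfl
  · refine RegVec.morphAt_line hA L₀
      (g := fun w => u + (show LinearMap.ker p from w).1) ?_ (hs1 w)
    exact RegVec.add hA (RegVec.const hA _ _) fun φ =>
      affine_reg (φ ∘ₗ (LinearMap.ker p).subtype) w

end Line

/-! ### Symplectic lines -/

theorem isIsomorphism_gr_sg_one {V : Type u} [AddCommGroup V] [Module ℂ V] [FiniteDimensional ℂ V]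
    {ω : LinearMap.BilinForm ℂ V} (hω : ω.IsAlt) :
    ∃ e : gr 1 V → sg 1 ω, IsIsomorphism e := by
  have h : ∀ L : gr 1 V, IsIsotropic ω L.1 := by
    intro L v hv w hw
    obtain ⟨u, hu, hu0⟩ := exists_ne_zero_mem L
    have e : Submodule.span ℂ {u} = L.1 :=
      (line_val L hu0).symm.trans (congrArg Subtype.val (line_eq L hu0 hu))
    rw [← e, Submodule.mem_span_singleton] at hv hw
    obtain ⟨a, rfl⟩ := hv
    obtain ⟨c, rfl⟩ := hw
    simp [hω u]
  refine ⟨fun L => ⟨L, h L⟩, isMorphism_iff.2 fun L =>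
    morphAt_restrict (gr_isLocal 1) (morphAt_id L), fun L => L.1,
    isMorphism_iff.2 fun L => morphAt_val L, fun L => rfl, fun L => rfl⟩

theorem stdSymp_isAlt (M : ℕ) : (stdSymp M).IsAlt := by
  intro v
  rw [stdSymp, Matrix.toBilin'_apply]
  simp [Matrix.J, Fintype.sum_sum_type, Matrix.one_apply, mul_comm]

/-! ### The point -/

section Point

variable {X : FSpace.{u}} [Subsingleton X]

theorem locAffine_of_subsingleton (hX : X.IsLocal) : LocAffine X := by
  intro x
  have hA := affine_isLocal (Fin 0 → ℂ)
  exact ⟨Fin 0 → ℂ, inferInstance, inferInstance, inferInstance, fun _ => (0 : Fin 0 → ℂ), fun _ => x,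
    Set.univ, Set.univ, trivial, isOpen_univ, isOpen_univ, fun _ _ => trivial, fun _ _ => trivial,
    fun _ _ => Subsingleton.elim _ _, fun y _ => Subsingleton.elim (α := Fin 0 → ℂ) _ _,
    fun y _ => morphAt_const hX y _, fun y _ => morphAt_const hA y x⟩

theorem isIrred_of_subsingleton [hne : Nonempty X] : X.IsIrred :=
  @IrreducibleSpace.mk X X.top ⟨fun _ _ _ _ ⟨x, _, hx⟩ ⟨y, _, hy⟩ =>
    ⟨x, trivial, hx, Subsingleton.elim y x ▸ hy⟩⟩ hne

theorem univClosed_of_subsingleton [hne : Nonempty X] : UnivClosed.{u, v} X := by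
  intro T hT C hC
  obtain ⟨x⟩ := hne
  have h : IsMorphism (X := T) (Y := T.prod X) (fun t => (t, x)) := isMorphism_iff.2 fun t =>
    morphAt_prodMk hT (morphAt_id t) (morphAt_const hT t x)
  convert hC.preimage h.1 using 1
  ext t
  exact ⟨fun ⟨y, hy⟩ => by rwa [Subsingleton.elim y x] at hy, fun h => ⟨x, h⟩⟩

end Point

end FSpace

/-! ### Combinatorics of Schubert indices -/

theorem card_filter_Icc_le (n : ℕ) (p : ℕ → Prop) [DecidablePred p] :
    ((Finset.Icc 1 n).filter p).card ≤ n :=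
  (Finset.card_filter_le _ _).trans (by simp)

/-- A count over an initial segment of a down-closed property. -/
theorem le_card_filter_Icc_iff {n : ℕ} {p : ℕ → Prop} [DecidablePred p]
    (hp : ∀ i j, 1 ≤ i → i ≤ j → j ≤ n → p j → p i) {t : ℕ} (h1 : 1 ≤ t) (h2 : t ≤ n) :
    t ≤ ((Finset.Icc 1 n).filter p).card ↔ p t := by
  constructor
  · intro h
    by_contra hpt
    have hsub : (Finset.Icc 1 n).filter p ⊆ Finset.Icc 1 (t - 1) := by
      intro i hi
      simp only [Finset.mem_filter, Finset.mem_Icc] at hi ⊢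
      refine ⟨hi.1.1, ?_⟩
      by_contra hti
      exact hpt (hp t i h1 (by omega) hi.1.2 hi.2)
    have := Finset.card_le_card hsub
    simp only [Nat.card_Icc] at this
    omega
  · intro h
    have hsub : Finset.Icc 1 t ⊆ (Finset.Icc 1 n).filter p := by
      intro i hi
      simp only [Finset.mem_filter, Finset.mem_Icc] at hi ⊢
      exact ⟨⟨hi.1, by omega⟩, hp i t hi.1 hi.2 h2 h⟩
    simpa using Finset.card_le_card hsub

theorem add_sub_le_of_strictMonoOn {f : ℕ → ℕ} {n : ℕ} (hf : StrictMonoOn f (Set.Icc 1 n))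
    {i j : ℕ} (hi : 1 ≤ i) (hij : i ≤ j) (hj : j ≤ n) : f i + (j - i) ≤ f j := by
  induction j, hij using Nat.le_induction with
  | base => simp
  | succ j hij ih =>
    have h1 := ih (by omega)
    have h2 := hf (a := j) (b := j + 1) ⟨by omega, by omega⟩ ⟨by omega, by omega⟩ (by omega)
    omega

namespace SchubertIndex

variable {k m : ℕ} (I : SchubertIndex k m)

theorem x_le_s (j : ℕ) : I.x j ≤ I.s := card_filter_Icc_le _ _

theorem le_x_iff {t : ℕ} (j : ℕ) (h1 : 1 ≤ t) (h2 : t ≤ I.s) : t ≤ I.x j ↔ I.a t ≤ I.b j :=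
  le_card_filter_Icc_iff (fun _ _ h3 h4 h5 h6 =>
    ((I.a_strictMono.le_iff_le ⟨h3, h4.trans h5⟩ ⟨h3.trans h4, h5⟩).2 h4).trans h6) h1 h2

theorem z_of_le {t : ℕ} (h : t ≤ I.s) :
    I.z t = ((Finset.Icc 1 (k - I.s)).filter (fun j => I.b j < I.a t)).card := if_pos h

theorem z_of_lt {t : ℕ} (h : I.s < t) : I.z t = k - t + 1 := if_neg (by omega)

theorem z_le (t : ℕ) (h : t ≤ k) : I.z t ≤ k - I.s := by
  by_cases ht : t ≤ I.s
  · rw [I.z_of_le ht]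
    exact card_filter_Icc_le _ _
  · rw [I.z_of_lt (by omega)]
    omega

theorem le_z_iff {t j : ℕ} (ht : t ≤ I.s) (h1 : 1 ≤ j) (h2 : j ≤ k - I.s) :
    j ≤ I.z t ↔ I.b j < I.a t := by
  rw [I.z_of_le ht]
  exact le_card_filter_Icc_iff (fun _ _ h3 h4 h5 h6 =>
    ((I.b_strictMono.le_iff_le ⟨h3, h4.trans h5⟩ ⟨h3.trans h4, h5⟩).2 h4).trans_lt h6) h1 h2

theorem le_z_iff_x_lt {t j : ℕ} (h0 : 1 ≤ t) (ht : t ≤ I.s) (h1 : 1 ≤ j) (h2 : j ≤ k - I.s) :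
    j ≤ I.z t ↔ I.x j < t := by
  rw [I.le_z_iff ht h1 h2, ← not_le, ← not_le, I.le_x_iff j h0 ht]

theorem x_lt_of_le_z {t j : ℕ} (h0 : 1 ≤ t) (ht : t ≤ k) (h1 : 1 ≤ j) (h : j ≤ I.z t) :
    I.x j < t := by
  by_cases hs : t ≤ I.s
  · exact (I.le_z_iff_x_lt h0 hs h1 (h.trans (I.z_le t ht))).1 h
  · exact (I.x_le_s j).trans_lt (by omega)

theorem z_mono {t t' : ℕ} (h1 : 1 ≤ t) (h : t ≤ t') (ht' : t' ≤ I.s) : I.z t ≤ I.z t' := by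
  by_contra hlt
  have h2 := I.z_le t (h.trans (ht'.trans I.s_le))
  have h3 : I.z t ≤ I.z t' := by
    rw [I.le_z_iff ht' (by omega) h2]
    exact ((I.le_z_iff (h.trans ht') (by omega) h2).1 le_rfl).trans_le
      ((I.a_strictMono.le_iff_le ⟨h1, h.trans ht'⟩ ⟨h1.trans h, ht'⟩).2 h)
  exact hlt h3

theorem le_a {t : ℕ} (h1 : 1 ≤ t) (h2 : t ≤ I.s) : t ≤ I.a t := by
  have h3 := add_sub_le_of_strictMonoOn I.a_strictMono le_rfl h1 h2
  have h4 := (I.a_mem 1 ⟨le_rfl, h1.trans h2⟩).1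
  omega

theorem x_le_b (j : ℕ) : I.x j ≤ I.b j := by
  rcases Nat.eq_zero_or_pos (I.x j) with h | h
  · omega
  · exact (I.le_a h (I.x_le_s j)).trans ((I.le_x_iff j h (I.x_le_s j)).1 le_rfl)

theorem b_mono {j j' : ℕ} (h1 : 1 ≤ j) (h : j ≤ j') (h2 : j' ≤ k - I.s) : I.b j ≤ I.b j' :=
  (I.b_strictMono.le_iff_le ⟨h1, h.trans h2⟩ ⟨h1.trans h, h2⟩).2 h

theorem a_mono {j j' : ℕ} (h1 : 1 ≤ j) (h : j ≤ j') (h2 : j' ≤ I.s) : I.a j ≤ I.a j' :=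
  (I.a_strictMono.le_iff_le ⟨h1, h.trans h2⟩ ⟨h1.trans h, h2⟩).2 h

theorem x_mono {j j' : ℕ} (h1 : 1 ≤ j) (h : j ≤ j') (h2 : j' ≤ k - I.s) : I.x j ≤ I.x j' := by
  rcases Nat.eq_zero_or_pos (I.x j) with h0 | h0
  · omega
  · exact (I.le_x_iff j' h0 (I.x_le_s j)).2
      (((I.le_x_iff j h0 (I.x_le_s j)).1 le_rfl).trans (I.b_mono h1 h h2))

theorem x_add_b_le {j j' : ℕ} (h1 : 1 ≤ j) (h : j ≤ j') (h2 : j' ≤ k - I.s) :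
    I.x j' + I.b j ≤ I.x j + I.b j' := by
  have h3 := I.b_mono h1 h h2
  by_cases hx : I.x j' ≤ I.x j
  · omega
  have h4 := (I.le_x_iff j' (by omega) (I.x_le_s j')).1 le_rfl
  have h5 := (I.le_x_iff (t := I.x j + 1) j (by omega) (by have := I.x_le_s j'; omega)).not.1
    (by omega)
  have h6 := add_sub_le_of_strictMonoOn I.a_strictMono (i := I.x j + 1) (j := I.x j') (by omega)
    (by omega) (I.x_le_s j')
  omega

/-- The elements `a_i` and `b_l + 1` of an interval are distinct. -/
theorem count_le {t j j' M : ℕ} (ht : t ≤ I.s) (hxt : I.x j ≤ t) (h1 : 1 ≤ j) (hj : j ≤ j' + 1)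
    (h2 : j' ≤ k - I.s) (hM : I.b j ≤ M) (ha : ∀ i, 1 ≤ i → i ≤ t → I.a i ≤ M)
    (hb : ∀ l, 1 ≤ l → l ≤ j' → I.b l < M) : t + (j' + 1) + I.b j ≤ M + I.x j + j := by
  rcases Nat.eq_or_lt_of_le hj with e | hj'
  · subst e
    by_cases hx : t = I.x (j' + 1)
    · omega
    have h4 := ha t (by omega) le_rfl
    have h5 := (I.le_x_iff (t := I.x (j' + 1) + 1) (j' + 1) (by omega) (by omega)).not.1 (by omega)
    have h6 := add_sub_le_of_strictMonoOn I.a_strictMono (i := I.x (j' + 1) + 1) (j := t) (by omega)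
      (by omega) ht
    omega
  let S₁ := (Finset.Icc (I.x j + 1) t).image I.a
  let S₂ := (Finset.Icc j j').image (fun l => I.b l + 1)
  have c1 : S₁.card = t - I.x j := by
    rw [Finset.card_image_of_injOn, Nat.card_Icc]
    · omega
    · refine I.a_strictMono.injOn.mono fun i hi => ?_
      simp only [Finset.coe_Icc, Set.mem_Icc] at hi ⊢
      omega
  have c2 : S₂.card = j' + 1 - j := by
    rw [Finset.card_image_of_injOn, Nat.card_Icc]
    intro l hl l' hl' e
    simp only [Finset.coe_Icc, Set.mem_Icc] at hl hl'
    refine I.b_strictMono.injOn (x₁ := l) (x₂ := l') ⟨by omega, by omega⟩ ⟨by omega, by omega⟩ ?_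
    simpa using e
  have hd : Disjoint S₁ S₂ := by
    rw [Finset.disjoint_left]
    rintro c h3 h4
    obtain ⟨i, hi, rfl⟩ := Finset.mem_image.1 h3
    obtain ⟨l, hl, e⟩ := Finset.mem_image.1 h4
    rw [Finset.mem_Icc] at hi hl
    exact I.a_ne i ⟨by omega, by omega⟩ l ⟨by omega, by omega⟩ e.symm
  have hsub : S₁ ∪ S₂ ⊆ Finset.Ioc (I.b j) M := by
    refine Finset.union_subset (fun c hc => ?_) (fun c hc => ?_)
    · obtain ⟨i, hi, rfl⟩ := Finset.mem_image.1 hc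
      rw [Finset.mem_Icc] at hi
      have h5 := (I.le_x_iff (t := i) j (by omega) (by omega)).not.1 (by omega)
      exact Finset.mem_Ioc.2 ⟨by omega, ha i (by omega) hi.2⟩
    · obtain ⟨l, hl, rfl⟩ := Finset.mem_image.1 hc
      rw [Finset.mem_Icc] at hl
      have h5 := I.b_mono h1 hl.1 (hl.2.trans h2)
      have h6 := hb l (by omega) hl.2
      exact Finset.mem_Ioc.2 ⟨by omega, by omega⟩
  have := Finset.card_le_card hsub
  rw [Finset.card_union_of_disjoint hd, c1, c2, Nat.card_Ioc] at this
  omega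

theorem positions_finite : I.positions.Finite := by
  refine (Set.finite_Icc (0, 0) (k, k)).subset fun p hp => ?_
  obtain ⟨h1, h2, h3⟩ := hp
  have := I.z_le p.1 h2
  exact ⟨⟨by omega, by omega⟩, ⟨h2, by change p.2 ≤ k; omega⟩⟩

instance : Finite I.positions := I.positions_finite

theorem dim_zero (t : ℕ) : I.dim (t, 0) = t := if_pos rfl

theorem dim_of_pos {t j : ℕ} (h : 1 ≤ j) : I.dim (t, j) = I.b j + t - I.x j :=
  if_neg (by simp; omega)

theorem dim_succ (t j : ℕ) : I.dim (t + 1, j) = I.dim (t, j) + 1 := by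
  rcases Nat.eq_zero_or_pos j with rfl | h
  · rw [dim_zero, dim_zero]
  · rw [I.dim_of_pos h, I.dim_of_pos h]
    have := I.x_le_b j
    omega

theorem dim_le_dim_succ {t j : ℕ} (h : j + 1 ≤ k - I.s) :
    I.dim (t, j) ≤ I.dim (t, j + 1) := by
  rw [I.dim_of_pos (Nat.le_add_left 1 j)]
  rcases Nat.eq_zero_or_pos j with rfl | h0
  · rw [dim_zero]
    have := I.x_le_b (0 + 1)
    omega
  · rw [I.dim_of_pos h0]
    have h1 := I.x_add_b_le h0 (Nat.le_succ j) h
    have h2 := I.x_le_b j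
    have h3 := I.x_le_b (j + 1)
    simp only [Nat.succ_eq_add_one] at h1
    omega

theorem dim_pos {t j : ℕ} (h0 : 1 ≤ t) : 1 ≤ I.dim (t, j) := by
  obtain ⟨t, rfl⟩ := Nat.exists_eq_add_of_le' h0
  rw [dim_succ]
  omega

theorem dim_le_a {t j : ℕ} (h0 : 1 ≤ t) (ht : t ≤ I.s) (hj : j ≤ I.z t) : I.dim (t, j) ≤ I.a t := by
  rcases Nat.eq_zero_or_pos j with rfl | h
  · rw [dim_zero]
    exact I.le_a h0 ht
  · have h2 := hj.trans (I.z_le t (ht.trans I.s_le))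
    have h3 := (I.le_z_iff ht h h2).1 hj
    have h4 := I.count_le (j' := j - 1) ht (I.x_lt_of_le_z h0 (ht.trans I.s_le) h hj).le h
      (by omega) (by omega) h3.le (fun i h5 h6 => I.a_mono h5 h6 ht) (fun l h5 h6 =>
        (I.b_mono h5 (by omega) h2).trans_lt h3)
    rw [I.dim_of_pos h]
    omega

theorem dim_le_m {t j : ℕ} (h0 : 1 ≤ t) (ht : t ≤ k) (hj : j ≤ I.z t) : I.dim (t, j) ≤ m := by
  by_cases hs : t ≤ I.s
  · exact (I.dim_le_a h0 hs hj).trans (I.a_mem t ⟨h0, hs⟩).2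
  · have hz := I.z_of_lt (t := t) (by omega)
    have h1 : ∀ j, 1 ≤ j → j ≤ I.z t → I.dim (t, j) ≤ m := by
      intro j h hj
      have h2 := I.count_le (j := j) (j' := k - I.s) (M := m) le_rfl (I.x_le_s j) h (by omega) le_rfl
        (I.b_lt j ⟨h, by omega⟩).le (fun i h5 h6 => (I.a_mem i ⟨h5, h6⟩).2)
        (fun l h5 h6 => I.b_lt l ⟨h5, h6⟩)
      rw [I.dim_of_pos h]
      have := I.s_le
      omega
    rcases Nat.eq_zero_or_pos j with rfl | h
    · exact (I.dim_le_dim_succ (by omega)).trans (h1 (0 + 1) le_rfl (by omega))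
    · exact h1 j h hj

end SchubertIndex

namespace SchubertIndex

variable {k m : ℕ} (I : SchubertIndex k m)
variable {V : Type u} [AddCommGroup V] [Module ℂ V] {ω : LinearMap.BilinForm ℂ V}

/-! ### Partial diagrams -/

/-- The bound for the last entry of a row. -/
def rowBound (F : IsotropicFlag ω m) (t : ℕ) : Submodule ℂ V :=
  if t ≤ I.s then F.F (I.a t) else ω.orthogonal (F.F (I.b (k - t + 1)))

/-- `D` is a diagram with entries at the positions in `T`. -/
structure IsPartial (F : IsotropicFlag ω m) (T : Set (ℕ × ℕ)) (D : ℕ × ℕ → Submodule ℂ V) :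
    Prop where
  finrank_eq : ∀ p ∈ T, finrank ℂ (D p) = I.dim p
  isotropic : ∀ p ∈ T, IsIsotropic ω (D p)
  row : ∀ t j, (t, j) ∈ T → (t, j + 1) ∈ T → D (t, j) ≤ D (t, j + 1)
  col : ∀ t j, (t, j) ∈ T → (t + 1, j) ∈ T → D (t, j) ≤ D (t + 1, j)
  flag_le : ∀ t j, (t, j) ∈ T → 1 ≤ j → F.F (I.b j) ≤ D (t, j)
  le_rowBound : ∀ t, (t, I.z t) ∈ T → D (t, I.z t) ≤ I.rowBound F t

/-- The lower bound that a partial diagram imposes on the next entry. -/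
def lower (F : IsotropicFlag ω m) (D : ℕ × ℕ → Submodule ℂ V) (p : ℕ × ℕ) : Submodule ℂ V :=
  if 2 ≤ p.1 ∧ p.2 ≤ I.z (p.1 - 1) then D (p.1 - 1, p.2)
  else if p.2 = 0 then ⊥ else F.F (I.b p.2)

/-- The upper bound that a partial diagram imposes on the next entry. -/
def upper (F : IsotropicFlag ω m) (D : ℕ × ℕ → Submodule ℂ V) (p : ℕ × ℕ) : Submodule ℂ V :=
  if p.2 < I.z p.1 then D (p.1, p.2 + 1)
  else if p.1 ≤ I.s then F.F (I.a p.1) else ω.orthogonal (I.lower F D p)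

variable {I} {F : IsotropicFlag ω m} {D : ℕ × ℕ → Submodule ℂ V} {T : Set (ℕ × ℕ)}

theorem IsPartial.mono {T' : Set (ℕ × ℕ)} (h : I.IsPartial F T D) (hT : T' ⊆ T) :
    I.IsPartial F T' D where
  finrank_eq p hp := h.finrank_eq p (hT hp)
  isotropic p hp := h.isotropic p (hT hp)
  row t j h1 h2 := h.row t j (hT h1) (hT h2)
  col t j h1 h2 := h.col t j (hT h1) (hT h2)
  flag_le t j h1 := h.flag_le t j (hT h1)
  le_rowBound t h1 := h.le_rowBound t (hT h1)

theorem IsPartial.congr {D' : ℕ × ℕ → Submodule ℂ V} (h : I.IsPartial F T D)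
    (hD : ∀ p ∈ T, D' p = D p) : I.IsPartial F T D' where
  finrank_eq p hp := by rw [hD p hp, h.finrank_eq p hp]
  isotropic p hp := by rw [hD p hp]; exact h.isotropic p hp
  row t j h1 h2 := by rw [hD _ h1, hD _ h2]; exact h.row t j h1 h2
  col t j h1 h2 := by rw [hD _ h1, hD _ h2]; exact h.col t j h1 h2
  flag_le t j h1 h2 := by rw [hD _ h1]; exact h.flag_le t j h1 h2
  le_rowBound t h1 := by rw [hD _ h1]; exact h.le_rowBound t h1

theorem before_up {t j : ℕ} (h1 : 2 ≤ t) (h2 : t ≤ k) (h3 : j ≤ I.z (t - 1)) (l : ℕ) :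
    (t - 1, j) ∈ I.before (t, l) :=
  ⟨⟨by simp; omega, by simp; omega, h3⟩, Or.inl (by simp; omega)⟩

theorem before_right {t j l : ℕ} (h1 : 1 ≤ t) (h2 : t ≤ k) (h3 : j ≤ I.z t) (h : l < j) :
    (t, j) ∈ I.before (t, l) :=
  ⟨⟨h1, h2, h3⟩, Or.inr ⟨rfl, h⟩⟩

theorem upTo_eq {p : ℕ × ℕ} (hp : p ∈ I.positions) : I.upTo p = insert p (I.before p) := by
  ext q
  simp only [upTo, before, Set.mem_insert_iff, Set.mem_ofPred]
  constructor
  · rintro ⟨h1, h2 | ⟨h2, h3⟩⟩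
    · exact Or.inr ⟨h1, Or.inl h2⟩
    · rcases h3.eq_or_lt with h4 | h4
      · exact Or.inl (Prod.ext h2 h4.symm)
      · exact Or.inr ⟨h1, Or.inr ⟨h2, h4⟩⟩
  · rintro (rfl | ⟨h1, h2 | ⟨h2, h3⟩⟩)
    · exact ⟨hp, Or.inr ⟨rfl, le_rfl⟩⟩
    · exact ⟨h1, Or.inl h2⟩
    · exact ⟨h1, Or.inr ⟨h2, h3.le⟩⟩

theorem self_mem_upTo {p : ℕ × ℕ} (hp : p ∈ I.positions) : p ∈ I.upTo p :=
  ⟨hp, Or.inr ⟨rfl, le_rfl⟩⟩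

theorem notMem_before (p : ℕ × ℕ) : p ∉ I.before p := by
  rintro ⟨-, h | h⟩
  · exact lt_irrefl _ h
  · exact lt_irrefl _ h.2

theorem lower_congr {D' : ℕ × ℕ → Submodule ℂ V} {p : ℕ × ℕ} (hp : p ∈ I.positions)
    (hD : ∀ q ∈ I.before p, D' q = D q) : I.lower F D' p = I.lower F D p := by
  rw [lower, lower]
  split_ifs with h
  · exact hD _ (before_up h.1 hp.2.1 h.2 _)
  · rfl
  · rfl

theorem upper_congr {D' : ℕ × ℕ → Submodule ℂ V} {p : ℕ × ℕ} (hp : p ∈ I.positions)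
    (hD : ∀ q ∈ I.before p, D' q = D q) : I.upper F D' p = I.upper F D p := by
  rw [upper, upper, lower_congr hp hD]
  split_ifs with h
  · exact hD _ (before_right hp.1 hp.2.1 (Nat.succ_le_of_lt h) (Nat.lt_succ_self _))
  · rfl
  · rfl

section Entry

variable {t j : ℕ}

theorem x_eq_of_not_le {k m : ℕ} {I : SchubertIndex k m} {t j : ℕ} (hp : (t, j) ∈ I.positions) (hj : ¬ j = 0) (hc : ¬ (2 ≤ t ∧ j ≤ I.z (t - 1))) : I.x j + 1 = t := by
  obtain ⟨h1, h2, h3⟩ := hp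
  simp only at h1 h2 h3
  have h4 := I.x_lt_of_le_z h1 h2 (by omega) h3
  have h5 := h3.trans (I.z_le t h2)
  by_cases h6 : 2 ≤ t
  · have h7 : ¬ j ≤ I.z (t - 1) := fun h8 => hc ⟨h6, h8⟩
    have h8 : t - 1 ≤ I.s := by
      by_contra h9
      rw [I.z_of_lt (by omega)] at h7 h3
      omega
    rw [I.le_z_iff_x_lt (by omega) h8 (by omega) h5] at h7
    omega
  · omega

theorem finrank_lower (hp : (t, j) ∈ I.positions) (h : I.IsPartial F (I.before (t, j)) D) :
    finrank ℂ (I.lower F D (t, j)) + 1 = I.dim (t, j) := by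
  have hp' := hp
  obtain ⟨h1, h2, h3⟩ := hp'
  simp only at h1 h2 h3
  by_cases hc : 2 ≤ t ∧ j ≤ I.z (t - 1)
  · rw [show I.lower F D (t, j) = D (t - 1, j) from if_pos hc,
      h.finrank_eq _ (before_up hc.1 h2 hc.2 _), ← dim_succ, Nat.sub_add_cancel h1]
  by_cases hj : j = 0
  · rw [show I.lower F D (t, j) = ⊥ from (if_neg hc).trans (if_pos hj)]
    subst hj
    rw [finrank_bot, dim_zero]
    by_contra h4
    exact hc ⟨by omega, Nat.zero_le _⟩
  · rw [show I.lower F D (t, j) = F.F (I.b j) from (if_neg hc).trans (if_neg hj)]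
    have h4 := x_eq_of_not_le hp hj hc
    have h5 := h3.trans (I.z_le t h2)
    have h6 := I.b_lt j ⟨by omega, h5⟩
    rw [F.finrank_eq _ h6.le, I.dim_of_pos (by omega)]
    omega

theorem isIsotropic_lower (hp : (t, j) ∈ I.positions) (h : I.IsPartial F (I.before (t, j)) D) :
    IsIsotropic ω (I.lower F D (t, j)) := by
  have hp' := hp
  obtain ⟨h1, h2, h3⟩ := hp'
  simp only at h1 h2 h3
  rw [lower]
  split_ifs with hc hj
  · exact h.isotropic _ (before_up hc.1 h2 hc.2 _)
  · intro v hv w _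
    rw [(Submodule.mem_bot ℂ).1 hv, map_zero, LinearMap.zero_apply]
  · simp only at hj
    exact F.isotropic _ (I.b_lt j ⟨by omega, h3.trans (I.z_le t h2)⟩).le

theorem flag_le_lower (hp : (t, j) ∈ I.positions) (h : I.IsPartial F (I.before (t, j)) D)
    (hj : 1 ≤ j) : F.F (I.b j) ≤ I.lower F D (t, j) := by
  have hp' := hp
  obtain ⟨h1, h2, h3⟩ := hp'
  simp only at h1 h2 h3
  rw [lower]
  split_ifs with hc hj
  · exact h.flag_le _ _ (before_up hc.1 h2 hc.2 _) hj
  · simp only at hj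
    omega
  · exact le_rfl

theorem lower_le_upper (hp : (t, j) ∈ I.positions) (h : I.IsPartial F (I.before (t, j)) D) :
    I.lower F D (t, j) ≤ I.upper F D (t, j) := by
  have hp' := hp
  obtain ⟨h1, h2, h3⟩ := hp'
  simp only at h1 h2 h3
  have hz := I.z_le t h2
  rw [upper]
  split_ifs with hj hs
  · simp only at hj
    have hr : (t, j + 1) ∈ I.before (t, j) := before_right h1 h2 hj (Nat.lt_succ_self j)
    have hf := h.flag_le _ _ hr (Nat.le_add_left 1 j)
    rw [lower]
    split_ifs with hc hj0
    · simp only at hc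
      have hu := before_up hc.1 h2 hc.2 j
      rcases hc.2.eq_or_lt with e | hlt
      · have h6 : t - 1 ≤ I.s := by
          by_contra h9
          rw [I.z_of_lt (by omega)] at e hj
          omega
        have h7 : ¬ j + 1 ≤ I.z (t - 1) := by omega
        rw [I.le_z_iff h6 (by omega) (by omega), not_lt] at h7
        have h8 := h.le_rowBound (t - 1) (e ▸ hu)
        rw [rowBound, if_pos h6, ← e] at h8
        exact h8.trans ((F.mono _ _ h7 (I.b_lt _ ⟨by omega, by omega⟩).le).trans hf)
      · have hu2 := before_up hc.1 h2 (Nat.succ_le_of_lt hlt) j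
        have h5 := h.row _ _ hu hu2
        have h6 := h.col (t - 1) (j + 1) hu2 (by rwa [Nat.sub_add_cancel h1])
        rw [Nat.sub_add_cancel h1] at h6
        exact h5.trans h6
    · exact bot_le
    · simp only at hj0 ⊢
      exact (F.mono _ _ (I.b_mono (by omega) (Nat.le_succ j) (by omega))
        (I.b_lt _ ⟨by omega, by omega⟩).le).trans hf
  · simp only at hj hs ⊢
    have ha := (I.a_mem t ⟨h1, hs⟩).2
    rw [lower]
    split_ifs with hc hj0
    · simp only at hc
      have hu := before_up hc.1 h2 hc.2 j
      have h5 := I.z_mono (t := t - 1) (by omega) (Nat.sub_le t 1) hs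
      have h6 : j = I.z (t - 1) := by omega
      have h7 := h.le_rowBound (t - 1) (h6 ▸ hu)
      rw [rowBound, if_pos (by omega), ← h6] at h7
      exact h7.trans (F.mono _ _ (I.a_mono (by omega) (Nat.sub_le t 1) hs) ha)
    · exact bot_le
    · simp only at hj0 ⊢
      exact F.mono _ _ ((I.le_z_iff hs (by omega) (by omega)).1 h3).le ha
  · intro v hv
    rw [LinearMap.BilinForm.mem_orthogonal_iff]
    exact fun w hw => isIsotropic_lower hp h w hw v hv

theorem isIsotropic_of_lower_le (hp : (t, j) ∈ I.positions) (h : I.IsPartial F (I.before (t, j)) D)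
    (hω' : ω.IsAlt) [FiniteDimensional ℂ V] {N : Submodule ℂ V}
    (h1 : I.lower F D (t, j) ≤ N) (h2 : N ≤ ω.orthogonal (I.lower F D (t, j)))
    (h3 : finrank ℂ N = I.dim (t, j)) : IsIsotropic ω N := by
  obtain ⟨v, hv, hvL⟩ : ∃ v ∈ N, v ∉ I.lower F D (t, j) := by
    by_contra! h4
    have := le_antisymm h1 h4
    have h5 := finrank_lower hp h
    rw [this] at h5
    omega
  have hN : N = I.lower F D (t, j) ⊔ Submodule.span ℂ {v} := by
    symm
    refine Submodule.eq_of_le_of_finrank_le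
      (sup_le h1 ((Submodule.span_singleton_le_iff_mem v N).2 hv)) ?_
    rw [h3, ← finrank_lower hp h]
    refine Submodule.finrank_lt_finrank_of_lt (lt_of_le_of_ne le_sup_left fun e => hvL ?_)
    rw [e]
    exact Submodule.mem_sup_right (Submodule.mem_span_singleton_self v)
  have hv2 := fun w hw => (LinearMap.BilinForm.mem_orthogonal_iff.1 (h2 hv)) w hw
  have hv3 : ∀ w ∈ I.lower F D (t, j), ω v w = 0 := fun w hw => hω'.isRefl _ _ (hv2 w hw)
  have hL := isIsotropic_lower hp h
  intro y hy z hz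
  rw [hN] at hy hz
  obtain ⟨y₁, hy₁, _, hy₂, rfl⟩ := Submodule.mem_sup.1 hy
  obtain ⟨c, rfl⟩ := Submodule.mem_span_singleton.1 hy₂
  obtain ⟨z₁, hz₁, _, hz₂, rfl⟩ := Submodule.mem_sup.1 hz
  obtain ⟨d, rfl⟩ := Submodule.mem_span_singleton.1 hz₂
  have e1 : ω y₁ v = 0 := hv2 y₁ hy₁
  simp [hL y₁ hy₁ z₁ hz₁, e1, hv3 z₁ hz₁, hω' v]

end Entry

theorem isPartial_upTo_iff [FiniteDimensional ℂ V] (hω' : ω.IsAlt) {p : ℕ × ℕ}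
    (hp : p ∈ I.positions) : I.IsPartial F (I.upTo p) D ↔
      I.IsPartial F (I.before p) D ∧ I.lower F D p ≤ D p ∧ D p ≤ I.upper F D p ∧
        finrank ℂ (D p) = I.dim p := by
  obtain ⟨t, j⟩ := p
  have hp' := hp
  obtain ⟨h1, h2, h3⟩ := hp'
  simp only at h1 h2 h3
  have hself := self_mem_upTo hp
  have hsub := I.before_subset_upTo (t, j)
  constructor
  · intro h
    have hb := h.mono hsub
    have hl : I.lower F D (t, j) ≤ D (t, j) := by
      rw [lower]
      split_ifs with hc hj
      · simp only at hc
        have := h.col (t - 1) j (hsub (before_up hc.1 h2 hc.2 _))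
          (by rwa [Nat.sub_add_cancel h1])
        rwa [Nat.sub_add_cancel h1] at this
      · exact bot_le
      · exact h.flag_le _ _ hself (by simp only at hj; omega)
    refine ⟨hb, hl, ?_, h.finrank_eq _ hself⟩
    rw [upper]
    split_ifs with hj hs
    · exact h.row _ _ hself (hsub (before_right h1 h2 hj (Nat.lt_succ_self j)))
    · have e : j = I.z t := by simp only at hj; omega
      subst e
      have := h.le_rowBound _ hself
      rwa [rowBound, if_pos hs] at this
    · intro v hv
      rw [LinearMap.BilinForm.mem_orthogonal_iff]
      exact fun w hw => h.isotropic _ hself w (hl hw) v hv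
  · rintro ⟨h, hl, hu, hd⟩
    have hiso : IsIsotropic ω (D (t, j)) := by
      rw [upper] at hu
      split_ifs at hu with hj hs
      · have hr : (t, j + 1) ∈ I.before (t, j) := before_right h1 h2 hj (Nat.lt_succ_self j)
        exact fun v hv w hw => h.isotropic _ hr v (hu hv) w (hu hw)
      · have ha := (I.a_mem t ⟨h1, hs⟩).2
        exact fun v hv w hw => F.isotropic _ ha v (hu hv) w (hu hw)
      · exact isIsotropic_of_lower_le hp h hω' hl hu hd
    rw [upTo_eq hp]
    have hrb : ∀ t' j', (t', j') ∈ I.before (t, j) → t' < t ∨ (t' = t ∧ j < j') := fun _ _ hq => hq.2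
    have hpos : ∀ t' j', (t', j') ∈ I.before (t, j) → 1 ≤ t' ∧ t' ≤ k ∧ j' ≤ I.z t' :=
      fun _ _ hq => hq.1
    refine ⟨?_, ?_, ?_, ?_, ?_, ?_⟩
    · rintro q (rfl | hq)
      · exact hd
      · exact h.finrank_eq q hq
    · rintro q (rfl | hq)
      · exact hiso
      · exact h.isotropic q hq
    · rintro t' j' (hq | hq) (hq' | hq')
      · simp only [Prod.mk.injEq] at hq hq'
        omega
      · obtain ⟨rfl, rfl⟩ := Prod.mk.inj hq
        have h4 := (hpos _ _ hq').2.2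
        rwa [upper, if_pos (Nat.lt_of_succ_le h4)] at hu
      · obtain ⟨rfl, rfl⟩ := Prod.mk.inj hq'
        have h4 := hrb _ _ hq
        omega
      · exact h.row _ _ hq hq'
    · rintro t' j' (hq | hq) (hq' | hq')
      · simp only [Prod.mk.injEq] at hq hq'
        omega
      · obtain ⟨rfl, rfl⟩ := Prod.mk.inj hq
        have h4 := hrb _ _ hq'
        omega
      · obtain ⟨rfl, rfl⟩ := Prod.mk.inj hq'
        have h4 := hpos _ _ hq
        rwa [lower, if_pos ⟨by simp only; omega, h4.2.2⟩] at hl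
      · exact h.col _ _ hq hq'
    · rintro t' j' (hq | hq) hj
      · obtain ⟨rfl, rfl⟩ := Prod.mk.inj hq
        exact (flag_le_lower hp h hj).trans hl
      · exact h.flag_le _ _ hq hj
    · rintro t' (hq | hq)
      · obtain ⟨rfl, e⟩ := Prod.mk.inj hq
        rw [e]
        rw [upper, if_neg (by simp only; omega)] at hu
        rw [rowBound]
        split_ifs at hu ⊢ with hs
        · exact hu
        · refine hu.trans (LinearMap.BilinForm.orthogonal_le ?_)
          have hz := I.z_of_lt (t := t') (by omega)
          rw [← hz, e]
          exact flag_le_lower hp h (by omega)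
      · exact h.le_rowBound _ hq

/-- The dimension of the upper bound, if the fibre dimension is `N`. -/
theorem finrank_upper [FiniteDimensional ℂ V] (hω : ω.Nondegenerate) (hV : finrank ℂ V = 2 * m)
    {t j : ℕ} (hp : (t, j) ∈ I.positions) (h : I.IsPartial F (I.before (t, j)) D) :
    finrank ℂ (I.upper F D (t, j)) + 1 = I.dim (t, j) +
      (if j < I.z t then I.dim (t, j + 1) + 1 - I.dim (t, j)
        else if t ≤ I.s then I.a t + 1 - I.dim (t, j) else 2 * (m + 1 - I.dim (t, j))) := by
  have hp' := hp
  obtain ⟨h1, h2, h3⟩ := hp'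
  simp only at h1 h2 h3
  have hz := I.z_le t h2
  by_cases hj : j < I.z t
  · have hr : (t, j + 1) ∈ I.before (t, j) := before_right h1 h2 hj (Nat.lt_succ_self j)
    rw [show I.upper F D (t, j) = D (t, j + 1) from if_pos hj, if_pos hj, h.finrank_eq _ hr]
    have := I.dim_le_dim_succ (t := t) (j := j) (by omega)
    omega
  by_cases hs : t ≤ I.s
  · have ha := (I.a_mem t ⟨h1, hs⟩).2
    rw [show I.upper F D (t, j) = F.F (I.a t) from (if_neg hj).trans (if_pos hs), if_neg hj,
      if_pos hs, F.finrank_eq _ ha]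
    have := I.dim_le_a h1 hs h3
    omega
  · rw [show I.upper F D (t, j) = ω.orthogonal (I.lower F D (t, j)) from
      (if_neg hj).trans (if_neg hs), if_neg hj, if_neg hs,
      LinearMap.BilinForm.finrank_orthogonal hω, hV]
    have h4 := finrank_lower hp h
    have h5 := I.dim_le_m h1 h2 h3
    omega

end SchubertIndex

/-- A subspace of given dimension between two subspaces. -/
theorem exists_finrank_eq_between {V : Type u} [AddCommGroup V] [Module ℂ V] [FiniteDimensional ℂ V]
    {A B : Submodule ℂ V} (h : A ≤ B) {d : ℕ} (hA : finrank ℂ A ≤ d) (hB : d ≤ finrank ℂ B) :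
    ∃ N, A ≤ N ∧ N ≤ B ∧ finrank ℂ N = d := by
  induction d, hA using Nat.le_induction with
  | base => exact ⟨A, le_rfl, h, rfl⟩
  | succ d hd ih =>
    obtain ⟨N, h1, h2, h3⟩ := ih (by omega)
    obtain ⟨v, hv, hvN⟩ : ∃ v ∈ B, v ∉ N := by
      by_contra! h4
      have := Submodule.finrank_mono (show B ≤ N from h4)
      omega
    refine ⟨N ⊔ Submodule.span ℂ {v}, h1.trans le_sup_left,
      sup_le h2 ((Submodule.span_singleton_le_iff_mem v B).2 hv), ?_⟩
    have h4 := Submodule.finrank_sup_add_finrank_inf_eq N (Submodule.span ℂ {v})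
    have h5 : N ⊓ Submodule.span ℂ {v} = ⊥ := by
      rw [← disjoint_iff, Submodule.disjoint_span_singleton' (by rintro rfl; exact hvN N.zero_mem)]
      exact hvN
    rw [h5, finrank_bot, finrank_span_singleton (by rintro rfl; exact hvN N.zero_mem)] at h4
    omega

namespace SchubertIndex

attribute [local instance] FSpace.top

open Filter FSpace

variable {k m : ℕ} {I : SchubertIndex k m}
variable {V : Type u} [AddCommGroup V] [Module ℂ V] {ω : LinearMap.BilinForm ℂ V}
variable {F : IsotropicFlag ω m} {D : ℕ × ℕ → Submodule ℂ V} {T : Set (ℕ × ℕ)}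

/-! ### Extension of partial diagrams -/

/-- A numbering of the positions compatible with their order. -/
def rank (k : ℕ) (p : ℕ × ℕ) : ℕ := p.1 * (k + 1) + (k - p.2)

theorem snd_le {p : ℕ × ℕ} (hp : p ∈ I.positions) : p.2 ≤ k :=
  (hp.2.2.trans (I.z_le p.1 hp.2.1)).trans (Nat.sub_le _ _)

theorem mem_before_iff {p q : ℕ × ℕ} (hp : p ∈ I.positions) (hq : q ∈ I.positions) :
    q ∈ I.before p ↔ rank k q < rank k p := by
  have h1 := snd_le hp
  have h2 := snd_le hq
  have key : ∀ a b : ℕ, a < b → a * (k + 1) + (k + 1) ≤ b * (k + 1) := fun a b h => by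
    have := Nat.mul_le_mul_right (k + 1) (Nat.succ_le_of_lt h)
    rwa [Nat.succ_mul] at this
  constructor
  · rintro ⟨-, h | ⟨h, h'⟩⟩
    · have := key _ _ h
      simp only [rank]
      omega
    · simp only [rank, h]
      omega
  · intro h
    refine ⟨hq, ?_⟩
    rcases lt_trichotomy q.1 p.1 with h3 | h3 | h3
    · exact Or.inl h3
    · refine Or.inr ⟨h3, ?_⟩
      simp only [rank, h3] at h
      omega
    · have := key _ _ h3
      simp only [rank] at h
      omega

/-- `T` is an initial segment of the positions. -/
structure IsInitial (I : SchubertIndex k m) (T : Set (ℕ × ℕ)) : Prop where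
  subset : T ⊆ I.positions
  before_subset : ∀ p ∈ T, I.before p ⊆ T

theorem isInitial_before {p : ℕ × ℕ} (hp : p ∈ I.positions) : IsInitial I (I.before p) where
  subset _ hq := hq.1
  before_subset _ hq _ hr :=
    (mem_before_iff hp hr.1).2 (((mem_before_iff hq.1 hr.1).1 hr).trans ((mem_before_iff hp hq.1).1 hq))

theorem isInitial_upTo {p : ℕ × ℕ} (hp : p ∈ I.positions) : IsInitial I (I.upTo p) where
  subset _ hq := hq.1
  before_subset q hq r hr := by
    rw [upTo_eq hp] at hq
    rcases hq with rfl | hq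
    · exact I.before_subset_upTo _ hr
    · exact I.before_subset_upTo _ ((isInitial_before hp).before_subset q hq hr)

theorem isInitial_positions : IsInitial I I.positions where
  subset := le_rfl
  before_subset _ _ _ hr := hr.1

theorem mem_before_or {p q : ℕ × ℕ} (hp : p ∈ I.positions) (hq : q ∈ I.positions) :
    q ∈ I.before p ∨ q = p ∨ p ∈ I.before q := by
  obtain ⟨t, j⟩ := p
  obtain ⟨t', j'⟩ := q
  simp only [before, Set.mem_ofPred, hp, hq, true_and, Prod.mk.injEq]
  omega

theorem IsInitial.eq_before {p : ℕ × ℕ} (hT : IsInitial I T) (hp : p ∈ I.positions) (hpT : p ∉ T)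
    (h : I.before p ⊆ T) : T = I.before p := by
  refine Set.Subset.antisymm (fun q hq => ?_) h
  rcases mem_before_or hp (hT.subset hq) with h1 | rfl | h1
  · exact h1
  · exact absurd hq hpT
  · exact absurd (hT.before_subset q hq h1) hpT

theorem IsInitial.finite (hT : IsInitial I T) : T.Finite := I.positions_finite.subset hT.subset

section Extend

variable [FiniteDimensional ℂ V]

theorem exists_between_lower_upper (hω : ω.Nondegenerate) (hV : finrank ℂ V = 2 * m) {p : ℕ × ℕ}
    (hp : p ∈ I.positions) (h : I.IsPartial F (I.before p) D) :
    ∃ N, I.lower F D p ≤ N ∧ N ≤ I.upper F D p ∧ finrank ℂ N = I.dim p := by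
  obtain ⟨t, j⟩ := p
  have h1 := finrank_lower hp h
  have h2 := finrank_upper hω hV hp h
  obtain ⟨h3, h4, h5⟩ := hp
  simp only at h3 h4 h5
  refine exists_finrank_eq_between (lower_le_upper ⟨h3, h4, h5⟩ h) (by omega) ?_
  have hz := I.z_le t h4
  split_ifs at h2 with hj hs
  · have := I.dim_le_dim_succ (t := t) (j := j) (by omega)
    omega
  · have := I.dim_le_a h3 hs h5
    omega
  · have := I.dim_le_m h3 h4 h5
    omega

open Classical in
theorem IsPartial.update (hω' : ω.IsAlt) {p : ℕ × ℕ} (hp : p ∈ I.positions)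
    (h : I.IsPartial F (I.before p) D) {N : Submodule ℂ V} (h1 : I.lower F D p ≤ N)
    (h2 : N ≤ I.upper F D p) (h3 : finrank ℂ N = I.dim p) :
    I.IsPartial F (I.upTo p) (Function.update D p N) := by
  have hD : ∀ q ∈ I.before p, Function.update D p N q = D q := fun q hq =>
    Function.update_of_ne (fun e => notMem_before p (e ▸ hq)) _ _
  rw [isPartial_upTo_iff hω' hp, lower_congr hp hD, upper_congr hp hD, Function.update_self]
  exact ⟨h.congr hD, h1, h2, h3⟩

theorem IsPartial.extend (hω : ω.Nondegenerate) (hω' : ω.IsAlt) (hV : finrank ℂ V = 2 * m)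
    (hT : IsInitial I T) (h : I.IsPartial F T D) :
    ∃ D', I.IsPartial F I.positions D' ∧ ∀ p ∈ T, D' p = D p := by
  classical
  induction e : (I.positions \ T).ncard using Nat.strong_induction_on generalizing T D with
  | _ n ih =>
  rcases (I.positions \ T).eq_empty_or_nonempty with h0 | h0
  · have : T = I.positions := hT.subset.antisymm (Set.sdiff_eq_empty.1 h0)
    subst this
    exact ⟨D, h, fun _ _ => rfl⟩
  have hfin : (I.positions \ T).Finite := I.positions_finite.sdiff
  obtain ⟨p, hp, hmin⟩ := Set.exists_min_image _ (rank k) hfin h0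
  have hTp : T = I.before p := hT.eq_before hp.1 hp.2 fun q hq => by
    by_contra hqT
    have h1 := hmin q ⟨hq.1, hqT⟩
    have h2 := (mem_before_iff hp.1 hq.1).1 hq
    omega
  subst hTp
  obtain ⟨N, h1, h2, h3⟩ := exists_between_lower_upper hω hV hp.1 h
  obtain ⟨D', h4, h5⟩ := ih _ (by
    rw [← e]
    refine Set.ncard_lt_ncard ?_ hfin
    refine ⟨Set.sdiff_subset_sdiff_right (I.before_subset_upTo p), fun h6 => ?_⟩
    exact (h6 hp).2 (self_mem_upTo hp.1)) (isInitial_upTo hp.1) (h.update hω' hp.1 h1 h2 h3) rfl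
  refine ⟨D', h4, fun q hq => ?_⟩
  rw [h5 q (I.before_subset_upTo p hq),
    Function.update_of_ne (fun e => notMem_before p (e ▸ hq))]

end Extend

/-! ### Spaces of partial diagrams -/

open Classical in
/-- The entries of a point of the ambient space, as a function on all pairs. -/
noncomputable def entries (E : I.ambient V T) (q : ℕ × ℕ) : Submodule ℂ V :=
  if h : q ∈ T then E.1 ⟨q, h⟩ else ⊥

theorem entries_of_mem (E : I.ambient V T) {q : ℕ × ℕ} (h : q ∈ T) : entries E q = E.1 ⟨q, h⟩ :=
  dif_pos h

theorem entries_injective {E E' : I.ambient V T} (h : ∀ q ∈ T, entries E q = entries E' q) :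
    E = E' := by
  refine Subtype.ext (funext fun q => ?_)
  have := h q.1 q.2
  rwa [entries_of_mem E q.2, entries_of_mem E' q.2] at this

/-- A point of the ambient space with given entries. -/
def ofEntries (D : ℕ × ℕ → Submodule ℂ V) (h : ∀ p ∈ T, finrank ℂ (D p) = I.dim p) :
    I.ambient V T :=
  ⟨fun p => D p.1, fun p => h p.1 p.2⟩

theorem entries_ofEntries (h : ∀ p ∈ T, finrank ℂ (D p) = I.dim p) {q : ℕ × ℕ} (hq : q ∈ T) :
    entries (I.ofEntries D h) q = D q := entries_of_mem _ hq

theorem entries_forget {T' : Set (ℕ × ℕ)} (h : T ⊆ T') (E : I.ambient V T') {q : ℕ × ℕ}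
    (hq : q ∈ T) : entries (I.forget h E) q = entries E q := by
  rw [entries_of_mem _ hq, entries_of_mem _ (h hq)]
  rfl

theorem mem_diagrams_iff (E : I.ambient V I.positions) :
    E ∈ I.diagrams F ↔ I.IsPartial F I.positions (entries E) := by
  constructor
  · rintro ⟨h1, h2, h3, h4, h5⟩
    refine ⟨fun p hp => ?_, fun p hp => ?_, fun t j hp hq => ?_, fun t j hp hq => ?_,
      fun t j hp hj => ?_, fun t hp => ?_⟩
    · rw [entries_of_mem E hp]
      exact E.2 ⟨p, hp⟩
    · rw [entries_of_mem E hp]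
      exact h1 _
    · rw [entries_of_mem E hp, entries_of_mem E hq]
      exact h2 _ _ rfl
    · rw [entries_of_mem E hp, entries_of_mem E hq]
      exact h3 _ _ rfl
    · rw [entries_of_mem E hp]
      exact h4 ⟨_, hp⟩ hj
    · rw [entries_of_mem E hp]
      exact h5 ⟨_, hp⟩ rfl
  · intro h
    have e : ∀ p : I.positions, E.1 p = entries E p.1 := fun p => (entries_of_mem E p.2).symm
    refine ⟨fun p => ?_, fun p q hpq => ?_, fun p q hpq => ?_, fun p hp => ?_, fun p hp => ?_⟩
    · rw [e]
      exact h.isotropic _ p.2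
    · rw [e, e, hpq]
      exact h.row _ _ p.2 (hpq ▸ q.2)
    · rw [e, e, hpq]
      exact h.col _ _ p.2 (hpq ▸ q.2)
    · rw [e]
      exact h.flag_le _ _ p.2 hp
    · have h1 : p.1 = (p.1.1, I.z p.1.1) := Prod.ext rfl hp
      rw [e]
      have h2 := h.le_rowBound p.1.1 (h1 ▸ p.2)
      rwa [← h1] at h2

variable [FiniteDimensional ℂ V]

theorem mem_stage_iff (hω : ω.Nondegenerate) (hω' : ω.IsAlt) (hV : finrank ℂ V = 2 * m)
    (hT : IsInitial I T) (hT' : T ⊆ I.positions) (E : I.ambient V T) :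
    E ∈ I.stage F hT' ↔ I.IsPartial F T (entries E) := by
  constructor
  · rintro ⟨D, hD, rfl⟩
    exact (((mem_diagrams_iff D).1 hD).mono hT').congr fun p hp => entries_forget hT' D hp
  · intro h
    obtain ⟨D', h1, h2⟩ := h.extend hω hω' hV hT
    refine ⟨I.ofEntries D' h1.finrank_eq, ?_, entries_injective fun q hq => ?_⟩
    · rw [mem_diagrams_iff]
      exact h1.congr fun p hp => entries_ofEntries _ hp
    · rw [entries_forget _ _ hq, entries_ofEntries _ (hT' hq), h2 q hq]

theorem regSub_entries [Finite T] (S : Set (I.ambient V T)) (E : (I.ambient V T).restrict S)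
    {q : ℕ × ℕ} (hq : q ∈ T) :
    RegSub ((I.ambient V T).restrict S) (I.dim q) (fun E => entries E.1 q) E := by
  refine RegSub.congr (L := fun E : (I.ambient V T).restrict S => E.1.1 ⟨q, hq⟩)
    (RegSub.comp (regSub_grProd (ι := T) (d := fun p => I.dim p.1) E.1 ⟨q, hq⟩) (morphAt_val E)) ?_
  exact Eventually.of_forall fun E => (entries_of_mem E.1 hq).symm

theorem morphAt_stage [Finite T] {S : Set (I.ambient V T)} {Z : FSpace.{w}} (hZ : Z.IsLocal)
    {f : Z → (I.ambient V T).restrict S} {z : Z}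
    (h : ∀ q ∈ T, RegSub Z (I.dim q) (fun y => entries (f y).1 q) z) : MorphAt f z := by
  refine morphAt_restrict hZ (morphAt_grProd (ι := T) (d := fun p => I.dim p.1) hZ fun q => ?_)
  exact (h q.1 q.2).congr (Eventually.of_forall fun y => entries_of_mem (f y).1 q.2)

theorem stage_isLocal [Finite T] (S : Set (I.ambient V T)) :
    ((I.ambient V T).restrict S).IsLocal :=
  restrict_isLocal (grProd_isLocal (ι := T) (d := fun p => I.dim p.1) (V := V)) S

instance finite_before (p : ℕ × ℕ) : Finite (I.before p) :=
  I.positions_finite.subset fun _ h => h.1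

instance finite_upTo (p : ℕ × ℕ) : Finite (I.upTo p) :=
  I.positions_finite.subset fun _ h => h.1

theorem entries_forgetEntry {p q : ℕ × ℕ} (hq : q ∈ I.before p) (E : I.stageUpTo F p) :
    entries (I.forgetEntry F p E).1 q = entries E.1 q :=
  entries_forget (I.before_subset_upTo p) E.1 hq

theorem isMorphism_forgetEntry (F : IsotropicFlag ω m) (p : ℕ × ℕ) :
    IsMorphism (I.forgetEntry F p) := by
  refine isMorphism_iff.2 fun E => morphAt_stage (stage_isLocal _) fun q hq => ?_
  refine (regSub_entries _ E (I.before_subset_upTo p hq)).congr (Eventually.of_forall fun E' => ?_)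
  exact (entries_forgetEntry hq E').symm

/-- The bundles of the tower. -/
theorem isFibreBundle_forgetEntry (hω : ω.Nondegenerate) (hω' : ω.IsAlt) (hV : finrank ℂ V = 2 * m)
    {t j : ℕ} (hp : (t, j) ∈ I.positions) (K : Type) [AddCommGroup K] [Module ℂ K]
    [FiniteDimensional ℂ K] (hK : finrank ℂ K =
      if j < I.z t then I.dim (t, j + 1) + 1 - I.dim (t, j)
        else if t ≤ I.s then I.a t + 1 - I.dim (t, j) else 2 * (m + 1 - I.dim (t, j))) :
    IsFibreBundle (I.forgetEntry F (t, j)) (gr 1 K) := by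
  have hX : (I.stageUpTo F (t, j)).IsLocal := stage_isLocal _
  have hY : (I.stageBefore F (t, j)).IsLocal := stage_isLocal _
  have hXp : ∀ E : I.stageUpTo F (t, j), I.IsPartial F (I.upTo (t, j)) (entries E.1) := fun E =>
    (mem_stage_iff hω hω' hV (isInitial_upTo hp) _ E.1).1 E.2
  have hYp : ∀ E : I.stageBefore F (t, j), I.IsPartial F (I.before (t, j)) (entries E.1) :=
    fun E => (mem_stage_iff hω hω' hV (isInitial_before hp) _ E.1).1 E.2
  have hd := I.dim_pos (j := j) hp.1
  simp only at hd
  have hself := self_mem_upTo hp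
  obtain ⟨h1, h2, h3⟩ := id hp
  simp only at h1 h2 h3
  have hl : ∀ E : I.stageBefore F (t, j), RegSub (I.stageBefore F (t, j)) (I.dim (t, j) - 1)
      (fun E => I.lower F (entries E.1) (t, j)) E := by
    intro E
    have hfr := finrank_lower hp (hYp E)
    by_cases hc : 2 ≤ t ∧ j ≤ I.z (t - 1)
    · have e : ∀ E : I.stageBefore F (t, j), entries E.1 (t - 1, j) =
        I.lower F (entries E.1) (t, j) := fun E => (if_pos hc).symm
      have h4 := regSub_entries _ E (before_up hc.1 h2 hc.2 j)
      have h5 : I.dim (t - 1, j) = I.dim (t, j) - 1 := by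
        rw [← h4.finrank_eq, e]
        omega
      rw [← h5]
      exact h4.congr (Eventually.of_forall e)
    · have e : ∀ E : I.stageBefore F (t, j), (if j = 0 then ⊥ else F.F (I.b j)) =
        I.lower F (entries E.1) (t, j) := fun E => (if_neg hc).symm
      refine (RegSub.const hY E ?_).congr (Eventually.of_forall e)
      rw [e E]
      omega
  have hu : ∀ E : I.stageBefore F (t, j), RegSub (I.stageBefore F (t, j))
      (finrank ℂ K + (I.dim (t, j) - 1)) (fun E => I.upper F (entries E.1) (t, j)) E := by
    intro E
    have hfr := finrank_upper hω hV hp (hYp E)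
    rw [← hK] at hfr
    by_cases hj : j < I.z t
    · have e : ∀ E : I.stageBefore F (t, j), entries E.1 (t, j + 1) =
        I.upper F (entries E.1) (t, j) := fun E => (if_pos hj).symm
      have h4 := regSub_entries _ E (before_right h1 h2 hj (Nat.lt_succ_self j))
      have h5 : I.dim (t, j + 1) = finrank ℂ K + (I.dim (t, j) - 1) := by
        rw [← h4.finrank_eq, e]
        omega
      rw [← h5]
      exact h4.congr (Eventually.of_forall e)
    by_cases hs : t ≤ I.s
    · have e : ∀ E : I.stageBefore F (t, j), F.F (I.a t) =
        I.upper F (entries E.1) (t, j) := fun E => ((if_neg hj).trans (if_pos hs)).symm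
      refine (RegSub.const hY E ?_).congr (Eventually.of_forall e)
      rw [e E]
      omega
    · have e : ∀ E : I.stageBefore F (t, j), ω.orthogonal (I.lower F (entries E.1) (t, j)) =
        I.upper F (entries E.1) (t, j) := fun E => ((if_neg hj).trans (if_neg hs)).symm
      have h4 := (hl E).orthogonal hY hω
      have h5 : finrank ℂ V - (I.dim (t, j) - 1) = finrank ℂ K + (I.dim (t, j) - 1) := by
        rw [← h4.finrank_eq, e]
        omega
      rw [← h5]
      exact h4.congr (Eventually.of_forall e)
  have hlow : ∀ E : I.stageUpTo F (t, j), I.lower F (entries (I.forgetEntry F (t, j) E).1) (t, j) =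
      I.lower F (entries E.1) (t, j) := fun E =>
    lower_congr hp fun q hq => entries_forgetEntry hq E
  have hupp : ∀ E : I.stageUpTo F (t, j), I.upper F (entries (I.forgetEntry F (t, j) E).1) (t, j) =
      I.upper F (entries E.1) (t, j) := fun E =>
    upper_congr hp fun q hq => entries_forgetEntry hq E
  refine isFibreBundle_of_lines hω hω'.isRefl hX hY (isMorphism_forgetEntry F _)
    (a := I.dim (t, j) - 1) (A := fun E => I.lower F (entries E.1) (t, j))
    (B := fun E => I.upper F (entries E.1) (t, j)) (W := fun E => entries E.1 (t, j))
    hl hu (fun E => lower_le_upper hp (hYp E)) (fun E => ?_) (fun E => ?_) (fun E => ?_)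
    (fun E N h4 h5 h6 => ?_) (fun E E' h4 h5 => ?_) (fun Z hZ g z h4 h5 => ?_)
  · rw [Nat.sub_add_cancel hd]
    exact regSub_entries _ E hself
  · rw [hlow]
    exact ((isPartial_upTo_iff hω' hp).1 (hXp E)).2.1
  · rw [hupp]
    exact ((isPartial_upTo_iff hω' hp).1 (hXp E)).2.2.1
  · classical
    rw [Nat.sub_add_cancel hd] at h6
    have h7 := (hYp E).update hω' hp h4 h5 h6
    refine ⟨⟨I.ofEntries _ h7.finrank_eq, (mem_stage_iff hω hω' hV (isInitial_upTo hp) _ _).2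
      (h7.congr fun q hq => entries_ofEntries _ hq)⟩, Subtype.ext (entries_injective fun q hq => ?_),
      ?_⟩
    · refine (entries_forgetEntry hq _).trans ?_
      refine (entries_ofEntries h7.finrank_eq (I.before_subset_upTo _ hq)).trans ?_
      exact Function.update_of_ne (fun e => notMem_before _ (e ▸ hq)) _ _
    · refine (entries_ofEntries h7.finrank_eq hself).trans ?_
      exact Function.update_self _ _ _
  · refine Subtype.ext (entries_injective fun q hq => ?_)
    rw [upTo_eq hp] at hq
    rcases hq with rfl | hq
    · exact h5
    · rw [← entries_forgetEntry hq E, ← entries_forgetEntry hq E', h4]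
  · refine morphAt_stage hZ fun q hq => ?_
    rw [upTo_eq hp] at hq
    rcases hq with rfl | hq
    · rwa [Nat.sub_add_cancel hd] at h5
    · refine (RegSub.comp (regSub_entries _ _ hq) h4).congr (Eventually.of_forall fun y => ?_)
      exact entries_forgetEntry hq (g y)

end SchubertIndex

namespace SchubertIndex

attribute [local instance] FSpace.top

open Filter FSpace

/-! ### The tower of bundles -/

variable {k m : ℕ} {I : SchubertIndex k m}
variable {V : Type u} [AddCommGroup V] [Module ℂ V] {ω : LinearMap.BilinForm ℂ V}
variable {F : IsotropicFlag ω m} {T : Set (ℕ × ℕ)} [FiniteDimensional ℂ V]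

theorem fibreDim_pos {t j : ℕ} (hp : (t, j) ∈ I.positions) :
    0 < if j < I.z t then I.dim (t, j + 1) + 1 - I.dim (t, j)
        else if t ≤ I.s then I.a t + 1 - I.dim (t, j) else 2 * (m + 1 - I.dim (t, j)) := by
  obtain ⟨h1, h2, h3⟩ := hp
  simp only at h1 h2 h3
  have hz := I.z_le t h2
  split_ifs with hj hs
  · have := I.dim_le_dim_succ (t := t) (j := j) (by omega)
    omega
  · have := I.dim_le_a h1 hs h3
    omega
  · have := I.dim_le_m h1 h2 h3
    omega

theorem stage_tower (hω : ω.Nondegenerate) (hω' : ω.IsAlt) (hV : finrank ℂ V = 2 * m)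
    (hT : IsInitial I T) (hT' : T ⊆ I.positions) :
    LocAffine ((I.ambient V T).restrict (I.stage F hT')) ∧
      ((I.ambient V T).restrict (I.stage F hT')).IsIrred ∧
      UnivClosed.{u, u} ((I.ambient V T).restrict (I.stage F hT')) := by
  induction e : T.ncard using Nat.strong_induction_on generalizing T with
  | _ n ih =>
  have hfin : Finite T := hT.finite
  rcases T.eq_empty_or_nonempty with rfl | h0
  · have h1 : I.IsPartial F ∅ (fun _ => ⊥) :=
      ⟨fun _ h => h.elim, fun _ h => h.elim, fun _ _ h => h.elim, fun _ _ h => h.elim,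
        fun _ _ h => h.elim, fun _ h => h.elim⟩
    have : Nonempty ((I.ambient V ∅).restrict (I.stage F hT')) :=
      ⟨⟨I.ofEntries _ h1.finrank_eq, (mem_stage_iff hω hω' hV hT _ _).2
        (h1.congr fun _ h => h.elim)⟩⟩
    have : Subsingleton ((I.ambient V ∅).restrict (I.stage F hT')) :=
      ⟨fun E E' => Subtype.ext (entries_injective fun _ h => h.elim)⟩
    exact ⟨locAffine_of_subsingleton (stage_isLocal _), isIrred_of_subsingleton,
      univClosed_of_subsingleton⟩
  · obtain ⟨⟨t, j⟩, hp, hmax⟩ := Set.exists_max_image T (rank k) hT.finite h0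
    have hpp := hT.subset hp
    have hTp : T = I.upTo (t, j) := by
      rw [upTo_eq hpp]
      refine Set.Subset.antisymm (fun q hq => ?_)
        (Set.insert_subset hp (hT.before_subset _ hp))
      rcases mem_before_or hpp (hT.subset hq) with h1 | h1 | h1
      · exact Or.inr h1
      · exact Or.inl h1
      · have h2 := hmax q hq
        have h3 := (mem_before_iff (hT.subset hq) hpp).1 h1
        omega
    subst hTp
    obtain ⟨h1, h2, h3⟩ := ih (I.before (t, j)).ncard (by
      rw [← e]
      refine Set.ncard_lt_ncard ⟨I.before_subset_upTo _, fun h => ?_⟩ hT.finite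
      exact notMem_before _ (h hp)) (isInitial_before hpp) (fun _ h => h.1) rfl
    let N := if j < I.z t then I.dim (t, j + 1) + 1 - I.dim (t, j)
        else if t ≤ I.s then I.a t + 1 - I.dim (t, j) else 2 * (m + 1 - I.dim (t, j))
    have hN : finrank ℂ (Fin N → ℂ) = N := by simp
    have hN0 : 0 < finrank ℂ (Fin N → ℂ) := by rw [hN]; exact fibreDim_pos hpp
    have hb : IsFibreBundle (I.forgetEntry F (t, j)) (gr 1 (Fin N → ℂ)) :=
      isFibreBundle_forgetEntry hω hω' hV hpp _ hN
    have := gr_one_nonempty (Fin N → ℂ) hN0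
    have hX : (I.stageUpTo F (t, j)).IsLocal := stage_isLocal _
    have hY : (I.stageBefore F (t, j)).IsLocal := stage_isLocal _
    have hG := gr_isLocal (V := Fin N → ℂ) 1
    exact ⟨hb.locAffine hX hY hG h1 (gr_one_locAffine _),
      hb.isIrred hX hY hG h2 (gr_one_isIrred _ hN0),
      hb.univClosed hX hY hG h3 (gr_one_univClosed _)⟩

theorem stage_positions (h : I.positions ⊆ I.positions) : I.stage F h = I.diagrams F := by
  ext D
  exact ⟨fun ⟨_, h, e⟩ => e ▸ h, fun h => ⟨D, h, rfl⟩⟩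

theorem gamma_properties (hω : ω.Nondegenerate) (hω' : ω.IsAlt) (hV : finrank ℂ V = 2 * m)
    (I : SchubertIndex k m) (F : IsotropicFlag ω m) :
    LocAffine (I.Gamma F) ∧ (I.Gamma F).IsIrred ∧ UnivClosed.{u, u} (I.Gamma F) := by
  have h := stage_tower (F := F) hω hω' hV (I := I) isInitial_positions le_rfl
  rwa [stage_positions] at h

theorem isClosed_le {X : FSpace.{w}} (hX : X.IsLocal) {d e : ℕ} {L M : X → Submodule ℂ V}
    (hL : ∀ x, RegSub X d L x) (hM : ∀ x, RegSub X e M x) : IsClosed {x | L x ≤ M x} :=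
  ⟨isOpen_iff_mem_nhds.2 fun x hx => (hL x).eventually_not_le hX (hM x) hx⟩

theorem isClosed_isotropic {X : FSpace.{w}} (hX : X.IsLocal) {d : ℕ} {L : X → Submodule ℂ V}
    (hL : ∀ x, RegSub X d L x) : IsClosed {x | IsIsotropic ω (L x)} :=
  ⟨isOpen_iff_mem_nhds.2 fun x hx => (hL x).eventually_not_isotropic hX ω hx⟩

theorem isClosed_diagrams (I : SchubertIndex k m) (F : IsotropicFlag ω m) :
    IsClosed (I.diagrams F) := by
  have hX : (I.ambient V I.positions).IsLocal :=
    grProd_isLocal (ι := I.positions) (d := fun p => I.dim p.1)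
  have hr : ∀ (p : I.positions) (D : I.ambient V I.positions),
      RegSub (I.ambient V I.positions) (I.dim p.1) (fun D => D.1 p) D := fun p D =>
    regSub_grProd (ι := I.positions) (d := fun p => I.dim p.1) D p
  have hc : ∀ (N : Submodule ℂ V) (D : I.ambient V I.positions),
      RegSub (I.ambient V I.positions) (finrank ℂ N) (fun _ => N) D := fun N D =>
    RegSub.const hX D rfl
  have h1 : IsClosed {D : I.ambient V I.positions | ∀ p, IsIsotropic ω (D.1 p)} := by
    rw [Set.ofPred_forall]
    exact isClosed_iInter fun p => isClosed_isotropic hX (hr p)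
  have h2 : ∀ P : I.positions → I.positions → Prop,
      IsClosed {D : I.ambient V I.positions | ∀ p q, P p q → D.1 p ≤ D.1 q} := fun P => by
    simp only [Set.ofPred_forall]
    exact isClosed_iInter fun p => isClosed_iInter fun q => isClosed_iInter fun _ =>
      isClosed_le hX (hr p) (hr q)
  have h3 : IsClosed {D : I.ambient V I.positions |
      ∀ p : I.positions, 1 ≤ p.1.2 → F.F (I.b p.1.2) ≤ D.1 p} := by
    simp only [Set.ofPred_forall]
    exact isClosed_iInter fun p => isClosed_iInter fun _ => isClosed_le hX (hc _) (hr p)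
  have h4 : ∀ (P : I.positions → Prop) (N : I.positions → Submodule ℂ V),
      IsClosed {D : I.ambient V I.positions | ∀ p, P p → D.1 p ≤ N p} := fun P N => by
    simp only [Set.ofPred_forall]
    exact isClosed_iInter fun p => isClosed_iInter fun _ => isClosed_le hX (hr p) (hc _)
  exact h1.inter ((h2 _).inter ((h2 _).inter (h3.inter (h4 _ _))))

/-- The bundles of the tower, with the fibres of the three kinds. -/
theorem isFibreBundle_tower (hω : ω.Nondegenerate) (hω' : ω.IsAlt) (hV : finrank ℂ V = 2 * m)
    (F : IsotropicFlag ω m) {p : ℕ × ℕ} (hp : p ∈ I.positions) :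
    (p.2 < I.z p.1 → IsFibreBundle (I.forgetEntry F p)
        (gr 1 (Fin (I.dim (p.1, p.2 + 1) + 1 - I.dim p) → ℂ))) ∧
    (p.2 = I.z p.1 → p.1 ≤ I.s →
      IsFibreBundle (I.forgetEntry F p) (gr 1 (Fin (I.a p.1 + 1 - I.dim p) → ℂ))) ∧
    (p.2 = I.z p.1 → I.s < p.1 →
      IsFibreBundle (I.forgetEntry F p) (sg 1 (stdSymp (m + 1 - I.dim p)))) := by
  obtain ⟨t, j⟩ := p
  refine ⟨fun hj => ?_, fun hj hs => ?_, fun hj hs => ?_⟩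
  · refine isFibreBundle_forgetEntry hω hω' hV hp _ ?_
    rw [if_pos hj]
    simp
  · refine isFibreBundle_forgetEntry hω hω' hV hp _ ?_
    rw [if_neg hj.not_lt, if_pos hs]
    simp
  · obtain ⟨e, he⟩ := isIsomorphism_gr_sg_one (stdSymp_isAlt (m + 1 - I.dim (t, j)))
    refine (isFibreBundle_forgetEntry hω hω' hV hp _ ?_).congr_fibre (stage_isLocal _)
      (stage_isLocal _) (gr_isLocal 1) (restrict_isLocal (gr_isLocal 1) _) he
    rw [if_neg hj.not_lt, if_neg hs.not_ge]
    simp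
    omega

end SchubertIndex

section LinearAlgebra

variable {V : Type u} [AddCommGroup V] [Module ℂ V]

theorem isIsotropic_iff_le_orthogonal {ω : LinearMap.BilinForm ℂ V} {N : Submodule ℂ V} :
    IsIsotropic ω N ↔ N ≤ ω.orthogonal N :=
  ⟨fun h v hv => LinearMap.BilinForm.mem_orthogonal_iff.2 fun _ hw => h _ hw v hv,
    fun h v hv _ hw => LinearMap.BilinForm.mem_orthogonal_iff.1 (h hw) v hv⟩

theorem IsIsotropic.mono {ω : LinearMap.BilinForm ℂ V} {N N' : Submodule ℂ V}
    (h : IsIsotropic ω N) (h' : N' ≤ N) : IsIsotropic ω N' :=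
  fun v hv w hw => h v (h' hv) w (h' hw)

theorem le_orthogonal_comm {ω : LinearMap.BilinForm ℂ V} (hω : ω.IsRefl) {N N' : Submodule ℂ V}
    (h : N ≤ ω.orthogonal N') : N' ≤ ω.orthogonal N := fun v hv =>
  LinearMap.BilinForm.mem_orthogonal_iff.2 fun _ hw =>
    hω _ _ (LinearMap.BilinForm.mem_orthogonal_iff.1 (h hw) v hv)

theorem IsIsotropic.sup {ω : LinearMap.BilinForm ℂ V} (hω : ω.IsRefl) {N N' : Submodule ℂ V}
    (h : IsIsotropic ω N) (h' : IsIsotropic ω N') (h'' : N ≤ ω.orthogonal N') :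
    IsIsotropic ω (N ⊔ N') := by
  rw [isIsotropic_iff_le_orthogonal] at h h' ⊢
  rw [FSpace.orthogonal_sup]
  exact sup_le (le_inf h h'') (le_inf (le_orthogonal_comm hω h'') h')

variable [FiniteDimensional ℂ V]

theorem finrank_sup_add_le {A B : Submodule ℂ V} (h : A ≤ B) (C : Submodule ℂ V) :
    finrank ℂ (B ⊔ C : Submodule ℂ V) + finrank ℂ A ≤
      finrank ℂ (A ⊔ C : Submodule ℂ V) + finrank ℂ B := by
  have h1 := Submodule.finrank_sup_add_finrank_inf_eq B (A ⊔ C)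
  have h2 : B ⊔ (A ⊔ C) = B ⊔ C := by rw [← sup_assoc, sup_eq_left.2 h]
  have h3 : A ≤ B ⊓ (A ⊔ C) := le_inf h le_sup_left
  have h4 := Submodule.finrank_mono h3
  rw [h2] at h1
  omega

theorem finrank_inf_eq_of_nondegenerate {ω : LinearMap.BilinForm ℂ V} (hω : ω.Nondegenerate)
    (hω' : ω.IsRefl) (A B : Submodule ℂ V) :
    finrank ℂ (A ⊓ B : Submodule ℂ V) =
      finrank ℂ V - finrank ℂ (ω.orthogonal A ⊔ ω.orthogonal B : Submodule ℂ V) := by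
  rw [FSpace.inf_eq_orthogonal_sup hω hω', LinearMap.BilinForm.finrank_orthogonal hω]

/-- A chain of subspaces of given dimensions between two chains. -/
theorem exists_chain_between {S U : ℕ → Submodule ℂ V} {d : ℕ → ℕ} {lo hi : ℕ} (h : lo ≤ hi)
    (hSU : ∀ t, lo ≤ t → t ≤ hi → S t ≤ U t)
    (hS : ∀ t, lo ≤ t → t < hi → S t ≤ S (t + 1) ∧ finrank ℂ (S (t + 1)) ≤ finrank ℂ (S t) + 1)
    (hU : ∀ t, lo ≤ t → t < hi → U t ≤ U (t + 1))
    (hd : ∀ t, lo ≤ t → t ≤ hi → finrank ℂ (S t) ≤ d t ∧ d t ≤ finrank ℂ (U t))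
    (hd1 : ∀ t, lo ≤ t → t < hi → d (t + 1) = d t + 1) :
    ∃ W : ℕ → Submodule ℂ V, ∀ t, lo ≤ t → t ≤ hi → S t ≤ W t ∧ W t ≤ U t ∧
      finrank ℂ (W t) = d t ∧ (t < hi → W t ≤ W (t + 1)) := by
  induction hi, h using Nat.le_induction with
  | base =>
    obtain ⟨N, h1, h2, h3⟩ := exists_finrank_eq_between (hSU lo le_rfl le_rfl)
      (hd lo le_rfl le_rfl).1 (hd lo le_rfl le_rfl).2
    refine ⟨fun _ => N, fun t ht ht' => ?_⟩
    obtain rfl := le_antisymm ht ht'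
    exact ⟨h1, h2, h3, fun h => absurd h (lt_irrefl _)⟩
  | succ hi hle ih =>
    obtain ⟨W, hW⟩ := ih (fun t h1 h2 => hSU t h1 (by omega)) (fun t h1 h2 => hS t h1 (by omega))
      (fun t h1 h2 => hU t h1 (by omega)) (fun t h1 h2 => hd t h1 (by omega))
      (fun t h1 h2 => hd1 t h1 (by omega))
    obtain ⟨w1, w2, w3, -⟩ := hW hi hle le_rfl
    have hUi := hU hi hle (Nat.lt_succ_self hi)
    have hSi := hS hi hle (Nat.lt_succ_self hi)
    have hdi := hd1 hi hle (Nat.lt_succ_self hi)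
    have hsup := finrank_sup_add_le w1 (S (hi + 1))
    rw [sup_eq_right.2 hSi.1] at hsup
    obtain ⟨N, h1, h2, h3⟩ := exists_finrank_eq_between (A := W hi ⊔ S (hi + 1)) (B := U (hi + 1))
      (d := d (hi + 1)) (sup_le (w2.trans hUi) (hSU _ (by omega) le_rfl)) (by omega)
      (hd (hi + 1) (by omega) le_rfl).2
    have e : ∀ t, t ≤ hi → Function.update W (hi + 1) N t = W t := fun t ht =>
      Function.update_of_ne (by omega) _ _
    refine ⟨Function.update W (hi + 1) N, fun t ht ht' => ?_⟩
    rcases ht'.eq_or_lt with rfl | ht'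
    · rw [Function.update_self]
      exact ⟨le_sup_right.trans h1, h2, h3, fun h => absurd h (lt_irrefl _)⟩
    · have ht2 : t ≤ hi := by omega
      obtain ⟨w1, w2, w3, w4⟩ := hW t ht ht2
      rw [e t ht2]
      refine ⟨w1, w2, w3, fun _ => ?_⟩
      rcases ht2.eq_or_lt with rfl | ht3
      · rw [Function.update_self]
        exact le_sup_left.trans h1
      · rw [e (t + 1) (by omega)]
        exact w4 ht3

end LinearAlgebra

section Flag

variable {V : Type u} [AddCommGroup V] [Module ℂ V] {ω : LinearMap.BilinForm ℂ V} {m : ℕ}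

theorem IsotropicFlag.le_orthogonal (F : IsotropicFlag ω m) {i i' : ℕ} (hi : i ≤ m)
    (hi' : i' ≤ m) : F.F i ≤ ω.orthogonal (F.F i') := fun v hv =>
  LinearMap.BilinForm.mem_orthogonal_iff.2 fun w hw =>
    F.isotropic m le_rfl w (F.mono _ _ hi' le_rfl hw) v (F.mono _ _ hi le_rfl hv)

theorem IsotropicFlag.orthogonal_le (F : IsotropicFlag ω m) {i i' : ℕ} (h : i ≤ i')
    (hi' : i' ≤ m) : ω.orthogonal (F.F i') ≤ ω.orthogonal (F.F i) :=
  LinearMap.BilinForm.orthogonal_le (F.mono _ _ h hi')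

variable [FiniteDimensional ℂ V]

theorem IsIsotropic.orthogonal_eq (hω : ω.Nondegenerate) (hV : finrank ℂ V = 2 * m)
    {L : Submodule ℂ V} (hL : IsIsotropic ω L) (hd : finrank ℂ L = m) : ω.orthogonal L = L := by
  refine (Submodule.eq_of_le_of_finrank_eq (isIsotropic_iff_le_orthogonal.1 hL) ?_).symm
  rw [LinearMap.BilinForm.finrank_orthogonal hω]
  omega

theorem IsotropicFlag.finrank_orthogonal (hω : ω.Nondegenerate) (hV : finrank ℂ V = 2 * m)
    (F : IsotropicFlag ω m) {i : ℕ} (hi : i ≤ m) :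
    finrank ℂ (ω.orthogonal (F.F i)) = 2 * m - i := by
  rw [LinearMap.BilinForm.finrank_orthogonal hω, hV, F.finrank_eq i hi]

/-- An isotropic subspace is contained in a Lagrangian subspace adapted to the flag. -/
theorem IsotropicFlag.lagrangian (hω : ω.Nondegenerate) (hω' : ω.IsRefl)
    (hV : finrank ℂ V = 2 * m) (F : IsotropicFlag ω m) {S : Submodule ℂ V}
    (hS : IsIsotropic ω S) : IsIsotropic ω (S ⊔ (ω.orthogonal S ⊓ F.F m)) ∧
      finrank ℂ (S ⊔ (ω.orthogonal S ⊓ F.F m) : Submodule ℂ V) = m := by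
  have hFm := F.isotropic m le_rfl
  have hFo := hFm.orthogonal_eq hω hV (F.finrank_eq m le_rfl)
  refine ⟨hS.sup hω' (hFm.mono inf_le_right) (le_orthogonal_comm hω' inf_le_left), ?_⟩
  have h1 := Submodule.finrank_sup_add_finrank_inf_eq S (ω.orthogonal S ⊓ F.F m)
  have h2 := finrank_inf_eq_of_nondegenerate hω hω' (ω.orthogonal S) (F.F m)
  have h3 := Submodule.finrank_sup_add_finrank_inf_eq S (F.F m)
  have h4 : S ⊓ (ω.orthogonal S ⊓ F.F m) = S ⊓ F.F m := by
    rw [← inf_assoc, inf_eq_left.2 (isIsotropic_iff_le_orthogonal.1 hS)]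
  rw [hFo, LinearMap.BilinForm.orthogonal_orthogonal hω hω', hV] at h2
  rw [h4] at h1
  rw [F.finrank_eq m le_rfl] at h3
  have h5 := Submodule.finrank_le (S ⊔ F.F m)
  omega

end Flag

namespace SchubertIndex

variable {k m : ℕ} (I : SchubertIndex k m)
variable {V : Type u} [AddCommGroup V] [Module ℂ V] {ω : LinearMap.BilinForm ℂ V}
variable (F : IsotropicFlag ω m)

theorem rowBound_mono {t : ℕ} (h1 : 1 ≤ t) (ht : t < k) :
    I.rowBound F t ≤ I.rowBound F (t + 1) := by
  rw [rowBound, rowBound]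
  split_ifs with h2 h3 h3
  · exact F.mono _ _ (I.a_mono h1 (Nat.le_succ t) h3) (I.a_mem _ ⟨by omega, h3⟩).2
  · exact F.le_orthogonal (I.a_mem t ⟨h1, h2⟩).2 (I.b_lt _ ⟨by omega, by omega⟩).le
  · omega
  · exact F.orthogonal_le (I.b_mono (by omega) (by omega) (by omega))
      (I.b_lt _ ⟨by omega, by omega⟩).le

theorem flag_le_rowBound {t j : ℕ} (hp : (t, j) ∈ I.positions) (hj : 1 ≤ j) :
    F.F (I.b j) ≤ I.rowBound F t := by
  obtain ⟨h1, h2, h3⟩ := hp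
  simp only at h1 h2 h3
  have hz := I.z_le t h2
  rw [rowBound]
  split_ifs with hs
  · exact F.mono _ _ ((I.le_z_iff hs hj (by omega)).1 h3).le (I.a_mem _ ⟨h1, hs⟩).2
  · exact F.le_orthogonal (I.b_lt _ ⟨hj, by omega⟩).le (I.b_lt _ ⟨by omega, by omega⟩).le

theorem rowBound_le_orthogonal {t j : ℕ} (hp : (t, j) ∈ I.positions) (hj : 1 ≤ j) :
    I.rowBound F t ≤ ω.orthogonal (F.F (I.b j)) := by
  obtain ⟨h1, h2, h3⟩ := hp
  simp only at h1 h2 h3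
  have hz := I.z_le t h2
  rw [rowBound]
  split_ifs with hs
  · exact F.le_orthogonal (I.a_mem _ ⟨h1, hs⟩).2 (I.b_lt _ ⟨hj, by omega⟩).le
  · have hzt := I.z_of_lt (t := t) (by omega)
    exact F.orthogonal_le (I.b_mono hj (by omega) (by omega)) (I.b_lt _ ⟨by omega, by omega⟩).le

theorem mem_positions_succ_iff {t j : ℕ} (hj : j + 1 ≤ k - I.s) :
    (t, j + 1) ∈ I.positions ↔ I.x (j + 1) < t ∧ t ≤ k - j := by
  have hx := I.x_le_s (j + 1)
  constructor
  · rintro ⟨h1, h2, h3⟩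
    simp only at h1 h2 h3
    refine ⟨I.x_lt_of_le_z h1 h2 (by omega) h3, ?_⟩
    by_cases hs : t ≤ I.s
    · omega
    · rw [I.z_of_lt (by omega)] at h3
      omega
  · rintro ⟨h1, h2⟩
    refine ⟨by simp only; omega, by simp only; omega, ?_⟩
    by_cases hs : t ≤ I.s
    · exact (I.le_z_iff_x_lt (by omega) hs (by omega) hj).2 h1
    · simp only
      rw [I.z_of_lt (by omega)]
      omega

variable {I F} [FiniteDimensional ℂ V]

/-- Given a column of a diagram, the next column can be added. -/
theorem exists_next_column (hω : ω.Nondegenerate) (hω' : ω.IsAlt) (hV : finrank ℂ V = 2 * m)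
    {j B X : ℕ} (hj : j + 1 ≤ k - I.s) {W : ℕ → Submodule ℂ V} (hX : X ≤ I.x (j + 1))
    (hXB : I.x (j + 1) + B ≤ X + I.b (j + 1))
    (hd : ∀ t, X < t → t ≤ k - j → finrank ℂ (W t) + X = B + t)
    (hiso : ∀ t, X < t → t ≤ k - j → IsIsotropic ω (W t))
    (hmono : ∀ t, X < t → t < k - j → W t ≤ W (t + 1))
    (hbd : ∀ t, X < t → t ≤ k - j → W t ≤ I.rowBound F t)
    (hfl : ∀ t, X < t → t ≤ k - j → F.F B ≤ W t) :
    ∃ W' : ℕ → Submodule ℂ V, ∀ t, (t, j + 1) ∈ I.positions → W t ≤ W' t ∧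
      F.F (I.b (j + 1)) ≤ W' t ∧ W' t ≤ I.rowBound F t ∧ IsIsotropic ω (W' t) ∧
      finrank ℂ (W' t) = I.dim (t, j + 1) ∧ ((t + 1, j + 1) ∈ I.positions → W' t ≤ W' (t + 1)) := by
  have hb := (I.b_lt (j + 1) ⟨by omega, hj⟩).le
  have hxs := I.x_le_s (j + 1)
  have hxb := I.x_le_b (j + 1)
  have hks : I.s ≤ k := I.s_le
  have hpos := fun t => I.mem_positions_succ_iff (t := t) hj
  have hmono' : ∀ t, X < t → ∀ t', t ≤ t' → t' ≤ k - j → W t ≤ W t' := by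
    intro t ht t' htt'
    induction t', htt' using Nat.le_induction with
    | base => exact fun _ => le_rfl
    | succ t' h1 ih => exact fun h2 => (ih (by omega)).trans (hmono t' (by omega) (by omega))
  let S : ℕ → Submodule ℂ V := fun t => W t ⊔ F.F (I.b (j + 1))
  have hSE : ∀ t, I.x (j + 1) < t → t ≤ k - j → S t ≤ I.rowBound F t := fun t h1 h2 =>
    sup_le (hbd t (by omega) h2) (I.flag_le_rowBound F ((hpos t).2 ⟨h1, h2⟩) (by omega))
  have hSd : ∀ t, I.x (j + 1) < t → t ≤ k - j →
      finrank ℂ (S t) + I.x (j + 1) ≤ I.b (j + 1) + t := by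
    intro t h1 h2
    have h3 : ∃ N ≤ W t ⊓ F.F (I.b (j + 1)), finrank ℂ N + X = B + I.x (j + 1) := by
      rcases hX.eq_or_lt with e | hlt
      · refine ⟨F.F B, le_inf (hfl t (by omega) h2) (F.mono _ _ (by omega) hb), ?_⟩
        rw [F.finrank_eq B (by omega)]
        omega
      · refine ⟨W (I.x (j + 1)), le_inf (hmono' _ hlt t h1.le h2) ?_, hd _ hlt (by omega)⟩
        have h4 := hbd _ hlt (by omega)
        rw [rowBound, if_pos hxs] at h4
        exact h4.trans (F.mono _ _ ((I.le_x_iff (j + 1) (by omega) hxs).1 le_rfl) hb)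
    obtain ⟨N, hN, hNd⟩ := h3
    have h4 := Submodule.finrank_mono hN
    have h5 := Submodule.finrank_sup_add_finrank_inf_eq (W t) (F.F (I.b (j + 1)))
    rw [F.finrank_eq _ hb] at h5
    have h6 := hd t (by omega) h2
    simp only [S]
    omega
  have hSiso : IsIsotropic ω (S (k - j)) := by
    refine (hiso _ (by omega) le_rfl).sup hω'.isRefl (F.isotropic _ hb) ?_
    exact (hbd _ (by omega) le_rfl).trans
      (I.rowBound_le_orthogonal F ((hpos _).2 ⟨by omega, le_rfl⟩) (by omega))
  obtain ⟨hL1, hL2⟩ := F.lagrangian hω hω'.isRefl hV hSiso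
  set L := S (k - j) ⊔ (ω.orthogonal (S (k - j)) ⊓ F.F m) with hL
  have key : ∀ c t₀, c ≤ m → X < t₀ → t₀ ≤ k - j → W t₀ ≤ ω.orthogonal (F.F c) →
      c + t₀ ≤ finrank ℂ (L ⊓ F.F c : Submodule ℂ V) + (k - j) := by
    intro c t₀ hc h1 h2 h3
    have h4 : ω.orthogonal (S (k - j)) ⊓ F.F c ≤ L ⊓ F.F c :=
      le_inf ((inf_le_inf_left _ (F.mono _ _ hc le_rfl)).trans le_sup_right) inf_le_right
    have h5 := Submodule.finrank_mono h4
    have h6 := finrank_inf_eq_of_nondegenerate hω hω'.isRefl (ω.orthogonal (S (k - j))) (F.F c)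
    rw [LinearMap.BilinForm.orthogonal_orthogonal hω hω'.isRefl, hV] at h6
    have h7 : S t₀ ≤ ω.orthogonal (F.F c) := sup_le h3 (F.le_orthogonal hb hc)
    have h8 := finrank_sup_add_le (show S t₀ ≤ S (k - j) from
      sup_le_sup_right (hmono' t₀ h1 _ h2 le_rfl) _) (ω.orthogonal (F.F c))
    rw [sup_eq_right.2 h7, F.finrank_orthogonal hω hV hc] at h8
    have h9 := finrank_sup_add_le (hmono' t₀ h1 _ h2 le_rfl) (F.F (I.b (j + 1)))
    have h10 := hd t₀ h1 h2
    have h11 := hd (k - j) (by omega) le_rfl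
    change finrank ℂ (S (k - j)) + _ ≤ finrank ℂ (S t₀) + _ at h9
    omega
  have hU : ∀ t, I.x (j + 1) < t → t ≤ k - j →
      I.b (j + 1) + t ≤ finrank ℂ (L ⊓ I.rowBound F t : Submodule ℂ V) + I.x (j + 1) := by
    intro t h1 h2
    have hp := (hpos t).2 ⟨h1, h2⟩
    obtain ⟨p1, p2, p3⟩ := hp
    simp only at p1 p2 p3
    have hz := I.z_le t p2
    rw [rowBound]
    by_cases hs : t ≤ I.s
    · rw [if_pos hs]
      have ha := (I.a_mem t ⟨p1, hs⟩).2
      have hlt := (I.le_z_iff hs (by omega) hz).1 le_rfl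
      have h3 : W (k - I.z t) ≤ ω.orthogonal (F.F (I.a t)) := by
        refine (hbd _ (by omega) (by omega)).trans ?_
        rw [rowBound]
        split_ifs with h4
        · exact F.le_orthogonal (I.a_mem _ ⟨by omega, h4⟩).2 ha
        · have e : k - (k - I.z t) + 1 = I.z t + 1 := by omega
          rw [e]
          have h5 := (I.le_z_iff (j := I.z t + 1) hs (by omega) (by omega)).not.1 (by omega)
          exact F.orthogonal_le (not_lt.1 h5) (I.b_lt _ ⟨by omega, by omega⟩).le
      have h4 := key (I.a t) (k - I.z t) ha (by omega) (by omega) h3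
      have h5 := I.count_le (t := t) (j := j + 1) (j' := I.z t) (M := I.a t) hs h1.le (by omega)
        (by omega) hz (((I.b_mono (by omega) p3 hz)).trans hlt.le)
        (fun i h6 h7 => I.a_mono h6 h7 hs) (fun l h6 h7 => (I.b_mono h6 h7 hz).trans_lt hlt)
      omega
    · rw [if_neg hs]
      have hzt := I.z_of_lt (t := t) (by omega)
      have hbl := (I.b_lt (k - t + 1) ⟨by omega, by omega⟩).le
      have h3 := hbd t (by omega) h2
      rw [rowBound, if_neg hs] at h3
      have h4 := key (I.b (k - t + 1)) t hbl (by omega) h2 h3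
      have h5 := finrank_inf_eq_of_nondegenerate hω hω'.isRefl L (ω.orthogonal (F.F (I.b (k - t + 1))))
      rw [LinearMap.BilinForm.orthogonal_orthogonal hω hω'.isRefl, hL1.orthogonal_eq hω hV hL2] at h5
      have h6 := Submodule.finrank_sup_add_finrank_inf_eq L (F.F (I.b (k - t + 1)))
      rw [F.finrank_eq _ hbl, hL2] at h6
      have h7 := I.count_le (j := j + 1) (j' := k - I.s) (M := m) le_rfl hxs (by omega) (by omega)
        le_rfl hb (fun i h5 h6 => (I.a_mem i ⟨h5, h6⟩).2) (fun l h5 h6 => I.b_lt l ⟨h5, h6⟩)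
      omega
  obtain ⟨W', hW'⟩ := exists_chain_between (S := S) (U := fun t => L ⊓ I.rowBound F t)
    (d := fun t => I.b (j + 1) + t - I.x (j + 1)) (lo := I.x (j + 1) + 1) (hi := k - j) (by omega)
    (fun t h1 h2 => le_inf ((sup_le_sup_right (hmono' t (by omega) _ h2 le_rfl) _).trans
      le_sup_left) (hSE t h1 h2))
    (fun t h1 h2 => by
      have h3 := hmono t (by omega) h2
      refine ⟨sup_le_sup_right h3 _, ?_⟩
      have h4 := finrank_sup_add_le h3 (F.F (I.b (j + 1)))
      have h5 := hd t (by omega) h2.le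
      have h6 := hd (t + 1) (by omega) h2
      simp only [S]
      omega)
    (fun t h1 h2 => inf_le_inf_left _ (I.rowBound_mono F (by omega) (by omega)))
    (fun t h1 h2 => by
      have h3 := hSd t h1 h2
      have h4 := hU t h1 h2
      omega)
    (fun t h1 h2 => by omega)
  refine ⟨W', fun t ht => ?_⟩
  obtain ⟨h1, h2⟩ := (hpos t).1 ht
  obtain ⟨w1, w2, w3, w4⟩ := hW' t h1 h2
  refine ⟨le_sup_left.trans w1, le_sup_right.trans w1, w2.trans inf_le_right,
    hL1.mono (w2.trans inf_le_left), ?_, fun h => w4 ((hpos _).1 h).2⟩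
  rw [I.dim_of_pos (by omega)]
  exact w3

/-- Every point of the closed rank locus extends to a diagram. -/
theorem exists_isPartial (hω : ω.Nondegenerate) (hω' : ω.IsAlt) (hV : finrank ℂ V = 2 * m)
    (hk : 1 ≤ k) {Λ : Submodule ℂ V} (hΛ : IsIsotropic ω Λ) (hd : finrank ℂ Λ = k)
    (h : ∀ t, 1 ≤ t → t ≤ k → t ≤ finrank ℂ (Λ ⊓ I.rowBound F t : Submodule ℂ V)) :
    ∃ D, I.IsPartial F I.positions D ∧ D (k, 0) = Λ := by
  have step : ∀ J, J ≤ k - I.s → ∃ D : ℕ × ℕ → Submodule ℂ V,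
      I.IsPartial F {p | p ∈ I.positions ∧ p.2 ≤ J} D ∧ D (k, 0) = Λ ∧
      ∀ p ∈ I.positions, p.2 ≤ J → D p ≤ I.rowBound F p.1 := by
    intro J
    induction J with
    | zero =>
      intro _
      obtain ⟨W, hW⟩ := exists_chain_between (S := fun _ => (⊥ : Submodule ℂ V))
        (U := fun t => Λ ⊓ I.rowBound F t) (d := fun t => t) hk (fun _ _ _ => bot_le)
        (fun _ _ _ => ⟨le_rfl, Nat.le_succ _⟩)
        (fun t h1 h2 => inf_le_inf_left _ (I.rowBound_mono F h1 h2))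
        (fun t h1 h2 => ⟨by simp, h t h1 h2⟩) (fun _ _ _ => rfl)
      refine ⟨fun p => W p.1, ⟨?_, ?_, ?_, ?_, ?_, ?_⟩, ?_, ?_⟩
      · rintro ⟨t, j⟩ ⟨⟨h1, h2, -⟩, h3⟩
        obtain rfl : j = 0 := by simpa using h3
        rw [dim_zero]
        exact (hW t h1 h2).2.2.1
      · rintro ⟨t, j⟩ ⟨⟨h1, h2, -⟩, -⟩
        exact hΛ.mono ((hW t h1 h2).2.1.trans inf_le_left)
      · rintro t j - ⟨-, h3⟩
        simp at h3
      · rintro t j ⟨⟨h1, h2, -⟩, -⟩ ⟨⟨h3, h4, -⟩, -⟩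
        exact (hW t h1 h2).2.2.2 h4
      · rintro t j ⟨-, h3⟩ hj
        simp only at h3
        omega
      · rintro t ⟨⟨h1, h2, -⟩, -⟩
        exact (hW t h1 h2).2.1.trans inf_le_right
      · obtain ⟨-, w2, w3, -⟩ := hW k hk le_rfl
        exact Submodule.eq_of_le_of_finrank_eq (w2.trans inf_le_left) (w3.trans hd.symm)
      · rintro ⟨t, j⟩ ⟨h1, h2, -⟩ -
        exact (hW t h1 h2).2.1.trans inf_le_right
    | succ j ih =>
      intro hj
      obtain ⟨D, hD, hDΛ, hDE⟩ := ih (by omega)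
      have hX : ∃ B X, X ≤ I.x (j + 1) ∧ I.x (j + 1) + B ≤ X + I.b (j + 1) ∧
          (∀ t, X < t → t ≤ k - j → (t, j) ∈ I.positions ∧ I.dim (t, j) + X = B + t) ∧
          ∀ t, X < t → t ≤ k - j → F.F B ≤ D (t, j) := by
        rcases j with _ | j
        · refine ⟨0, 0, Nat.zero_le _, ?_, fun t h1 h2 => ⟨⟨h1, h2, Nat.zero_le _⟩, ?_⟩,
            fun t h1 h2 => ?_⟩
          · have := I.x_le_b (0 + 1)
            omega
          · rw [dim_zero]
            omega
          · rw [Submodule.finrank_eq_zero.1 (F.finrank_eq 0 (Nat.zero_le m))]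
            exact bot_le
        · have h0 : 1 ≤ j + 1 := Nat.le_add_left 1 j
          have hp : ∀ t, I.x (j + 1) < t → t ≤ k - (j + 1) → (t, j + 1) ∈ I.positions :=
            fun t h1 h2 => (I.mem_positions_succ_iff (by omega)).2 ⟨h1, by omega⟩
          refine ⟨I.b (j + 1), I.x (j + 1), I.x_mono h0 (Nat.le_succ _) hj,
            I.x_add_b_le h0 (Nat.le_succ _) hj, fun t h1 h2 => ⟨hp t h1 h2, ?_⟩, fun t h1 h2 => ?_⟩
          · rw [I.dim_of_pos h0]
            have := I.x_le_b (j + 1)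
            omega
          · exact hD.flag_le _ _ ⟨hp t h1 h2, le_rfl⟩ h0
      obtain ⟨B, X, hX1, hX2, hX3, hX4⟩ := hX
      obtain ⟨W', hW'⟩ := exists_next_column hω hω' hV hj (W := fun t => D (t, j)) (F := F) hX1 hX2
        (fun t h1 h2 => by
          rw [hD.finrank_eq _ ⟨(hX3 t h1 h2).1, le_rfl⟩]
          exact (hX3 t h1 h2).2)
        (fun t h1 h2 => hD.isotropic _ ⟨(hX3 t h1 h2).1, le_rfl⟩)
        (fun t h1 h2 => hD.col _ _ ⟨(hX3 t h1 h2.le).1, le_rfl⟩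
          ⟨(hX3 (t + 1) (by omega) h2).1, le_rfl⟩)
        (fun t h1 h2 => hDE _ (hX3 t h1 h2).1 le_rfl) hX4
      let D' : ℕ × ℕ → Submodule ℂ V := fun p => if p.2 = j + 1 then W' p.1 else D p
      have e1 : ∀ t, D' (t, j + 1) = W' t := fun t => if_pos rfl
      have e2 : ∀ p : ℕ × ℕ, p.2 ≤ j → D' p = D p := fun p hp => if_neg (by omega)
      have hE : ∀ p ∈ I.positions, p.2 ≤ j + 1 → D' p ≤ I.rowBound F p.1 := by
        rintro ⟨t, l⟩ hp hl
        simp only at hl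
        rcases hl.eq_or_lt with rfl | hl
        · rw [e1]
          exact (hW' t hp).2.2.1
        · rw [e2 _ (by simp only; omega)]
          exact hDE _ hp (by simp only; omega)
      refine ⟨D', ⟨?_, ?_, ?_, ?_, ?_, ?_⟩, (e2 _ (Nat.zero_le j)).trans hDΛ, hE⟩
      · rintro ⟨t, l⟩ ⟨hp, hl⟩
        simp only at hl
        rcases hl.eq_or_lt with rfl | hl
        · rw [e1]
          exact (hW' t hp).2.2.2.2.1
        · rw [e2 _ (by simp only; omega)]
          exact hD.finrank_eq _ ⟨hp, by simp only; omega⟩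
      · rintro ⟨t, l⟩ ⟨hp, hl⟩
        simp only at hl
        rcases hl.eq_or_lt with rfl | hl
        · rw [e1]
          exact (hW' t hp).2.2.2.1
        · rw [e2 _ (by simp only; omega)]
          exact hD.isotropic _ ⟨hp, by simp only; omega⟩
      · rintro t l ⟨hp, -⟩ ⟨hq, hl⟩
        simp only at hl
        rcases hl.eq_or_lt with e | hl
        · obtain rfl : l = j := by omega
          rw [e1, e2 _ le_rfl]
          exact (hW' t hq).1
        · rw [e2 _ (by simp only; omega), e2 _ (by simp only; omega)]
          exact hD.row _ _ ⟨hp, by simp only; omega⟩ ⟨hq, by simp only; omega⟩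
      · rintro t l ⟨hp, hl⟩ ⟨hq, -⟩
        simp only at hl
        rcases hl.eq_or_lt with rfl | hl
        · rw [e1, e1]
          exact (hW' t hp).2.2.2.2.2 hq
        · rw [e2 _ (by simp only; omega), e2 _ (by simp only; omega)]
          exact hD.col _ _ ⟨hp, by simp only; omega⟩ ⟨hq, by simp only; omega⟩
      · rintro t l ⟨hp, hl⟩ h1
        simp only at hl
        rcases hl.eq_or_lt with rfl | hl
        · rw [e1]
          exact (hW' t hp).2.1
        · rw [e2 _ (by simp only; omega)]
          exact hD.flag_le _ _ ⟨hp, by simp only; omega⟩ h1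
      · rintro t ⟨hp, hl⟩
        exact hE _ hp hl
  obtain ⟨D, hD, hDΛ, -⟩ := step (k - I.s) le_rfl
  exact ⟨D, hD.mono fun p hp => ⟨hp, hp.2.2.trans (I.z_le _ hp.2.1)⟩, hDΛ⟩

end SchubertIndex

/-! ### Symplectic bases adapted to a flag -/

section Dual

variable {V : Type u} [AddCommGroup V] [Module ℂ V] {ω : LinearMap.BilinForm ℂ V}
variable {s : Finset ℕ} {g h : ℕ → V}

theorem linearIndependent_of_dual (hgh : ∀ t ∈ s, ∀ t' ∈ s, ω (h t) (g t') = if t = t' then 1 else 0)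
    {A : Finset ℕ} (hA : A ⊆ s) : LinearIndependent ℂ (fun t : A => g t) := by
  rw [Fintype.linearIndependent_iff]
  intro c hc i
  have h1 := congrArg (ω (h i)) hc
  rw [map_sum, map_zero, Finset.sum_eq_single i] at h1
  · simpa [hgh i (hA i.2) i (hA i.2)] using h1
  · intro j _ hj
    rw [map_smul, hgh i (hA i.2) j (hA j.2), if_neg (fun e => hj (Subtype.ext e.symm)), smul_zero]
  · exact fun h => absurd (Finset.mem_univ i) h

theorem finrank_span_of_dual
    (hgh : ∀ t ∈ s, ∀ t' ∈ s, ω (h t) (g t') = if t = t' then 1 else 0)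
    {A : Finset ℕ} (hA : A ⊆ s) : finrank ℂ (Submodule.span ℂ (g '' A)) = A.card := by
  rw [Set.image_eq_range]
  exact (finrank_span_eq_card (linearIndependent_of_dual hgh hA)).trans (Fintype.card_coe A)

theorem finrank_span_inf_le_of_dual [FiniteDimensional ℂ V]
    (hgh : ∀ t ∈ s, ∀ t' ∈ s, ω (h t) (g t') = if t = t' then 1 else 0)
    {A : Finset ℕ} (hA : A ⊆ s) {N : Submodule ℂ V}
    (hN : ∀ t ∈ s, t ∉ A → ∀ v ∈ N, ω (h t) v = 0) :
    finrank ℂ (Submodule.span ℂ (g '' s) ⊓ N : Submodule ℂ V) ≤ A.card := by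
  rw [← finrank_span_of_dual hgh hA]
  refine Submodule.finrank_mono ?_
  rintro v ⟨hv, hvN⟩
  rw [SetLike.mem_coe, Submodule.mem_span_image_finset_iff_exists_fun] at hv
  obtain ⟨c, rfl⟩ := hv
  refine Submodule.sum_mem _ fun t _ => ?_
  by_cases ht : t.1 ∈ A
  · exact Submodule.smul_mem _ _ (Submodule.subset_span ⟨t, ht, rfl⟩)
  · have h1 := hN t t.2 ht _ hvN
    rw [map_sum, Finset.sum_eq_single t] at h1
    · have h2 : c t = 0 := by simpa [hgh t t.2 t t.2] using h1
      rw [h2, zero_smul]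
      exact Submodule.zero_mem _
    · intro j _ hj
      rw [map_smul, hgh t t.2 j j.2, if_neg (fun e => hj (Subtype.ext e.symm)), smul_zero]
    · exact fun h => absurd (Finset.mem_univ t) h

end Dual

theorem IsotropicFlag.exists_symplectic {V : Type u} [AddCommGroup V] [Module ℂ V]
    [FiniteDimensional ℂ V] {ω : LinearMap.BilinForm ℂ V} {m : ℕ} (hω : ω.Nondegenerate)
    (hω' : ω.IsAlt) (F : IsotropicFlag ω m) : ∃ e f : ℕ → V,
      (∀ l < m, e l ∈ F.F (l + 1)) ∧
      (∀ l < m, ∀ l' < m, ω (f l) (e l') = if l = l' then 1 else 0) ∧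
      (∀ l < m, ∀ l' < m, ω (f l) (f l') = 0) ∧
      ∀ i l, i ≤ l → l < m → ∀ v ∈ F.F i, ω (f l) v = 0 := by
  have he : ∀ l, ∃ e : V, l < m → e ∈ F.F (l + 1) ∧ e ∉ F.F l := by
    intro l
    by_cases hl : l < m
    · by_contra! h
      have h1 : F.F (l + 1) ≤ F.F l := fun v hv => (h v).2 hv
      have h2 := Submodule.finrank_mono h1
      rw [F.finrank_eq _ hl, F.finrank_eq _ hl.le] at h2
      omega
    · exact ⟨0, fun h => absurd h hl⟩
  choose e he using he
  have hspan : ∀ n ≤ m, Submodule.span ℂ (Set.range fun i : Fin n => e i) ≤ F.F n := by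
    intro n hn
    rw [Submodule.span_le]
    rintro _ ⟨i, rfl⟩
    exact F.mono _ _ i.2 hn (he i (by omega)).1
  have hli : ∀ n ≤ m, LinearIndependent ℂ (fun i : Fin n => e i) := by
    intro n
    induction n with
    | zero => exact fun _ => linearIndependent_empty_type
    | succ n ih =>
      intro hn
      rw [linearIndependent_finSucc']
      exact ⟨ih (by omega), fun h => (he n hn).2 (hspan n (by omega) h)⟩
  have hF : ∀ n ≤ m, Submodule.span ℂ (Set.range fun i : Fin n => e i) = F.F n := fun n hn =>
    Submodule.eq_of_le_of_finrank_eq (hspan n hn) (by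
      rw [finrank_span_eq_card (hli n hn), Fintype.card_fin, F.finrank_eq n hn])
  obtain ⟨p, hp⟩ := FSpace.exists_leftInverse_frame (hli m le_rfl)
  have hf : ∀ l, ∃ f : V, l < m → ∀ l' < m, ω f (e l') = if l = l' then 1 else 0 := by
    intro l
    by_cases hl : l < m
    · refine ⟨(ω.toDual hω).symm (LinearMap.proj ⟨l, hl⟩ ∘ₗ p), fun _ l' hl' => ?_⟩
      rw [LinearMap.BilinForm.apply_toDual_symm_apply]
      have h1 := congrFun (hp ⟨l', hl'⟩) ⟨l, hl⟩
      refine h1.trans ?_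
      simp [Pi.single_apply]
    · exact ⟨0, fun h => absurd h hl⟩
  choose f hf using hf
  have hee : ∀ l < m, ∀ l' < m, ω (e l) (e l') = 0 := fun l hl l' hl' =>
    F.isotropic m le_rfl _ (F.mono _ _ hl le_rfl (he l hl).1) _
      (F.mono _ _ hl' le_rfl (he l' hl').1)
  have hef : ∀ l < m, ∀ l' < m, ω (e l) (f l') = if l = l' then -1 else 0 := by
    intro l hl l' hl'
    rw [← LinearMap.BilinForm.IsAlt.neg_eq hω', hf l' hl' l hl]
    by_cases h : l = l'
    · simp [h]
    · simp [h, Ne.symm h]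
  let f' : ℕ → V := fun l => f l + ∑ i ∈ Finset.range m, (ω (f l) (f i) / 2) • e i
  have hf' : ∀ l < m, ∀ l' < m, ω (f' l) (e l') = if l = l' then 1 else 0 := by
    intro l hl l' hl'
    simp only [f', map_add, map_sum, map_smul, LinearMap.add_apply, LinearMap.sum_apply,
      LinearMap.smul_apply, hf l hl l' hl']
    rw [Finset.sum_eq_zero, add_zero]
    intro i hi
    rw [hee i (Finset.mem_range.1 hi) l' hl', smul_zero]
  refine ⟨e, f', fun l hl => (he l hl).1, hf', fun l hl l' hl' => ?_, fun i l hil hl v hv => ?_⟩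
  · have h1 : ω (f' l) (f' l') = ω (f' l) (f l') +
        ∑ i ∈ Finset.range m, (ω (f l') (f i) / 2) * ω (f' l) (e i) := by
      simp only [f']
      rw [map_add (ω _) (f l'), map_sum]
      simp only [map_smul, smul_eq_mul]
    have h2 : ∑ i ∈ Finset.range m, (ω (f l') (f i) / 2) * ω (f' l) (e i) = ω (f l') (f l) / 2 := by
      rw [Finset.sum_eq_single l]
      · rw [hf' l hl l hl, if_pos rfl, mul_one]
      · intro i hi hil
        rw [hf' l hl i (Finset.mem_range.1 hi), if_neg (Ne.symm hil), mul_zero]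
      · exact fun h => absurd (Finset.mem_range.2 hl) h
    have h3 : ω (f' l) (f l') = ω (f l) (f l') +
        ∑ i ∈ Finset.range m, (ω (f l) (f i) / 2) * ω (e i) (f l') := by
      simp only [f', map_add, map_sum, map_smul, LinearMap.add_apply, LinearMap.sum_apply,
        LinearMap.smul_apply, smul_eq_mul]
    have h4 : ∑ i ∈ Finset.range m, (ω (f l) (f i) / 2) * ω (e i) (f l') =
        -(ω (f l) (f l') / 2) := by
      rw [Finset.sum_eq_single l']
      · rw [hef l' hl' l' hl', if_pos rfl, mul_neg, mul_one]
      · intro i hi hil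
        rw [hef i (Finset.mem_range.1 hi) l' hl', if_neg hil, mul_zero]
      · exact fun h => absurd (Finset.mem_range.2 hl') h
    rw [h1, h2, h3, h4, ← LinearMap.BilinForm.IsAlt.neg_eq hω' (f l) (f l')]
    ring
  · rw [← hF i (by omega)] at hv
    induction hv using Submodule.span_induction with
    | mem v hv =>
      obtain ⟨j, rfl⟩ := hv
      have := j.2
      rw [hf' l hl j (by omega), if_neg (by omega)]
    | zero => exact map_zero _
    | add x y _ _ hx hy => rw [map_add, hx, hy, add_zero]
    | smul c x _ hx => rw [map_smul, hx, smul_zero]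

namespace SchubertIndex

variable {k m : ℕ} (I : SchubertIndex k m)
variable {V : Type u} [AddCommGroup V] [Module ℂ V] {ω : LinearMap.BilinForm ℂ V}
variable (F : IsotropicFlag ω m)

/-! ### Rank conditions -/

/-- The subspaces satisfying the rank conditions of the Schubert cell. -/
def InCell (N : Submodule ℂ V) : Prop := ∀ i ≤ m,
  finrank ℂ (N ⊓ F.F i : Submodule ℂ V) =
    ((Finset.Icc 1 I.s).filter (fun l => I.a l ≤ i)).card ∧
  finrank ℂ (N ⊓ ω.orthogonal (F.F i) : Submodule ℂ V) =
    I.s + ((Finset.Icc 1 (k - I.s)).filter (fun j => i ≤ I.b j)).card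

/-- The subspaces satisfying the closed rank conditions of the Schubert variety. -/
def RankGE (N : Submodule ℂ V) : Prop :=
  ∀ t, 1 ≤ t → t ≤ k → t ≤ finrank ℂ (N ⊓ I.rowBound F t : Submodule ℂ V)

variable {I F}

theorem card_filter_a {t : ℕ} (h1 : 1 ≤ t) (h2 : t ≤ I.s) :
    ((Finset.Icc 1 I.s).filter (fun l => I.a l ≤ I.a t)).card = t := by
  have : (Finset.Icc 1 I.s).filter (fun l => I.a l ≤ I.a t) = Finset.Icc 1 t := by
    ext l
    simp only [Finset.mem_filter, Finset.mem_Icc]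
    constructor
    · rintro ⟨⟨h3, h4⟩, h5⟩
      exact ⟨h3, (I.a_strictMono.le_iff_le ⟨h3, h4⟩ ⟨h1, h2⟩).1 h5⟩
    · rintro ⟨h3, h4⟩
      exact ⟨⟨h3, h4.trans h2⟩, I.a_mono h3 h4 h2⟩
  rw [this, Nat.card_Icc, Nat.add_sub_cancel]

theorem card_filter_b {j : ℕ} (h1 : 1 ≤ j) (h2 : j ≤ k - I.s) :
    I.s + ((Finset.Icc 1 (k - I.s)).filter (fun l => I.b j ≤ I.b l)).card = k - j + 1 := by
  have : (Finset.Icc 1 (k - I.s)).filter (fun l => I.b j ≤ I.b l) = Finset.Icc j (k - I.s) := by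
    ext l
    simp only [Finset.mem_filter, Finset.mem_Icc]
    constructor
    · rintro ⟨⟨h3, h4⟩, h5⟩
      exact ⟨(I.b_strictMono.le_iff_le ⟨h1, h2⟩ ⟨h3, h4⟩).1 h5, h4⟩
    · rintro ⟨h3, h4⟩
      exact ⟨⟨h1.trans h3, h4⟩, I.b_mono h1 h3 h4⟩
  rw [this, Nat.card_Icc]
  have := I.s_le
  omega

theorem InCell.finrank_inf_rowBound {N : Submodule ℂ V} (h : I.InCell F N) {t : ℕ} (h1 : 1 ≤ t)
    (h2 : t ≤ k) : finrank ℂ (N ⊓ I.rowBound F t : Submodule ℂ V) = t := by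
  rw [rowBound]
  by_cases hs : t ≤ I.s
  · rw [if_pos hs, (h _ (I.a_mem t ⟨h1, hs⟩).2).1, card_filter_a h1 hs]
  · rw [if_neg hs, (h _ (I.b_lt (k - t + 1) ⟨by omega, by omega⟩).le).2,
      card_filter_b (by omega) (by omega)]
    omega

theorem InCell.rankGE {N : Submodule ℂ V} (h : I.InCell F N) : I.RankGE F N :=
  fun _ h1 h2 => (h.finrank_inf_rowBound h1 h2).ge

theorem RankGE.inCell [FiniteDimensional ℂ V] {N : Submodule ℂ V} (h : I.RankGE F N)
    (h' : ∀ i ≤ m, finrank ℂ (N ⊓ F.F i : Submodule ℂ V) ≤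
      ((Finset.Icc 1 I.s).filter (fun l => I.a l ≤ i)).card ∧
      finrank ℂ (N ⊓ ω.orthogonal (F.F i) : Submodule ℂ V) ≤
      I.s + ((Finset.Icc 1 (k - I.s)).filter (fun j => i ≤ I.b j)).card) : I.InCell F N := by
  intro i hi
  have hsk := I.s_le
  refine ⟨le_antisymm (h' i hi).1 ?_, le_antisymm (h' i hi).2 ?_⟩
  · set c := ((Finset.Icc 1 I.s).filter (fun l => I.a l ≤ i)).card with hc
    have hcs : c ≤ I.s := card_filter_Icc_le _ _
    rcases Nat.eq_zero_or_pos c with h0 | h0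
    · omega
    have h1 : I.a c ≤ i := (le_card_filter_Icc_iff (p := fun l => I.a l ≤ i)
      (fun _ _ h3 h4 h5 h6 => (I.a_mono h3 h4 h5).trans h6) h0 hcs).1 le_rfl
    have h2 := h c h0 (hcs.trans hsk)
    rw [rowBound, if_pos hcs] at h2
    exact h2.trans (Submodule.finrank_mono (inf_le_inf_left _ (F.mono _ _ h1 hi)))
  · have hbase : I.s ≤ finrank ℂ (N ⊓ ω.orthogonal (F.F i) : Submodule ℂ V) := by
      rcases Nat.eq_zero_or_pos I.s with h0 | h0
      · omega
      have h2 := h I.s h0 hsk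
      rw [rowBound, if_pos le_rfl] at h2
      exact h2.trans (Submodule.finrank_mono (inf_le_inf_left _
        (F.le_orthogonal (I.a_mem _ ⟨h0, le_rfl⟩).2 hi)))
    rcases ((Finset.Icc 1 (k - I.s)).filter (fun j => i ≤ I.b j)).eq_empty_or_nonempty with h0 | h0
    · rwa [h0, Finset.card_empty, add_zero]
    · let j := ((Finset.Icc 1 (k - I.s)).filter (fun j => i ≤ I.b j)).min' h0
      have hj := Finset.min'_mem _ h0
      have hj' : (1 ≤ j ∧ j ≤ k - I.s) ∧ i ≤ I.b j := by
        simpa only [Finset.mem_filter, Finset.mem_Icc] using hj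
      obtain ⟨⟨j1, j2⟩, j3⟩ := hj'
      have hsub : (Finset.Icc 1 (k - I.s)).filter (fun j => i ≤ I.b j) ⊆
          (Finset.Icc 1 (k - I.s)).filter (fun l => I.b j ≤ I.b l) := by
        intro l hl
        have h3 := Finset.min'_le _ l hl
        simp only [Finset.mem_filter, Finset.mem_Icc] at hl ⊢
        exact ⟨hl.1, I.b_mono j1 h3 hl.1.2⟩
      have h4 := Finset.card_le_card hsub
      have h5 := card_filter_b j1 j2
      have h2 := h (k - j + 1) (by omega) (by omega)
      rw [rowBound, if_neg (by omega), show k - (k - j + 1) + 1 = j by omega] at h2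
      have h6 := Submodule.finrank_mono (inf_le_inf_left N
        (F.orthogonal_le j3 (I.b_lt j ⟨j1, j2⟩).le))
      omega

/-- The Schubert cell is not empty. -/
theorem exists_inCell [FiniteDimensional ℂ V] (hω : ω.Nondegenerate) (hω' : ω.IsAlt) :
    ∃ N : Submodule ℂ V, finrank ℂ N = k ∧ IsIsotropic ω N ∧ I.InCell F N := by
  classical
  obtain ⟨e, f, he, hfe, hff, hfF⟩ := F.exists_symplectic hω hω'
  have hsk := I.s_le
  let g : ℕ → V := fun t => if t ≤ I.s then e (I.a t - 1) else f (I.b (k - t + 1))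
  let h : ℕ → V := fun t => if t ≤ I.s then f (I.a t - 1) else -e (I.b (k - t + 1))
  have ha : ∀ t, 1 ≤ t → t ≤ I.s → 1 ≤ I.a t ∧ I.a t ≤ m := fun t h1 h2 => I.a_mem t ⟨h1, h2⟩
  have hb : ∀ t, ¬ t ≤ I.s → t ≤ k → I.b (k - t + 1) < m := fun t h1 h2 =>
    I.b_lt _ ⟨by omega, by omega⟩
  have hab : ∀ t t', 1 ≤ t → t ≤ I.s → ¬ t' ≤ I.s → t' ≤ k → I.a t - 1 ≠ I.b (k - t' + 1) := by
    intro t t' h1 h2 h3 h4 h5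
    have := I.a_ne t ⟨h1, h2⟩ (k - t' + 1) ⟨by omega, by omega⟩
    have := ha t h1 h2
    omega
  have hee : ∀ l < m, ∀ l' < m, ω (e l) (e l') = 0 := fun l hl l' hl' =>
    F.isotropic m le_rfl _ (F.mono _ _ hl le_rfl (he l hl)) _
      (F.mono _ _ hl' le_rfl (he l' hl'))
  have hef : ∀ l < m, ∀ l' < m, ω (e l) (f l') = -if l' = l then 1 else 0 := by
    intro l hl l' hl'
    rw [← LinearMap.BilinForm.IsAlt.neg_eq hω', hfe l' hl' l hl]
  have hmem : ∀ t ∈ Finset.Icc 1 k, 1 ≤ t ∧ t ≤ k := fun t ht => Finset.mem_Icc.1 ht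
  have hgh : ∀ t ∈ Finset.Icc 1 k, ∀ t' ∈ Finset.Icc 1 k,
      ω (h t) (g t') = if t = t' then 1 else 0 := by
    intro t ht t' ht'
    obtain ⟨h1, h2⟩ := hmem t ht
    obtain ⟨h3, h4⟩ := hmem t' ht'
    simp only [g, h]
    split_ifs with c1 c2 c3 c3 c2 c3 c3
    · have := ha t h1 c1
      rw [c3, hfe _ (by rw [← c3]; omega) _ (by rw [← c3]; omega), if_pos rfl]
    · have h5 := ha t h1 c1
      have h6 := ha t' h3 c2
      rw [hfe _ (by omega) _ (by omega), if_neg]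
      intro h7
      exact c3 (I.a_strictMono.injOn ⟨h1, c1⟩ ⟨h3, c2⟩ (by omega))
    · omega
    · have := ha t h1 c1
      exact hff _ (by omega) _ (hb t' c2 h4)
    · omega
    · have := ha t' h3 c2
      rw [map_neg, LinearMap.neg_apply, hee _ (hb t c1 h2) _ (by omega), neg_zero]
    · rw [map_neg, LinearMap.neg_apply, hef _ (hb t c1 h2) _ (hb t' c2 h4), neg_neg, c3, if_pos rfl]
    · rw [map_neg, LinearMap.neg_apply, hef _ (hb t c1 h2) _ (hb t' c2 h4), neg_neg, if_neg]
      intro h7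
      have := I.b_strictMono.injOn (x₁ := k - t' + 1) (x₂ := k - t + 1) ⟨by omega, by omega⟩
        ⟨by omega, by omega⟩ h7
      omega
  have hgg : ∀ t ∈ Finset.Icc 1 k, ∀ t' ∈ Finset.Icc 1 k, ω (g t) (g t') = 0 := by
    intro t ht t' ht'
    obtain ⟨h1, h2⟩ := hmem t ht
    obtain ⟨h3, h4⟩ := hmem t' ht'
    simp only [g]
    split_ifs with c1 c2 c2
    · have := ha t h1 c1
      have := ha t' h3 c2
      exact hee _ (by omega) _ (by omega)
    · have := ha t h1 c1
      rw [hef _ (by omega) _ (hb t' c2 h4), if_neg (hab t t' h1 c1 c2 h4).symm, neg_zero]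
    · have := ha t' h3 c2
      rw [hfe _ (hb t c1 h2) _ (by omega), if_neg (hab t' t h3 c2 c1 h2).symm]
    · exact hff _ (hb t c1 h2) _ (hb t' c2 h4)
  have hgE : ∀ t, 1 ≤ t → t ≤ k → g t ∈ I.rowBound F t := by
    intro t h1 h2
    simp only [g, rowBound]
    split_ifs with c1
    · have h3 := ha t h1 c1
      have := he (I.a t - 1) (by omega)
      rwa [Nat.sub_add_cancel h3.1] at this
    · refine LinearMap.BilinForm.mem_orthogonal_iff.2 fun w hw => ?_
      exact hω'.isRefl _ _ (hfF _ _ le_rfl (hb t c1 h2) w hw)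
  have hEmono : ∀ t, 1 ≤ t → ∀ t', t ≤ t' → t' ≤ k → I.rowBound F t ≤ I.rowBound F t' := by
    intro t h1 t' htt'
    induction t', htt' using Nat.le_induction with
    | base => exact fun _ => le_rfl
    | succ t' h2 ih => exact fun h3 => (ih (by omega)).trans (I.rowBound_mono F (by omega) h3)
  have hge : I.RankGE F (Submodule.span ℂ (g '' Finset.Icc 1 k)) := by
    intro t h1 h2
    have h3 := finrank_span_of_dual hgh (Finset.Icc_subset_Icc_right h2 : Finset.Icc 1 t ⊆ _)
    rw [Nat.card_Icc, Nat.add_sub_cancel] at h3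
    refine h3.ge.trans (Submodule.finrank_mono (le_inf ?_ ?_))
    · exact Submodule.span_mono (Set.image_mono (by
        rw [Finset.coe_subset]
        exact Finset.Icc_subset_Icc_right h2))
    · rw [Submodule.span_le]
      rintro _ ⟨t', ht', rfl⟩
      obtain ⟨h4, h5⟩ := Finset.mem_Icc.1 ht'
      exact hEmono t' h4 t h5 h2 (hgE t' h4 (by omega))
  refine ⟨Submodule.span ℂ (g '' Finset.Icc 1 k), ?_, ?_, hge.inCell fun i hi => ⟨?_, ?_⟩⟩
  · rw [finrank_span_of_dual hgh subset_rfl, Nat.card_Icc, Nat.add_sub_cancel]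
  · rw [Set.image_eq_range]
    exact FSpace.isIsotropic_span fun t t' => hgg t t.2 t' t'.2
  · refine finrank_span_inf_le_of_dual hgh (fun t ht => ?_) (fun t ht htA v hv => ?_)
    · simp only [Finset.mem_filter, Finset.mem_Icc] at ht ⊢
      omega
    · obtain ⟨h1, h2⟩ := hmem t ht
      simp only [h]
      split_ifs with c1
      · have h3 := ha t h1 c1
        have h4 : ¬ I.a t ≤ i := fun h4 =>
          htA (Finset.mem_filter.2 ⟨Finset.mem_Icc.2 ⟨h1, c1⟩, h4⟩)
        exact hfF i _ (by omega) (by omega) v hv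
      · rw [map_neg, LinearMap.neg_apply, neg_eq_zero]
        have h3 := hb t c1 h2
        exact F.isotropic m le_rfl _ (F.mono _ _ h3 le_rfl (he _ h3)) _ (F.mono _ _ hi le_rfl hv)
  · refine (finrank_span_inf_le_of_dual hgh (A := Finset.Icc 1 I.s ∪
      ((Finset.Icc 1 (k - I.s)).filter (fun j => i ≤ I.b j)).image (fun j => k - j + 1))
      (fun t ht => ?_) (fun t ht htA v hv => ?_)).trans ?_
    · rw [Finset.mem_Icc]
      rcases Finset.mem_union.1 ht with ht | ht
      · have := Finset.mem_Icc.1 ht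
        omega
      · obtain ⟨j, hj, rfl⟩ := Finset.mem_image.1 ht
        have := Finset.mem_Icc.1 (Finset.mem_filter.1 hj).1
        omega
    · obtain ⟨h1, h2⟩ := hmem t ht
      rw [Finset.mem_union, not_or] at htA
      have c1 : ¬ t ≤ I.s := fun c1 => htA.1 (Finset.mem_Icc.2 ⟨h1, c1⟩)
      have h3 := hb t c1 h2
      have h4 : ¬ i ≤ I.b (k - t + 1) := fun h4 => htA.2 (Finset.mem_image.2
        ⟨k - t + 1, Finset.mem_filter.2 ⟨Finset.mem_Icc.2 ⟨by omega, by omega⟩, h4⟩, by omega⟩)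
      simp only [h]
      rw [if_neg c1, map_neg, LinearMap.neg_apply, neg_eq_zero]
      exact LinearMap.BilinForm.mem_orthogonal_iff.1 hv _ (F.mono _ _ (by omega) hi (he _ h3))
    · refine (Finset.card_union_le _ _).trans ?_
      rw [Nat.card_Icc, Nat.add_sub_cancel]
      exact Nat.add_le_add_left Finset.card_image_le _

end SchubertIndex

namespace SchubertIndex

attribute [local instance] FSpace.top
open Filter FSpace

variable {k m : ℕ} {I : SchubertIndex k m}
variable {V : Type u} [AddCommGroup V] [Module ℂ V] {ω : LinearMap.BilinForm ℂ V}
variable {F : IsotropicFlag ω m} {D : ℕ × ℕ → Submodule ℂ V}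

/-! ### The Schubert variety and the projection from the variety of diagrams -/

theorem schubertCell_subset_schubertLocus : I.schubertCell F ⊆ I.schubertLocus F := by
  intro Λ h
  refine ⟨fun i hi => ?_, fun j hj => ?_⟩
  · rw [(h _ (I.a_mem i hi).2).1, card_filter_a hi.1 hi.2]
  · rw [(h _ (I.b_lt j hj).le).2, card_filter_b hj.1 hj.2]

theorem rankGE_of_mem_schubertLocus {Λ : sg k ω} (h : Λ ∈ I.schubertLocus F) :
    I.RankGE F Λ.1.1 := by
  intro t h1 h2
  rw [rowBound]
  by_cases hs : t ≤ I.s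
  · rw [if_pos hs, h.1 t ⟨h1, hs⟩]
  · rw [if_neg hs, h.2 (k - t + 1) ⟨by omega, by omega⟩]
    omega

theorem IsPartial.row_le (h : I.IsPartial F I.positions D) {t j l : ℕ} (hjl : j ≤ l)
    (hp : (t, l) ∈ I.positions) : D (t, j) ≤ D (t, l) := by
  induction l, hjl using Nat.le_induction with
  | base => exact le_rfl
  | succ l hl ih =>
    have hp' : (t, l) ∈ I.positions := ⟨hp.1, hp.2.1, (Nat.le_succ l).trans hp.2.2⟩
    exact (ih hp').trans (h.row t l hp' hp)

theorem IsPartial.le_rowBound_of_mem (h : I.IsPartial F I.positions D) {t j : ℕ}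
    (hp : (t, j) ∈ I.positions) : D (t, j) ≤ I.rowBound F t :=
  (h.row_le hp.2.2 ⟨hp.1, hp.2.1, le_rfl⟩).trans (h.le_rowBound t ⟨hp.1, hp.2.1, le_rfl⟩)

theorem IsPartial.le_last (h : I.IsPartial F I.positions D) {t l : ℕ} (h1 : 1 ≤ t) (htl : t ≤ l)
    (hl : l ≤ k) : D (t, 0) ≤ D (l, 0) := by
  induction l, htl using Nat.le_induction with
  | base => exact le_rfl
  | succ l htl ih =>
    exact (ih (by omega)).trans (h.col l 0 ⟨h1.trans htl, by omega, Nat.zero_le _⟩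
      ⟨by simp, hl, Nat.zero_le _⟩)

theorem morphAt_sg {Z : FSpace.{w}} (hZ : Z.IsLocal) {f : Z → sg k ω} {z : Z}
    (h : RegSub Z k (fun y => (f y).1.1) z) : MorphAt f z :=
  morphAt_restrict hZ (morphAt_gr hZ h)

theorem Gamma.isPartial (D : I.Gamma F) : I.IsPartial F I.positions (entries D.1) :=
  (mem_diagrams_iff D.1).1 D.2

theorem entries_last (hk : 1 ≤ k) (D : I.Gamma F) :
    entries D.1 (k, 0) = (I.lastEntry hk F D).1.1 := entries_of_mem _ (I.last_mem hk)

theorem schubertCell_subset_schubertVariety : I.schubertCell F ⊆ I.schubertVariety F :=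
  schubertCell_subset_schubertLocus.trans subset_closure

variable [FiniteDimensional ℂ V]

theorem sg_isLocal : (sg k ω).IsLocal := restrict_isLocal (gr_isLocal k) _

theorem IsPartial.rankGE (h : I.IsPartial F I.positions D) : I.RankGE F (D (k, 0)) := by
  intro t h1 h2
  have hp : (t, 0) ∈ I.positions := ⟨h1, h2, Nat.zero_le _⟩
  refine ((h.finrank_eq _ hp).trans (I.dim_zero t)).ge.trans (Submodule.finrank_mono ?_)
  exact le_inf (h.le_last h1 h2 le_rfl) (h.le_rowBound_of_mem hp)

variable (I F) in
/-- The entries of the diagram over a point of the Schubert cell. -/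
def cellEntry (N : Submodule ℂ V) (q : ℕ × ℕ) : Submodule ℂ V :=
  if q.2 = 0 then N ⊓ I.rowBound F q.1 else N ⊓ I.rowBound F q.1 ⊔ F.F (I.b q.2)

theorem IsPartial.eq_cellEntry (h : I.IsPartial F I.positions D) (hN : I.InCell F (D (k, 0)))
    {q : ℕ × ℕ} (hq : q ∈ I.positions) : D q = I.cellEntry F (D (k, 0)) q := by
  obtain ⟨t, j⟩ := q
  have h0 : (t, 0) ∈ I.positions := ⟨hq.1, hq.2.1, Nat.zero_le _⟩
  have h1 : D (t, 0) = D (k, 0) ⊓ I.rowBound F t := by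
    refine Submodule.eq_of_le_of_finrank_eq
      (le_inf (h.le_last hq.1 hq.2.1 le_rfl) (h.le_rowBound_of_mem h0)) ?_
    rw [hN.finrank_inf_rowBound hq.1 hq.2.1, h.finrank_eq _ h0, dim_zero]
  rw [cellEntry, ← h1]
  by_cases hj : j = 0
  · rw [if_pos hj, hj]
  rw [if_neg hj]
  have hj1 : 1 ≤ j := by omega
  have hb := I.b_lt j ⟨hj1, hq.2.2.trans (I.z_le _ hq.2.1)⟩
  refine (Submodule.eq_of_le_of_finrank_eq
    (sup_le (h.row_le (Nat.zero_le j) hq) (h.flag_le t j hq hj1)) ?_).symm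
  have h2 : D (t, 0) ⊓ F.F (I.b j) = D (k, 0) ⊓ F.F (I.b j) := by
    rw [h1, inf_assoc, inf_eq_right.2 (I.flag_le_rowBound F hq hj1)]
  have h3 := Submodule.finrank_sup_add_finrank_inf_eq (D (t, 0)) (F.F (I.b j))
  have h4 : finrank ℂ (D (k, 0) ⊓ F.F (I.b j) : Submodule ℂ V) = I.x j := (hN _ hb.le).1
  rw [h2, h4, h.finrank_eq _ h0, dim_zero, F.finrank_eq _ hb.le] at h3
  rw [h.finrank_eq _ hq, I.dim_of_pos hj1]
  omega

theorem isClosed_rankGE {X : FSpace.{w}} (hX : X.IsLocal) {d : ℕ} {L : X → Submodule ℂ V}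
    (hL : ∀ x, RegSub X d L x) : IsClosed {x | I.RankGE F (L x)} := by
  refine ⟨isOpen_iff_mem_nhds.2 fun x hx => ?_⟩
  have hx' : ¬ I.RankGE F (L x) := hx
  unfold RankGE at hx'
  push Not at hx'
  obtain ⟨t, h1, h2, h3⟩ := hx'
  filter_upwards [(hL x).eventually_finrank_inf_le hX
    (RegSub.const hX x (N := I.rowBound F t) rfl)] with y hy hy'
  exact absurd (hy' t h1 h2) (by omega)

theorem isOpen_inCell {X : FSpace.{w}} (hX : X.IsLocal) {d : ℕ} {L : X → Submodule ℂ V}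
    (hL : ∀ x, RegSub X d L x) (h : ∀ x, I.RankGE F (L x)) : IsOpen {x | I.InCell F (L x)} := by
  refine isOpen_iff_mem_nhds.2 fun x hx => ?_
  have h1 : ∀ N : ℕ → Submodule ℂ V, ∀ᶠ y in 𝓝 x, ∀ i ∈ Finset.range (m + 1),
      finrank ℂ (L y ⊓ N i : Submodule ℂ V) ≤ finrank ℂ (L x ⊓ N i : Submodule ℂ V) := fun N =>
    (Finset.eventually_all _).2 fun i _ =>
      (hL x).eventually_finrank_inf_le hX (RegSub.const hX x (N := N i) rfl)
  filter_upwards [h1 F.F, h1 fun i => ω.orthogonal (F.F i)] with y h2 h3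
  refine (h y).inCell fun i hi => ?_
  have hi' : i ∈ Finset.range (m + 1) := Finset.mem_range.2 (by omega)
  exact ⟨(h2 i hi').trans (hx i hi).1.le, (h3 i hi').trans (hx i hi).2.le⟩

theorem regSub_sg (Λ : sg k ω) : RegSub (sg k ω) k (fun N => N.1.1) Λ :=
  RegSub.comp (regSub_gr Λ.1) (morphAt_val Λ)

theorem sigma_isLocal : (I.Sigma F).IsLocal := restrict_isLocal sg_isLocal _

theorem regSub_sigma (Λ : I.Sigma F) : RegSub (I.Sigma F) k (fun N => N.1.1.1) Λ :=
  RegSub.comp (Y := I.Sigma F) (X := sg k ω) (L := fun N => N.1.1) (f := fun Λ => Λ.1)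
    (regSub_sg Λ.1) (morphAt_val Λ)

theorem gamma_isLocal : (I.Gamma F).IsLocal := stage_isLocal _

theorem regSub_lastEntry (hk : 1 ≤ k) (D : I.Gamma F) :
    RegSub (I.Gamma F) k (fun D => (I.lastEntry hk F D).1.1) D := by
  have h := (regSub_entries (I.diagrams F) D (I.last_mem hk)).congr
    (Eventually.of_forall fun D' => entries_last hk D')
  exact h

theorem morphAt_lastEntry (hk : 1 ≤ k) (D : I.Gamma F) : MorphAt (I.lastEntry hk F) D :=
  morphAt_sg gamma_isLocal (regSub_lastEntry hk D)

theorem lastEntry_rankGE (hk : 1 ≤ k) (D : I.Gamma F) : I.RankGE F (I.lastEntry hk F D).1.1 :=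
  entries_last hk D ▸ (Gamma.isPartial D).rankGE

theorem exists_lastEntry_eq (hω : ω.Nondegenerate) (hω' : ω.IsAlt) (hV : finrank ℂ V = 2 * m)
    (hk : 1 ≤ k) (Λ : sg k ω) (h : I.RankGE F Λ.1.1) : ∃ D : I.Gamma F, I.lastEntry hk F D = Λ := by
  obtain ⟨D, h1, h2⟩ := exists_isPartial hω hω' hV hk Λ.2 Λ.1.2 h
  refine ⟨⟨I.ofEntries D h1.finrank_eq, ?_⟩, Subtype.ext (Subtype.ext h2)⟩
  rw [mem_diagrams_iff]
  exact h1.congr fun p hp => entries_ofEntries _ hp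

theorem isOpen_preimage_schubertCell (hk : 1 ≤ k) :
    IsOpen {D : I.Gamma F | I.lastEntry hk F D ∈ I.schubertCell F} :=
  isOpen_inCell gamma_isLocal (regSub_lastEntry hk) (lastEntry_rankGE hk)

theorem dense_preimage_schubertCell (hω : ω.Nondegenerate) (hω' : ω.IsAlt)
    (hV : finrank ℂ V = 2 * m) (hk : 1 ≤ k) :
    Dense {D : I.Gamma F | I.lastEntry hk F D ∈ I.schubertCell F} := by
  have : IrreducibleSpace (I.Gamma F) := (gamma_properties hω hω' hV I F).2.1
  refine (isOpen_preimage_schubertCell hk).dense ?_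
  obtain ⟨N, h1, h2, h3⟩ := exists_inCell (I := I) (F := F) hω hω'
  obtain ⟨D, hD⟩ := exists_lastEntry_eq hω hω' hV hk (⟨⟨N, h1⟩, h2⟩ : sg k ω) h3.rankGE
  refine ⟨D, ?_⟩
  change I.lastEntry hk F D ∈ I.schubertCell F
  rw [hD]
  exact h3

theorem lastEntry_mem_closure (hω : ω.Nondegenerate) (hω' : ω.IsAlt)
    (hV : finrank ℂ V = 2 * m) (hk : 1 ≤ k) (D : I.Gamma F) :
    I.lastEntry hk F D ∈ closure (I.schubertCell F) :=
  map_mem_closure (continuous_iff_continuousAt.2 fun D => (morphAt_lastEntry hk D).1)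
    (dense_preimage_schubertCell hω hω' hV hk D) fun _ h => h

theorem lastEntry_mem (hω : ω.Nondegenerate) (hω' : ω.IsAlt)
    (hV : finrank ℂ V = 2 * m) (hk : 1 ≤ k) (D : I.Gamma F) :
    I.lastEntry hk F D ∈ I.schubertVariety F :=
  closure_mono schubertCell_subset_schubertLocus (lastEntry_mem_closure hω hω' hV hk D)

theorem schubertVariety_subset_closure (hω : ω.Nondegenerate) (hω' : ω.IsAlt)
    (hV : finrank ℂ V = 2 * m) (hk : 1 ≤ k) :
    I.schubertVariety F ⊆ closure (I.schubertCell F) := by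
  refine closure_minimal (fun Λ hΛ => ?_) isClosed_closure
  obtain ⟨D, rfl⟩ := exists_lastEntry_eq hω hω' hV hk Λ (rankGE_of_mem_schubertLocus hΛ)
  exact lastEntry_mem_closure hω hω' hV hk D

theorem sigma_rankGE (Λ : I.Sigma F) : I.RankGE F Λ.1.1.1 :=
  closure_minimal (fun _ h => rankGE_of_mem_schubertLocus h)
    (isClosed_rankGE sg_isLocal regSub_sg) Λ.2

theorem isOpen_schubertCell : IsOpen {Λ : I.Sigma F | Λ.1 ∈ I.schubertCell F} :=
  isOpen_inCell sigma_isLocal regSub_sigma sigma_rankGE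

theorem dense_schubertCell (hω : ω.Nondegenerate) (hω' : ω.IsAlt)
    (hV : finrank ℂ V = 2 * m) (hk : 1 ≤ k) :
    Dense {Λ : I.Sigma F | Λ.1 ∈ I.schubertCell F} := by
  refine (Subtype.dense_iff (s := I.schubertVariety F)).2 fun Λ hΛ => ?_
  refine closure_mono ?_ (schubertVariety_subset_closure hω hω' hV hk hΛ)
  exact fun N hN => ⟨⟨N, schubertCell_subset_schubertVariety hN⟩, hN, rfl⟩

end SchubertIndex

namespace SchubertIndex

attribute [local instance] FSpace.top
open Filter FSpace

variable {k m : ℕ} {I : SchubertIndex k m}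
variable {V : Type u} [AddCommGroup V] [Module ℂ V] [FiniteDimensional ℂ V]
variable {ω : LinearMap.BilinForm ℂ V} {F : IsotropicFlag ω m}

/-! ### The resolution -/

theorem isMorphism_projection (hk : 1 ≤ k)
    (h : ∀ D : I.Gamma F, I.lastEntry hk F D ∈ I.schubertVariety F) :
    IsMorphism (X := I.Gamma F) (Y := I.Sigma F) (fun D => ⟨I.lastEntry hk F D, h D⟩) :=
  isMorphism_iff.2 fun D => morphAt_restrict gamma_isLocal (morphAt_lastEntry hk D)

theorem isIsomorphismOver_schubertCell (hω : ω.Nondegenerate) (hω' : ω.IsAlt)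
    (hV : finrank ℂ V = 2 * m) (hk : 1 ≤ k)
    (h : ∀ D : I.Gamma F, I.lastEntry hk F D ∈ I.schubertVariety F) :
    IsIsomorphismOver (X := I.Gamma F) (Y := I.Sigma F)
      (fun D => ⟨I.lastEntry hk F D, h D⟩) {Λ : I.Sigma F | Λ.1 ∈ I.schubertCell F} := by
  set f : I.Gamma F → I.Sigma F := fun D => ⟨I.lastEntry hk F D, h D⟩
  set U : Set (I.Sigma F) := {Λ : I.Sigma F | Λ.1 ∈ I.schubertCell F}
  have hex : ∀ Λ : U, ∃ D : I.Gamma F, I.lastEntry hk F D = Λ.1.1 := fun Λ =>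
    exists_lastEntry_eq hω hω' hV hk Λ.1.1 (sigma_rankGE Λ.1)
  choose g hg using hex
  have hg' : ∀ Λ : U, f (g Λ) = Λ.1 := fun Λ => Subtype.ext (hg Λ)
  have hent : ∀ D : I.Gamma F, f D ∈ U → ∀ q ∈ I.positions,
      entries D.1 q = I.cellEntry F (I.lastEntry hk F D).1.1 q := fun D hD q hq => by
    have h1 : I.InCell F (I.lastEntry hk F D).1.1 := hD
    rw [← entries_last] at h1 ⊢
    exact (Gamma.isPartial D).eq_cellEntry h1 hq
  have hX : ((I.Gamma F).restrict (f ⁻¹' U)).IsLocal := restrict_isLocal gamma_isLocal _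
  have hY : ((I.Sigma F).restrict U).IsLocal := restrict_isLocal sigma_isLocal _
  have hgU : ∀ Λ : U, g Λ ∈ f ⁻¹' U := fun Λ => by
    rw [Set.mem_preimage, hg']
    exact Λ.2
  have hN : ∀ Λ : (I.Sigma F).restrict U,
      RegSub ((I.Sigma F).restrict U) k (fun N => N.1.1.1.1) Λ := fun Λ =>
    RegSub.comp (Y := (I.Sigma F).restrict U) (X := I.Sigma F) (L := fun N => N.1.1.1)
      (f := fun Λ => Λ.1) (regSub_sigma Λ.1) (morphAt_val Λ)
  refine ⟨isMorphism_iff.2 fun D => morphAt_restrict hX ?_, fun Λ => ⟨g Λ, hgU Λ⟩,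
    isMorphism_iff.2 fun Λ => morphAt_restrict hY (morphAt_stage hY fun q hq => ?_), ?_, ?_⟩
  · exact MorphAt.comp (X := (I.Gamma F).restrict (f ⁻¹' U)) (Y := I.Gamma F) (Z := I.Sigma F)
      (g := f) (f := fun D => D.1) (isMorphism_iff.1 (isMorphism_projection hk h) D.1)
      (morphAt_val D)
  · have e : ∀ Λ : (I.Sigma F).restrict U,
        I.cellEntry F Λ.1.1.1.1 q = entries (g Λ).1 q := fun Λ => by
      exact ((hent (g Λ) (hgU Λ) q hq).trans
        (congrArg (fun N : sg k ω => I.cellEntry F N.1.1 q) (hg Λ))).symm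
    have hc : ∀ Λ : (I.Sigma F).restrict U, finrank ℂ (I.cellEntry F Λ.1.1.1.1 q) = I.dim q :=
      fun Λ => by rw [e, (Gamma.isPartial (g Λ)).finrank_eq q hq]
    refine RegSub.congr (L := fun Λ : (I.Sigma F).restrict U => I.cellEntry F Λ.1.1.1.1 q) ?_
      (Eventually.of_forall e)
    have h1 : RegSub ((I.Sigma F).restrict U) q.1
        (fun Λ => Λ.1.1.1.1 ⊓ I.rowBound F q.1) Λ :=
      RegSub.inf hY hω hω'.isRefl (hN Λ) (RegSub.const hY Λ rfl)
        (Eventually.of_forall fun Λ => InCell.finrank_inf_rowBound (I := I) (F := F) Λ.2 hq.1 hq.2.1)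
    by_cases hj : q.2 = 0
    · rw [show I.dim q = q.1 from if_pos hj]
      exact h1.congr (Eventually.of_forall fun _ => (if_pos hj).symm)
    · have e' : ∀ N, N ⊓ I.rowBound F q.1 ⊔ F.F (I.b q.2) = I.cellEntry F N q :=
        fun N => (if_neg hj).symm
      exact (h1.sup hY (RegSub.const hY Λ rfl) (Eventually.of_forall fun Λ =>
        (congrArg (fun N : Submodule ℂ V => finrank ℂ N) (e' _)).trans (hc Λ))).congr
          (Eventually.of_forall fun _ => e' _)
  · intro D
    refine Subtype.ext (Subtype.ext (entries_injective fun q hq => ?_))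
    have hD : f D.1 ∈ U := D.2
    change entries (g ⟨f D.1, hD⟩).1 q = entries D.1.1 q
    rw [hent _ (hgU _) q hq, hg, hent _ hD q hq]
  · exact fun Λ => Subtype.ext (hg' Λ)

theorem isProperMap_projection (hω : ω.Nondegenerate) (hω' : ω.IsAlt)
    (hV : finrank ℂ V = 2 * m) (hk : 1 ≤ k)
    (h : ∀ D : I.Gamma F, I.lastEntry hk F D ∈ I.schubertVariety F) :
    FSpace.IsProperMap (X := I.Gamma F) (Y := I.Sigma F) (fun D => ⟨I.lastEntry hk F D, h D⟩) := by
  refine ⟨isMorphism_projection hk h, fun A _ _ _ C hC => ?_⟩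
  have hA : (spm A).IsLocal := spm_isLocal A
  have hT : ((I.Sigma F).prod (spm A)).IsLocal := prod_isLocal sigma_isLocal hA
  have hP : (((I.Sigma F).prod (spm A)).prod (I.Gamma F)).IsLocal := prod_isLocal hT gamma_isLocal
  have m1 := fun p => morphAt_fst hT (gamma_isLocal (I := I) (F := F)) p
  have m2 := fun p => morphAt_snd hT (gamma_isLocal (I := I) (F := F)) p
  have c1 : IsClosed {p : ((I.Sigma F).prod (spm A)).prod (I.Gamma F) |
      (I.lastEntry hk F p.2).1.1 ≤ p.1.1.1.1.1} :=
    isClosed_le hP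
      (fun p => RegSub.comp (X := I.Gamma F) (Y := ((I.Sigma F).prod (spm A)).prod (I.Gamma F))
        (L := fun D => (I.lastEntry hk F D).1.1)
        (f := fun p => p.2) (regSub_lastEntry hk p.2) (m2 p))
      (fun p => RegSub.comp (X := I.Sigma F) (Y := ((I.Sigma F).prod (spm A)).prod (I.Gamma F))
        (L := fun Λ => Λ.1.1.1)
        (f := fun p => p.1.1) (regSub_sigma p.1.1) ((m1 p).fst sigma_isLocal hA))
  have c2 : IsClosed {p : ((I.Sigma F).prod (spm A)).prod (I.Gamma F) |
      ((p.2, p.1.2) : I.Gamma F × spm A) ∈ C} :=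
    hC.preimage (continuous_iff_continuousAt.2 fun p =>
      (morphAt_prodMk (X := I.Gamma F) (Y := spm A) hP (m2 p) ((m1 p).snd sigma_isLocal hA)).1)
  have key := (gamma_properties hω hω' hV I F).2.2 _ hT _ (c1.inter c2)
  refine (congrArg (IsClosed (X := (I.Sigma F).prod (spm A))) ?_).mp key
  ext ⟨Λ, a⟩
  constructor
  · rintro ⟨D, h1, h2⟩
    refine ⟨(D, a), h2, Prod.ext (Subtype.ext (Subtype.ext (Subtype.ext ?_))) rfl⟩
    exact Submodule.eq_of_le_of_finrank_eq h1 ((I.lastEntry hk F D).1.2.trans Λ.1.1.2.symm)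
  · rintro ⟨⟨D, a'⟩, h1, h2⟩
    obtain ⟨rfl, rfl⟩ := Prod.ext_iff.1 h2
    exact ⟨D, le_refl (I.lastEntry hk F D).1.1, h1⟩

theorem isResolution_projection (hω : ω.Nondegenerate) (hω' : ω.IsAlt)
    (hV : finrank ℂ V = 2 * m) (hk : 1 ≤ k)
    (h : ∀ D : I.Gamma F, I.lastEntry hk F D ∈ I.schubertVariety F) :
    IsResolution (X := I.Gamma F) (Y := I.Sigma F) (fun D => ⟨I.lastEntry hk F D, h D⟩) :=
  ⟨(gamma_properties hω hω' hV I F).1.isSmooth, (gamma_properties hω hω' hV I F).2.1,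
    isMorphism_projection hk h, isProperMap_projection hω hω' hV hk h,
    {Λ : I.Sigma F | Λ.1 ∈ I.schubertCell F}, isOpen_schubertCell,
    dense_schubertCell hω hω' hV hk, dense_preimage_schubertCell hω hω' hV hk,
    isIsomorphismOver_schubertCell hω hω' hV hk h⟩

end SchubertIndex

end SympSchubert

theorem mainTheorem7 {V : Type*} [AddCommGroup V] [Module ℂ V] [FiniteDimensional ℂ V]
    (ω : LinearMap.BilinForm ℂ V) (hω : ω.Nondegenerate) (hω' : ω.IsAlt)
    (m : ℕ) (hV : finrank ℂ V = 2 * m) (k : ℕ) (hk : 1 ≤ k)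
    (I : SchubertIndex k m) (F : IsotropicFlag ω m) :
    -- `Γ` is a closed subvariety of a product of Grassmannians, smooth and irreducible
    IsClosed[(I.ambient V I.positions).top] (I.diagrams F) ∧
    (I.Gamma F).IsSmooth ∧ (I.Gamma F).IsIrred ∧
    -- `Γ` is an iterated tower of Grassmannian and symplectic Grassmannian bundles
    (∀ p ∈ I.positions,
      (p.2 < I.z p.1 →
        IsFibreBundle (I.forgetEntry F p)
          (gr 1 (Fin (I.dim (p.1, p.2 + 1) + 1 - I.dim p) → ℂ))) ∧
      (p.2 = I.z p.1 → p.1 ≤ I.s →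
        IsFibreBundle (I.forgetEntry F p) (gr 1 (Fin (I.a p.1 + 1 - I.dim p) → ℂ))) ∧
      (p.2 = I.z p.1 → I.s < p.1 →
        IsFibreBundle (I.forgetEntry F p) (sg 1 (stdSymp (m + 1 - I.dim p))))) ∧
    -- the forgetful map is a resolution of singularities, an isomorphism over the Schubert cell
    ∃ h : ∀ D : I.Gamma F, I.lastEntry hk F D ∈ I.schubertVariety F,
      IsResolution (X := I.Gamma F) (Y := I.Sigma F) (fun D => ⟨I.lastEntry hk F D, h D⟩) ∧
      I.schubertCell F ⊆ I.schubertVariety F ∧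
      IsOpen[(I.Sigma F).top] {Λ : I.Sigma F | Λ.1 ∈ I.schubertCell F} ∧
      @Dense (I.Sigma F) (I.Sigma F).top {Λ : I.Sigma F | Λ.1 ∈ I.schubertCell F} ∧
      IsIsomorphismOver (X := I.Gamma F) (Y := I.Sigma F)
        (fun D => ⟨I.lastEntry hk F D, h D⟩) {Λ : I.Sigma F | Λ.1 ∈ I.schubertCell F} := by
  have h := SchubertIndex.gamma_properties hω hω' hV I F
  exact ⟨SchubertIndex.isClosed_diagrams I F, h.1.isSmooth, h.2.1,
    fun p hp => SchubertIndex.isFibreBundle_tower hω hω' hV F hp,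
    SchubertIndex.lastEntry_mem hω hω' hV hk,
    SchubertIndex.isResolution_projection hω hω' hV hk _,
    SchubertIndex.schubertCell_subset_schubertVariety, SchubertIndex.isOpen_schubertCell,
    SchubertIndex.dense_schubertCell hω hω' hV hk,
    SchubertIndex.isIsomorphismOver_schubertCell hω hω' hV hk _⟩
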